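/- **Duals of the sixteen quantum two-dimensional centrally extended Galilei groups.** Let $c,c_1,c_2,c_3$ be complex deformation parameters (they stand for $1/\chi,1/\chi_1,1/\chi_2,1/\chi_3$; the case of real $\chi$'s is included). For each of the sixteen cases let $\mathcal A$ be the unital $\mathbb C$-algebra generated by $m,\tau,v,a$ with $[v,\tau]=0$ and the commutators (those not listed vanish) 1. $[\tau,a]=icv$, $[\tau,m]=-\frac i2cv^2$, $[a,m]=-\frac i6cv^3$ 2. $[v,m]=icv$, $[a,m]=ica$ 3. $[\tau,m]=icv$, $[a,m]=\frac i2cv^2$ 4. $[a,m]=-ic\tau$ 5. $[a,m]=icv$ 6. $[v,m]=ic_1v$, $[a,m]=ic_1a+ic_2v$ 7. $[v,m]=ic_1v$, $[\tau,a]=ic_2v$, $[\tau,m]=-\frac i2c_2v^2$, $[a,m]=ic_1a-\frac i6c_2v^3$ 8. $[\tau,m]=ic_1v$, $[a,m]=\frac i2c_1v^2-ic_2\tau$ 9. $[v,a]=ic_1v$, $[v,m]=-\frac i2c_1v^2$, $[\tau,m]=ic_2v$, $[a,m]=ic_3v-ic_1m+\frac i2c_2v^2$ 10. $[\tau,a]=ic_1v$,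 $[\tau,m]=-\frac i2c_1v^2$, $[a,m]=-ic_2\tau-\frac i6c_1v^3$ 11. $[\tau,m]=-ic_1\tau$, $[a,m]=-ic_2\tau-ic_1a$ 12. $[v,m]=ic_1v$, $[\tau,m]=-ic_2\tau$, $[a,m]=i(c_1-c_2)a$ 13. $[v,m]=ic_1v$, $[\tau,m]=ic_1\tau+ic_2v$, $[a,m]=2ic_1a+\frac i2c_2v^2$ 14. $[v,m]=-ic_1\tau$, $[\tau,m]=-ic_2\tau$, $[a,m]=-ic_2a-\frac i2c_1\tau^2+ic_3v$ 15. $[v,m]=-ic_1\tau$, $[\tau,m]=-ic_2\tau+ic_3v$, $[a,m]=-ic_2a-\frac i2c_1\tau^2+\frac i2c_3v^2$ 16. $[\tau,a]=-ic\tau$, $[\tau,m]=ica$, $[a,m]=-icm$ $\mathcal A$ is a Hopf algebra with $\Delta m=m\otimes1+1\otimes m-\frac12v^2\otimes\tau-v\otimes a$, $\Delta\tau=\tau\otimes1+1\otimes\tau$, $\Delta v=v\otimes1+1\otimes v$, $\Delta a=a\otimes1+1\otimes a+v\otimes\tau$, $\varepsilon(m)=\varepsilon(\tau)=\varepsilon(v)=\varepsilon(a)=0$,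 $S(m)=-m+\frac12v^2\tau-va$, $S(\tau)=-\tau$, $S(v)=-v$, $S(a)=-a+v\tau$. On the linear dual $\mathcal A^*$ put $\langle XY,\varphi\rangle=\langle X\otimes Y,\Delta\varphi\rangle$, unit $1=\varepsilon$; let $\Delta X\in(\mathcal A\otimes\mathcal A)^*$ be $\langle\Delta X,\varphi\otimes\psi\rangle=\langle X,\varphi\psi\rangle$, and let $\langle SX,\varphi\rangle=\langle X,S\varphi\rangle$, $\varepsilon(X)=\langle X,1\rangle$. Assume that the denominators occurring below are non-zero: $c\ne0$ in cases 2, 16; $c_1\neq0$ in cases 6, 7, 9, 11, 13; $2c_1\ne c_2$ in case 12; $c_2\ne0$ in case 14; $c_2^2\ne4c_1c_3$ and $2c_2^2+c_1c_3\neq0$ in case 15; nothing in the other cases. Then the monomials $m^\alpha\tau^\beta v^\sigma a^\gamma$ ($\alpha,\beta,\gamma,\sigma\ge0$) span $\mathcal A$. If a functional $X$ on $\mathcal A$ or on $\mathcal A\otimes\mathcal A$ vanishes at the unit, then for each $\varphi$ one has $\langle X^n,\varphi\rangle=0$ for all large $n$, so all power series below converge pointwise. There are (necessarily unique) functionals $M,H,P,K$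 on $\mathcal A$ that vanish on all these monomials except for $$\langle M,m\rangle=-i,\quad\langle H,\tau\rangle=i,\quad\langle P,a\rangle=-i,\quad\langle K,v\rangle=-i .$$ Their counits vanish, $\varepsilon(M)=\varepsilon(H)=\varepsilon(P)=\varepsilon(K)=0$, and their commutators, coproducts and antipodes are as follows. Wherever a case lists no other value, one has $$[K,P]=iM,\quad[K,H]=iP,\quad[K,M]=[H,P]=[M,P]=[M,H]=0,\quad \Delta X=1\otimes X+X\otimes1,\quad S(X)=-X\qquad(X=M,H,P,K).$$ 1. $\Delta K=1\otimes K+K\otimes1-cP\otimes H$; $S(K)=-K-cPH$. 2. $[K,P]=\frac{i}{2c}(1-e^{-2cM})$; $\Delta P=1\otimes P+P\otimes e^{-cM}$, $\Delta K=1\otimes K+K\otimes e^{-cM}$; $S(P)=-Pe^{cM}$, $S(K)=-Ke^{cM}$. 3. $\Delta K=1\otimes K+K\otimes1+cH\otimes M$; $S(K)=-K+cHM$. 4. $[K,H]=iP-\frac i2cM^2$; $\Delta H=1\otimes H+H\otimes1-cP\otimes M$; $S(H)=-H-cPM$. 5. $\Delta K=1\otimes K+K\otimes1-cP\otimes M$;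 $S(K)=-K-cPM$. 6. $[K,P]=\frac{i}{2c_1}(1-e^{-2c_1M})$; $\Delta P=1\otimes P+P\otimes e^{-c_1M}$, $\Delta K=1\otimes K+K\otimes e^{-c_1M}-c_2P\otimes Me^{-c_1M}$; $S(P)=-Pe^{c_1M}$, $S(K)=-Ke^{c_1M}-c_2PMe^{c_1M}$. 7. $[K,P]=\frac{i}{2c_1}(1-e^{-2c_1M})$; $\Delta P=1\otimes P+P\otimes e^{-c_1M}$, $\Delta K=1\otimes K+K\otimes e^{-c_1M}-c_2P\otimes He^{-c_1M}$; $S(P)=-Pe^{c_1M}$, $S(K)=-Ke^{c_1M}-c_2PHe^{c_1M}$. 8. $[K,H]=iP-\frac i2c_2M^2$; $\Delta H=1\otimes H+H\otimes1-c_2P\otimes M$, $\Delta K=1\otimes K+K\otimes1+c_1H\otimes M-\frac12c_1c_2P\otimes M^2$; $S(H)=-H-c_2PM$, $S(K)=-K+c_1HM+\frac12c_1c_2PM^2$. 9. $[K,M]=\frac i2c_1M^2$, $[K,H]=-\frac{i}{c_1}(1-e^{c_1P})$; $\Delta M=e^{c_1P}\otimes M+M\otimes1$, $\Delta K=e^{c_1P}\otimes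 K+K\otimes1+c_2He^{c_1P}\otimes M-c_3Pe^{c_1P}\otimes M$; $S(M)=-Me^{-c_1P}$, $S(K)=-e^{-c_1P}K+c_2HMe^{-c_1P}-c_3PMe^{-c_1P}$. 10. $[K,H]=iP-\frac i2c_2M^2$; $\Delta H=1\otimes H+H\otimes1-c_2P\otimes M$, $\Delta K=1\otimes K+K\otimes1+\frac12c_1c_2P^2\otimes M-c_1P\otimes H$; $S(H)=-H-c_2PM$, $S(K)=-K-c_1PH-\frac12c_1c_2MP^2$. 11. $[K,H]=iP-\frac{ic_2}{c_1}Me^{c_1M}+\frac{ic_2}{c_1^2}(e^{c_1M}-1)$, $[K,P]=\frac{i}{c_1}(e^{c_1M}-1)$; $\Delta H=1\otimes H+H\otimes e^{c_1M}-c_2P\otimes Me^{c_1M}$, $\Delta P=1\otimes P+P\otimes e^{c_1M}$; $S(H)=-He^{-c_1M}-c_2PMe^{-c_1M}$, $S(P)=-Pe^{-c_1M}$. 12. $[K,P]=\frac{i}{2c_1-c_2}(1-e^{-(2c_1-c_2)M})$; $\Delta H=1\otimes H+H\otimes e^{c_2M}$, $\Delta P=1\otimes P+P\otimes e^{(c_2-c_1)M}$,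 $\Delta K=1\otimes K+K\otimes e^{-c_1M}$; $S(H)=-He^{-c_2M}$, $S(P)=-Pe^{(c_1-c_2)M}$, $S(K)=-Ke^{c_1M}$. 13. $[K,P]=\frac{i}{3c_1}(1-e^{-3c_1M})$; $\Delta H=1\otimes H+H\otimes e^{-c_1M}$, $\Delta P=1\otimes P+P\otimes e^{-2c_1M}$, $\Delta K=1\otimes K+K\otimes e^{-c_1M}+c_2H\otimes Me^{-c_1M}$; $S(H)=-He^{c_1M}$, $S(P)=-Pe^{2c_1M}$, $S(K)=-Ke^{c_1M}+c_2HMe^{c_1M}$. 14. $[K,H]=iP+\frac{ic_1c_3}{c_2^2}Me^{c_2M}-\frac{ic_1c_3}{2c_2^3}(e^{2c_2M}-1)$, $[K,P]=\frac{i}{c_2}(e^{c_2M}-1)$, $[H,P]=-\frac{ic_1}{2c_2^2}(e^{2c_2M}-1)+\frac{ic_1}{c_2^2}(e^{c_2M}-1)$; $\Delta H=1\otimes H+H\otimes e^{c_2M}-\frac{c_1}{c_2}K\otimes e^{c_2M}+\frac{c_1}{c_2}K\otimes1+\frac{c_1c_3}{c_2}P\otimes Me^{c_2M}+\frac{c_1c_3}{c_2^2}P\otimes1-\frac{c_1c_3}{c_2^2}P\otimes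 e^{c_2M}$, $\Delta P=1\otimes P+P\otimes e^{c_2M}$, $\Delta K=1\otimes K+K\otimes1+\frac{c_3}{c_2}P\otimes1-\frac{c_3}{c_2}P\otimes e^{c_2M}$; $S(H)=-He^{-c_2M}-\frac{c_1}{c_2}K+\frac{c_1}{c_2}Ke^{-c_2M}+\frac{c_1c_3}{c_2^2}Pe^{-c_2M}-\frac{c_1c_3}{c_2^2}P+\frac{c_1c_3}{c_2}PMe^{-c_2M}$, $S(P)=-Pe^{-c_2M}$, $S(K)=-K+\frac{c_3}{c_2}Pe^{-c_2M}-\frac{c_3}{c_2}P$. 15. With $r=\sqrt{c_2^2-4c_1c_3}$ (principal complex root; the formulas are even in $r$) and $\rho_\pm=\frac32c_2\pm\frac12r$: $[K,P]=\frac{i(-c_2+r)}{2r\rho_+}(e^{\rho_+M}-1)+\frac{i(c_2+r)}{2r\rho_-}(e^{\rho_-M}-1)$, $[H,P]=\frac{ic_1}{r\rho_-}(e^{\rho_-M}-1)-\frac{ic_1}{r\rho_+}(e^{\rho_+M}-1)$; $\Delta H=1\otimes H+H\otimes e^{\frac12c_2M}[\cosh(-\frac r2M)-\frac{c_2}{r}\sinh(-\frac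 r2M)]+\frac{2c_1}{r}K\otimes e^{\frac12c_2M}\sinh(-\frac r2M)$, $\Delta P=1\otimes P+P\otimes e^{c_2M}$, $\Delta K=1\otimes K+K\otimes e^{\frac12c_2M}[\cosh(-\frac r2M)+\frac{c_2}{r}\sinh(-\frac r2M)]-\frac{2c_3}{r}H\otimes e^{\frac12c_2M}\sinh(-\frac r2M)$; $S(H)=-He^{-\frac12c_2M}[\cosh(\frac r2M)-\frac{c_2}{r}\sinh(\frac r2M)]-\frac{2c_1}{r}Ke^{-\frac12c_2M}\sinh(\frac r2M)$, $S(P)=-Pe^{-c_2M}$, $S(K)=-Ke^{-\frac12c_2M}[\cosh(\frac r2M)+\frac{c_2}{r}\sinh(\frac r2M)]+\frac{2c_3}{r}He^{-\frac12c_2M}\sinh(\frac r2M)$. 16. $[K,M]=\frac i2cM^2$, $[K,H]=\frac ic(1-e^{-cP})-icMH$; $\Delta M=M\otimes1+\dfrac{e^{cP}\otimes M}{1-\frac12c^2He^{cP}\otimes M}$, $\Delta H=e^{-cP}\otimes H+H\otimes1-c^2H\otimes MH+\frac14c^4H^2e^{cP}\otimes M^2H-\frac12c^2H^2e^{cP}\otimes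 M$, $\Delta P=1\otimes P+P\otimes1-\frac2c\ln(1-\frac12c^2He^{cP}\otimes M)$; $S(M)=\dfrac{-Me^{-cP}}{1-\frac12c^2MH}$, $S(H)=-He^{cP}+\frac12c^2MH^2e^{cP}$, $S(P)=-P+\frac2c\ln\dfrac{1}{1-\frac12c^2HM}$. -/

import Mathlib

open scoped TensorProduct

noncomputable section

namespace QuantumGalilei

open Complex (I)

/-- The four generators (coordinate functions) of the quantum Galilei groups. -/
inductive Gen
  | m | τ | v | a

/-- The right-hand sides of the commutators `[v,a]`, `[v,m]`, `[τ,a]`, `[τ,m]`, `[a,m]`. -/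
structure Brackets (B : Type*) where
  va : B
  vm : B
  τa : B
  τm : B
  am : B

/-- The sixteen families of quantum groups with their deformation parameters. The parameters
`c`, `c₁`, `c₂`, `c₃` stand for `1 / χ`, `1 / χ₁`, `1 / χ₂`, `1 / χ₃`. -/
inductive Case
  | case1 (c : ℂ)
  | case2 (c : ℂ)
  | case3 (c : ℂ)
  | case4 (c : ℂ)
  | case5 (c : ℂ)
  | case6 (c₁ c₂ : ℂ)
  | case7 (c₁ c₂ : ℂ)
  | case8 (c₁ c₂ : ℂ)
  | case9 (c₁ c₂ c₃ : ℂ)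
  | case10 (c₁ c₂ : ℂ)
  | case11 (c₁ c₂ : ℂ)
  | case12 (c₁ c₂ : ℂ)
  | case13 (c₁ c₂ : ℂ)
  | case14 (c₁ c₂ c₃ : ℂ)
  | case15 (c₁ c₂ c₃ : ℂ)
  | case16 (c : ℂ)

/-- The table of commutators of the sixteen quantum groups, read in an arbitrary algebra. -/
def Case.brackets {B : Type*} [Ring B] [Algebra ℂ B] (q : Case) (m τ v a : B) : Brackets B :=
  match q with
  | case1 c =>
    { va := 0, vm := 0, τa := (I * c) • v, τm := -(1 / 2 * I * c) • v ^ 2,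
      am := -(1 / 6 * I * c) • v ^ 3 }
  | case2 c => { va := 0, vm := (I * c) • v, τa := 0, τm := 0, am := (I * c) • a }
  | case3 c => { va := 0, vm := 0, τa := 0, τm := (I * c) • v, am := (1 / 2 * I * c) • v ^ 2 }
  | case4 c => { va := 0, vm := 0, τa := 0, τm := 0, am := -(I * c) • τ }
  | case5 c => { va := 0, vm := 0, τa := 0, τm := 0, am := (I * c) • v }
  | case6 c₁ c₂ =>
    { va := 0, vm := (I * c₁) • v, τa := 0, τm := 0, am := (I * c₁) • a + (I * c₂) • v }
  | case7 c₁ c₂ =>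
    { va := 0, vm := (I * c₁) • v, τa := (I * c₂) • v, τm := -(1 / 2 * I * c₂) • v ^ 2,
      am := (I * c₁) • a - (1 / 6 * I * c₂) • v ^ 3 }
  | case8 c₁ c₂ =>
    { va := 0, vm := 0, τa := 0, τm := (I * c₁) • v,
      am := (1 / 2 * I * c₁) • v ^ 2 - (I * c₂) • τ }
  | case9 c₁ c₂ c₃ =>
    { va := (I * c₁) • v, vm := -(1 / 2 * I * c₁) • v ^ 2, τa := 0, τm := (I * c₂) • v,
      am := (I * c₃) • v - (I * c₁) • m + (1 / 2 * I * c₂) • v ^ 2 }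
  | case10 c₁ c₂ =>
    { va := 0, vm := 0, τa := (I * c₁) • v, τm := -(1 / 2 * I * c₁) • v ^ 2,
      am := -(I * c₂) • τ - (1 / 6 * I * c₁) • v ^ 3 }
  | case11 c₁ c₂ =>
    { va := 0, vm := 0, τa := 0, τm := -(I * c₁) • τ, am := -(I * c₂) • τ - (I * c₁) • a }
  | case12 c₁ c₂ =>
    { va := 0, vm := (I * c₁) • v, τa := 0, τm := -(I * c₂) • τ, am := (I * (c₁ - c₂)) • a }
  | case13 c₁ c₂ =>
    { va := 0, vm := (I * c₁) • v, τa := 0, τm := (I * c₁) • τ + (I * c₂) • v,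
      am := (2 * I * c₁) • a + (1 / 2 * I * c₂) • v ^ 2 }
  | case14 c₁ c₂ c₃ =>
    { va := 0, vm := -(I * c₁) • τ, τa := 0, τm := -(I * c₂) • τ,
      am := -(I * c₂) • a - (1 / 2 * I * c₁) • τ ^ 2 + (I * c₃) • v }
  | case15 c₁ c₂ c₃ =>
    { va := 0, vm := -(I * c₁) • τ, τa := 0, τm := -(I * c₂) • τ + (I * c₃) • v,
      am := -(I * c₂) • a - (1 / 2 * I * c₁) • τ ^ 2 + (1 / 2 * I * c₃) • v ^ 2 }
  | case16 c => { va := 0, vm := 0, τa := -(I * c) • τ, τm := (I * c) • a, am := -(I * c) • m }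

/-- The elements `m τ v a` of the algebra `B` satisfy the commutation relations of the case
(`[v, τ] = 0` in all cases). -/
structure Case.Holds {B : Type*} [Ring B] [Algebra ℂ B] (q : Case) (m τ v a : B) : Prop where
  va : v * a - a * v = (q.brackets m τ v a).va
  vm : v * m - m * v = (q.brackets m τ v a).vm
  τa : τ * a - a * τ = (q.brackets m τ v a).τa
  τm : τ * m - m * τ = (q.brackets m τ v a).τm
  am : a * m - m * a = (q.brackets m τ v a).am
  vτ : v * τ - τ * v = 0

set_option maxHeartbeats 8000000 in
set_option linter.unusedSimpArgs false in
/-- The coproducts of the generators satisfy the relations. -/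
theorem Case.Holds.comul {A : Type*} [Ring A] [Algebra ℂ A] {q : Case} {m τ v a : A}
    (h : q.Holds m τ v a) :
    q.Holds (B := A ⊗[ℂ] A)
      (m ⊗ₜ 1 + 1 ⊗ₜ m - (1 / 2 : ℂ) • (v ^ 2) ⊗ₜ τ - v ⊗ₜ a)
      (τ ⊗ₜ 1 + 1 ⊗ₜ τ) (v ⊗ₜ 1 + 1 ⊗ₜ v) (a ⊗ₜ 1 + 1 ⊗ₜ a + v ⊗ₜ τ) := by
  obtain ⟨hva, hvm, hτa, hτm, ham, hvτ⟩ := h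
  cases q
  all_goals
    simp only [Case.brackets] at hva hvm hτa hτm ham hvτ
    have e1 : a * v = v * a - (v * a - a * v) := by abel
    have e2 : v * m = m * v + (v * m - m * v) := by abel
    have e3 : a * τ = τ * a - (τ * a - a * τ) := by abel
    have e4 : τ * m = m * τ + (τ * m - m * τ) := by abel
    have e5 : a * m = m * a + (a * m - m * a) := by abel
    have e6 : v * τ = τ * v + (v * τ - τ * v) := by abel
    rw [hva] at e1
    rw [hvm] at e2
    rw [hτa] at e3
    rw [hτm] at e4
    rw [ham] at e5
    rw [hvτ] at e6
    clear hva hvm hτa hτm ham hvτ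
    have f1 : ∀ x, a * (v * x) = _ := fun x => by rw [← mul_assoc, e1]
    have f2 : ∀ x, v * (m * x) = _ := fun x => by rw [← mul_assoc, e2]
    have f3 : ∀ x, a * (τ * x) = _ := fun x => by rw [← mul_assoc, e3]
    have f4 : ∀ x, τ * (m * x) = _ := fun x => by rw [← mul_assoc, e4]
    have f5 : ∀ x, a * (m * x) = _ := fun x => by rw [← mul_assoc, e5]
    have f6 : ∀ x, v * (τ * x) = _ := fun x => by rw [← mul_assoc, e6]
    constructor
    all_goals
      simp only [Case.brackets, pow_succ, pow_zero, one_mul, mul_one, add_mul, mul_add, sub_mul, mul_sub,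
        Algebra.TensorProduct.tmul_mul_tmul, mul_assoc, smul_mul_assoc, mul_smul_comm,
        neg_smul, neg_mul, mul_neg, mul_zero, zero_mul, add_zero, sub_zero,
        e1, e2, e3, e4, e5, e6, f1, f2, f3, f4, f5, f6,
        TensorProduct.tmul_add, TensorProduct.add_tmul, TensorProduct.tmul_sub,
        TensorProduct.sub_tmul, TensorProduct.tmul_smul, ← TensorProduct.smul_tmul',
        TensorProduct.tmul_neg, TensorProduct.neg_tmul, TensorProduct.tmul_zero, TensorProduct.zero_tmul, smul_add, smul_sub, smul_neg, smul_zero]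
      module

set_option maxHeartbeats 8000000 in
set_option linter.unusedSimpArgs false in
/-- The antipodes of the generators satisfy the relations in the opposite algebra. -/
theorem Case.Holds.antipode {A : Type*} [Ring A] [Algebra ℂ A] {q : Case} {m τ v a : A}
    (h : q.Holds m τ v a) :
    q.Holds (B := Aᵐᵒᵖ)
      (.op (-m + (1 / 2 : ℂ) • (v ^ 2 * τ) - v * a)) (.op (-τ)) (.op (-v)) (.op (-a + v * τ)) := by
  obtain ⟨hva, hvm, hτa, hτm, ham, hvτ⟩ := h
  cases q
  all_goals
    simp only [Case.brackets] at hva hvm hτa hτm ham hvτ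
    have e1 : a * v = v * a - (v * a - a * v) := by abel
    have e2 : v * m = m * v + (v * m - m * v) := by abel
    have e3 : a * τ = τ * a - (τ * a - a * τ) := by abel
    have e4 : τ * m = m * τ + (τ * m - m * τ) := by abel
    have e5 : a * m = m * a + (a * m - m * a) := by abel
    have e6 : v * τ = τ * v + (v * τ - τ * v) := by abel
    rw [hva] at e1
    rw [hvm] at e2
    rw [hτa] at e3
    rw [hτm] at e4
    rw [ham] at e5
    rw [hvτ] at e6
    clear hva hvm hτa hτm ham hvτ
    have f1 : ∀ x, a * (v * x) = _ := fun x => by rw [← mul_assoc, e1]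
    have f2 : ∀ x, v * (m * x) = _ := fun x => by rw [← mul_assoc, e2]
    have f3 : ∀ x, a * (τ * x) = _ := fun x => by rw [← mul_assoc, e3]
    have f4 : ∀ x, τ * (m * x) = _ := fun x => by rw [← mul_assoc, e4]
    have f5 : ∀ x, a * (m * x) = _ := fun x => by rw [← mul_assoc, e5]
    have f6 : ∀ x, v * (τ * x) = _ := fun x => by rw [← mul_assoc, e6]
    constructor
    all_goals
      apply MulOpposite.unop_injective
      simp only [Case.brackets, MulOpposite.unop_sub, MulOpposite.unop_add, MulOpposite.unop_neg,
        MulOpposite.unop_mul, MulOpposite.unop_op, MulOpposite.unop_smul, MulOpposite.unop_pow,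
        MulOpposite.unop_zero, pow_succ, pow_zero, one_mul, mul_one, add_mul, mul_add, sub_mul,
        mul_sub, mul_assoc, smul_mul_assoc, mul_smul_comm, neg_smul, neg_mul, mul_neg, mul_zero,
        zero_mul, add_zero, sub_zero, neg_neg,
        e1, e2, e3, e4, e5, e6, f1, f2, f3, f4, f5, f6, smul_add, smul_sub, smul_neg, smul_zero]
      module

theorem Case.Holds.counit (q : Case) : q.Holds (B := ℂ) 0 0 0 0 := by
  constructor <;> cases q <;> simp [Case.brackets]

/-- The defining relations of the case, in the free algebra on the four generators. -/
inductive Case.Rel (q : Case) : FreeAlgebra ℂ Gen → FreeAlgebra ℂ Gen → Prop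
  | va : Rel q (.ι ℂ .v * .ι ℂ .a - .ι ℂ .a * .ι ℂ .v)
      (q.brackets (.ι ℂ .m) (.ι ℂ .τ) (.ι ℂ .v) (.ι ℂ .a)).va
  | vm : Rel q (.ι ℂ .v * .ι ℂ .m - .ι ℂ .m * .ι ℂ .v)
      (q.brackets (.ι ℂ .m) (.ι ℂ .τ) (.ι ℂ .v) (.ι ℂ .a)).vm
  | τa : Rel q (.ι ℂ .τ * .ι ℂ .a - .ι ℂ .a * .ι ℂ .τ)
      (q.brackets (.ι ℂ .m) (.ι ℂ .τ) (.ι ℂ .v) (.ι ℂ .a)).τa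
  | τm : Rel q (.ι ℂ .τ * .ι ℂ .m - .ι ℂ .m * .ι ℂ .τ)
      (q.brackets (.ι ℂ .m) (.ι ℂ .τ) (.ι ℂ .v) (.ι ℂ .a)).τm
  | am : Rel q (.ι ℂ .a * .ι ℂ .m - .ι ℂ .m * .ι ℂ .a)
      (q.brackets (.ι ℂ .m) (.ι ℂ .τ) (.ι ℂ .v) (.ι ℂ .a)).am
  | vτ : Rel q (.ι ℂ .v * .ι ℂ .τ - .ι ℂ .τ * .ι ℂ .v) 0

/-- The quantum Galilei group: the algebra generated by `m τ v a` with the commutation relations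
of the case. -/
def QGalilei (q : Case) : Type := RingQuot q.Rel

namespace QGalilei

instance instRing (q : Case) : Ring (QGalilei q) := inferInstanceAs (Ring (RingQuot q.Rel))
instance instAlgebra (q : Case) : Algebra ℂ (QGalilei q) := inferInstanceAs (Algebra ℂ (RingQuot q.Rel))

variable (q : Case)

/-- The quotient map from the free algebra. -/
def mk : FreeAlgebra ℂ Gen →ₐ[ℂ] QGalilei q := RingQuot.mkAlgHom ℂ q.Rel

/-- The image of a generator. -/
def gen (g : Gen) : QGalilei q := mk q (.ι ℂ g)

def m : QGalilei q := gen q .m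
def τ : QGalilei q := gen q .τ
def v : QGalilei q := gen q .v
def a : QGalilei q := gen q .a

variable {q}

theorem holds_of_rel {B : Type*} [Ring B] [Algebra ℂ B] (f : FreeAlgebra ℂ Gen →ₐ[ℂ] B)
    (h : ∀ x y, q.Rel x y → f x = f y) :
    q.Holds (f (.ι ℂ .m)) (f (.ι ℂ .τ)) (f (.ι ℂ .v)) (f (.ι ℂ .a)) := by
  have h1 := h _ _ .va
  have h2 := h _ _ .vm
  have h3 := h _ _ .τa
  have h4 := h _ _ .τm
  have h5 := h _ _ .am
  have h6 := h _ _ .vτ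
  constructor <;> simp only [← map_mul, ← map_sub, h1, h2, h3, h4, h5, h6, map_zero] <;>
    cases q <;> simp [Case.brackets]

theorem holds (q : Case) : q.Holds (m q) (τ q) (v q) (a q) :=
  holds_of_rel (mk q) fun _ _ h => RingQuot.mkAlgHom_rel ℂ h

/-- The universal property of the presentation. -/
def lift {B : Type*} [Ring B] [Algebra ℂ B] {m τ v a : B} (h : q.Holds m τ v a) :
    QGalilei q →ₐ[ℂ] B :=
  RingQuot.liftAlgHom ℂ (s := q.Rel)
    ⟨FreeAlgebra.lift ℂ fun | .m => m | .τ => τ | .v => v | .a => a, by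
      obtain ⟨hva, hvm, hτa, hτm, ham, hvτ⟩ := h
      intro x y hxy
      cases hxy <;> simp only [map_sub, map_mul, FreeAlgebra.lift_ι_apply, map_zero, *] <;>
        cases q <;> simp [Case.brackets]⟩

section
variable {B : Type*} [Ring B] [Algebra ℂ B] {m' τ' v' a' : B} (h : q.Holds m' τ' v' a')

theorem lift_gen (g : Gen) :
    lift h (gen q g) = match g with | .m => m' | .τ => τ' | .v => v' | .a => a' := by
  unfold lift gen mk
  erw [RingQuot.liftAlgHom_mkAlgHom_apply]
  simp

@[simp] theorem lift_m : lift h (m q) = m' := lift_gen h _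
@[simp] theorem lift_τ : lift h (τ q) = τ' := lift_gen h _
@[simp] theorem lift_v : lift h (v q) = v' := lift_gen h _
@[simp] theorem lift_a : lift h (a q) = a' := lift_gen h _

theorem algHom_ext {f g : QGalilei q →ₐ[ℂ] B} (hm : f (m q) = g (m q)) (hτ : f (τ q) = g (τ q))
    (hv : f (v q) = g (v q)) (ha : f (a q) = g (a q)) : f = g := by
  refine RingQuot.ringQuot_ext' ℂ f g (FreeAlgebra.hom_ext (funext fun x => ?_))
  cases x
  exacts [hm, hτ, hv, ha]

theorem induction {p : QGalilei q → Prop} (hm : p (m q)) (hτ : p (τ q)) (hv : p (v q)) (ha : p (a q))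
    (hc : ∀ c : ℂ, p (algebraMap ℂ _ c)) (hadd : ∀ x y, p x → p y → p (x + y))
    (hmul : ∀ x y, p x → p y → p (x * y)) (x : QGalilei q) : p x := by
  obtain ⟨y, rfl⟩ := RingQuot.mkAlgHom_surjective ℂ q.Rel x
  change p (mk q y)
  induction y using FreeAlgebra.induction with
  | grade0 r => rw [AlgHom.commutes]; exact hc r
  | grade1 g => cases g; exacts [hm, hτ, hv, ha]
  | mul x y hx hy => rw [map_mul]; exact hmul _ _ hx hy
  | add x y hx hy => rw [map_add]; exact hadd _ _ hx hy

end

/-- The coalgebra structure: the algebra homomorphisms `Δ` and `ε` with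
`Δ m = m ⊗ 1 + 1 ⊗ m - (1/2) v² ⊗ τ - v ⊗ a`, `Δ τ = τ ⊗ 1 + 1 ⊗ τ`, `Δ v = v ⊗ 1 + 1 ⊗ v`,
`Δ a = a ⊗ 1 + 1 ⊗ a + v ⊗ τ`, and `ε = 0` on the generators. -/
instance instBialgebra : Bialgebra ℂ (QGalilei q) :=
  .ofAlgHom (lift (holds q).comul) (lift (.counit q))
    (by
      have hs : ∀ (c : ℂ) (x : QGalilei q ⊗[ℂ] QGalilei q),
          (c • x) ⊗ₜ[ℂ] (1 : QGalilei q) = c • x ⊗ₜ[ℂ] (1 : QGalilei q) :=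
        fun c x => (TensorProduct.smul_tmul' c x _).symm
      apply algHom_ext <;>
        simp [hs, TensorProduct.tmul_add, TensorProduct.add_tmul, TensorProduct.tmul_sub,
          TensorProduct.sub_tmul, pow_two, mul_add, add_mul, Algebra.TensorProduct.one_def] <;>
        module)
    (by
      apply algHom_ext <;> simp)
    (by
      apply algHom_ext <;> simp)

theorem comul_eq (x : QGalilei q) : Coalgebra.comul (R := ℂ) x = lift (holds q).comul x := rfl
theorem counit_eq (x : QGalilei q) : Coalgebra.counit (R := ℂ) x = lift (.counit q) x := rfl

variable (q) in
/-- The antipode as a homomorphism to the opposite algebra. -/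
def antipodeHom : QGalilei q →ₐ[ℂ] (QGalilei q)ᵐᵒᵖ := lift (holds q).antipode

variable (q) in
/-- The antipode as a linear map. -/
def antipodeLin : QGalilei q →ₗ[ℂ] QGalilei q :=
  (MulOpposite.opLinearEquiv ℂ).symm.toLinearMap ∘ₗ (antipodeHom q).toLinearMap


theorem antipodeLin_mul (x y : QGalilei q) :
    antipodeLin q (x * y) = antipodeLin q y * antipodeLin q x := by
  simp [antipodeLin]

theorem antipodeLin_algebraMap (c : ℂ) :
    antipodeLin q (algebraMap ℂ _ c) = algebraMap ℂ _ c := by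
  simp [antipodeLin, AlgHom.commutes]

@[simp] theorem antipodeLin_one : antipodeLin q 1 = 1 := by
  simp [antipodeLin]

@[simp] theorem antipodeLin_m :
    antipodeLin q (m q) = -m q + (1 / 2 : ℂ) • (v q ^ 2 * τ q) - v q * a q := by
  simp [antipodeLin, antipodeHom]

@[simp] theorem antipodeLin_τ : antipodeLin q (τ q) = -τ q := by simp [antipodeLin, antipodeHom]
@[simp] theorem antipodeLin_v : antipodeLin q (v q) = -v q := by simp [antipodeLin, antipodeHom]
@[simp] theorem antipodeLin_a : antipodeLin q (a q) = -a q + v q * τ q := by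
  simp [antipodeLin, antipodeHom]

theorem antipode_left (x : QGalilei q) :
    LinearMap.mul' ℂ _ ((antipodeLin q).rTensor _ (lift (holds q).comul x)) =
      algebraMap ℂ _ (lift (.counit q) x) := by
  have key : ∀ (z : QGalilei q ⊗[ℂ] QGalilei q) (y₁ y₂ : QGalilei q),
      LinearMap.mul' ℂ _ ((antipodeLin q).rTensor _ (z * y₁ ⊗ₜ y₂)) =
        antipodeLin q y₁ * LinearMap.mul' ℂ _ ((antipodeLin q).rTensor _ z) * y₂ := by
    intro z y₁ y₂
    induction z with
    | zero => simp
    | tmul a b => simp [antipodeLin_mul, mul_assoc]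
    | add a b ha hb => simp only [add_mul, map_add, mul_add, ha, hb]
  have vτ : v q * τ q = τ q * v q := sub_eq_zero.1 (holds q).vτ
  induction x using induction with
  | hm => simp [pow_two, antipodeLin_mul, TensorProduct.sub_tmul]; abel
  | hτ => simp
  | hv => simp
  | ha => simp
  | hc c => simp [Algebra.TensorProduct.algebraMap_apply, antipodeLin_algebraMap]
  | hadd x y hx hy => simp only [map_add, hx, hy]
  | hmul x y hx hy =>
    have : ∀ w : QGalilei q ⊗[ℂ] QGalilei q,
        LinearMap.mul' ℂ _ ((antipodeLin q).rTensor _ (lift (holds q).comul x * w)) =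
          algebraMap ℂ _ (lift (.counit q) x) *
            LinearMap.mul' ℂ _ ((antipodeLin q).rTensor _ w) := by
      intro w
      induction w with
      | zero => simp
      | tmul y₁ y₂ =>
        rw [key, hx, ← Algebra.commutes, mul_assoc]; simp
      | add a b ha hb => simp only [map_add, mul_add, ha, hb]
    rw [map_mul, this, hy, map_mul, map_mul]

theorem antipode_right (x : QGalilei q) :
    LinearMap.mul' ℂ _ ((antipodeLin q).lTensor _ (lift (holds q).comul x)) =
      algebraMap ℂ _ (lift (.counit q) x) := by
  have key : ∀ (z : QGalilei q ⊗[ℂ] QGalilei q) (y₁ y₂ : QGalilei q),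
      LinearMap.mul' ℂ _ ((antipodeLin q).lTensor _ (y₁ ⊗ₜ y₂ * z)) =
        y₁ * LinearMap.mul' ℂ _ ((antipodeLin q).lTensor _ z) * antipodeLin q y₂ := by
    intro z y₁ y₂
    induction z with
    | zero => simp
    | tmul a b => simp [antipodeLin_mul, mul_assoc]
    | add a b ha hb => simp only [add_mul, map_add, mul_add, ha, hb]
  have vτ : v q * τ q = τ q * v q := sub_eq_zero.1 (holds q).vτ
  induction x using induction with
  | hm => simp [pow_two, mul_add, mul_assoc]; module
  | hτ => simp
  | hv => simp
  | ha => simp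
  | hc c => simp [Algebra.TensorProduct.algebraMap_apply]
  | hadd x y hx hy => simp only [map_add, hx, hy]
  | hmul x y hx hy =>
    have : ∀ w : QGalilei q ⊗[ℂ] QGalilei q,
        LinearMap.mul' ℂ _ ((antipodeLin q).lTensor _ (w * lift (holds q).comul y)) =
          LinearMap.mul' ℂ _ ((antipodeLin q).lTensor _ w) *
            algebraMap ℂ _ (lift (.counit q) y) := by
      intro w
      induction w with
      | zero => simp
      | tmul y₁ y₂ =>
        rw [key, hy, mul_assoc, Algebra.commutes, ← mul_assoc]; simp
      | add a b ha hb => simp only [map_add, add_mul, ha, hb]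
    rw [map_mul, this, hx, map_mul, map_mul]

instance instHopfAlgebra : HopfAlgebra ℂ (QGalilei q) where
  antipode := antipodeLin q
  mul_antipode_rTensor_comul := LinearMap.ext antipode_left
  mul_antipode_lTensor_comul := LinearMap.ext antipode_right


end QGalilei
section Dual

variable {C D : Type*} [AddCommGroup C] [Module ℂ C] [Coalgebra ℂ C]
  [AddCommGroup D] [Module ℂ D] [Coalgebra ℂ D]

/-- The full linear dual of a coalgebra `C`, as an algebra under convolution:
`(X * Y) φ = (X ⊗ Y) (Δ φ)`, with unit the counit of `C`. -/
abbrev Dual (C : Type*) [AddCommGroup C] [Module ℂ C] [Coalgebra ℂ C] : Type _ :=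
  WithConv (C →ₗ[ℂ] ℂ)

/-- `X ⊗ Y` as a functional on `C ⊗ D`: `φ ⊗ ψ ↦ X φ * Y ψ`. -/
def tens (X : Dual C) (Y : Dual D) : Dual (C ⊗[ℂ] D) :=
  .toConv (LinearMap.mul' ℂ ℂ ∘ₗ TensorProduct.map X.ofConv Y.ofConv)

/-- The powers of `X` vanish eventually at each point, so that every formal power series in `X`
converges pointwise in the dual. -/
def LocallyNilpotent (X : Dual C) : Prop := ∀ φ : C, ∃ N : ℕ, ∀ n ≥ N, (X ^ n) φ = 0

theorem LocallyNilpotent.support_finite {X : Dual C} (h : LocallyNilpotent X) (f : ℕ → ℂ) (φ : C) :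
    (Function.support fun n => f n * (X ^ n) φ).Finite := by
  obtain ⟨N, hN⟩ := h φ
  refine (Set.finite_lt_nat N).subset fun n hn => ?_
  by_contra hlt
  exact hn (by simp [hN n (not_lt.1 hlt)])

open Classical in
/-- The power series `∑ n, f n • X ^ n` in the dual, summed pointwise (each evaluation is a finite
sum); only meaningful for locally nilpotent `X`. -/
def series (f : ℕ → ℂ) (X : Dual C) : Dual C :=
  if h : LocallyNilpotent X then
    .toConv
      { toFun := fun φ => ∑ᶠ n, f n * (X ^ n) φ
        map_add' := fun φ ψ => by
          rw [← finsum_add_distrib (h.support_finite f φ) (h.support_finite f ψ)]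
          exact finsum_congr fun n => by rw [map_add, mul_add]
        map_smul' := fun c φ => by
          rw [RingHom.id_apply, smul_finsum' c (h.support_finite f φ)]
          exact finsum_congr fun n => by rw [map_smul, smul_eq_mul, smul_eq_mul, mul_left_comm] }
  else 0

/-- `e ^ X` -/
def exp (X : Dual C) : Dual C := series (fun n => 1 / (n.factorial : ℂ)) X

/-- The hyperbolic cosine `(e ^ X + e ^ (-X)) / 2` -/
def cosh (X : Dual C) : Dual C := (1 / 2 : ℂ) • (exp X + exp (-X))

/-- The hyperbolic sine `(e ^ X - e ^ (-X)) / 2` -/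
def sinh (X : Dual C) : Dual C := (1 / 2 : ℂ) • (exp X - exp (-X))

/-- `1 / (1 - X) = ∑ n, X ^ n` -/
def invOneSub (X : Dual C) : Dual C := series (fun _ => 1) X

/-- `ln (1 - X) = -∑ n ≥ 1, X ^ n / n` -/
def logOneSub (X : Dual C) : Dual C := series (fun n => if n = 0 then 0 else -(1 / (n : ℂ))) X

variable {A : Type*} [Ring A] [HopfAlgebra ℂ A]

/-- The dual coproduct, with values in the functionals on `A ⊗ A`: `Δ X (φ ⊗ ψ) = X (φ * ψ)`. -/
def coproduct (X : Dual A) : Dual (A ⊗[ℂ] A) := .toConv (X.ofConv ∘ₗ LinearMap.mul' ℂ A)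

/-- The dual antipode `S X = X ∘ S`. -/
def antipode (X : Dual A) : Dual A := .toConv (X.ofConv ∘ₗ HopfAlgebra.antipode ℂ)

/-- The dual counit `ε X = X 1`. -/
def counit (X : Dual A) : ℂ := X 1

end Dual

local notation:100 X:100 " ⊠ " Y:101 => tens X Y

/-- The data that describe a Hopf algebra on generators `M`, `H`, `P`, `K`: the six commutators
(`KM` stands for `[K, M]`, and so on), the coproducts and the antipodes of the generators. -/
structure Formulas (D D₂ : Type*) where
  KM : D
  KP : D
  KH : D
  HP : D
  MP : D
  MH : D
  ΔM : D₂
  ΔH : D₂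
  ΔP : D₂
  ΔK : D₂
  SM : D
  SH : D
  SP : D
  SK : D

section Formulas

variable {A : Type*} [Ring A] [HopfAlgebra ℂ A]

/-- The undeformed centrally extended Galilei Lie algebra. -/
def classical (M H P K : Dual A) : Formulas (Dual A) (Dual (A ⊗[ℂ] A)) where
  KM := 0
  KP := I • M
  KH := I • P
  HP := 0
  MP := 0
  MH := 0
  ΔM := 1 ⊠ M + M ⊠ 1
  ΔH := 1 ⊠ H + H ⊠ 1
  ΔP := 1 ⊠ P + P ⊠ 1
  ΔK := 1 ⊠ K + K ⊠ 1
  SM := -M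
  SH := -H
  SP := -P
  SK := -K

/-- A square root of `1 / χ₂ ^ 2 - 4 / (χ₁ * χ₃)`. All formulas that use it are even in it. -/
def root (c₁ c₂ c₃ : ℂ) : ℂ := (c₂ ^ 2 - 4 * c₁ * c₃) ^ (1 / 2 : ℂ)

set_option maxHeartbeats 4000000 in
/-- The quantum Lie algebra of each case. Entries that are not listed are the undeformed ones. -/
def Case.formulas (q : Case) (M H P K : Dual A) : Formulas (Dual A) (Dual (A ⊗[ℂ] A)) :=
  match q with
  | case1 c =>
    { classical M H P K with
      ΔK := 1 ⊠ K + K ⊠ 1 - c • P ⊠ H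
      SK := -K - c • (P * H) }
  | case2 c =>
    { classical M H P K with
      KP := (I / (2 * c)) • (1 - exp (-(2 * c) • M))
      ΔP := 1 ⊠ P + P ⊠ exp (-c • M)
      ΔK := 1 ⊠ K + K ⊠ exp (-c • M)
      SP := -(P * exp (c • M))
      SK := -(K * exp (c • M)) }
  | case3 c =>
    { classical M H P K with
      ΔK := 1 ⊠ K + K ⊠ 1 + c • H ⊠ M
      SK := -K + c • (H * M) }
  | case4 c =>
    { classical M H P K with
      KH := I • P - (I * c / 2) • M ^ 2
      ΔH := 1 ⊠ H + H ⊠ 1 - c • P ⊠ M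
      SH := -H - c • (P * M) }
  | case5 c =>
    { classical M H P K with
      ΔK := 1 ⊠ K + K ⊠ 1 - c • P ⊠ M
      SK := -K - c • (P * M) }
  | case6 c₁ c₂ =>
    { classical M H P K with
      KP := (I / (2 * c₁)) • (1 - exp (-(2 * c₁) • M))
      ΔP := 1 ⊠ P + P ⊠ exp (-c₁ • M)
      ΔK := 1 ⊠ K + K ⊠ exp (-c₁ • M) - c₂ • P ⊠ (M * exp (-c₁ • M))
      SP := -(P * exp (c₁ • M))
      SK := -(K * exp (c₁ • M)) - c₂ • (P * M * exp (c₁ • M)) }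
  | case7 c₁ c₂ =>
    { classical M H P K with
      KP := (I / (2 * c₁)) • (1 - exp (-(2 * c₁) • M))
      ΔP := 1 ⊠ P + P ⊠ exp (-c₁ • M)
      ΔK := 1 ⊠ K + K ⊠ exp (-c₁ • M) - c₂ • P ⊠ (H * exp (-c₁ • M))
      SP := -(P * exp (c₁ • M))
      SK := -(K * exp (c₁ • M)) - c₂ • (P * H * exp (c₁ • M)) }
  | case8 c₁ c₂ =>
    { classical M H P K with
      KH := I • P - (I * c₂ / 2) • M ^ 2
      ΔH := 1 ⊠ H + H ⊠ 1 - c₂ • P ⊠ M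
      ΔK := 1 ⊠ K + K ⊠ 1 + c₁ • H ⊠ M - (c₁ * c₂ / 2) • P ⊠ (M ^ 2)
      SH := -H - c₂ • (P * M)
      SK := -K + c₁ • (H * M) + (c₁ * c₂ / 2) • (P * M ^ 2) }
  | case9 c₁ c₂ c₃ =>
    { classical M H P K with
      KM := (I * c₁ / 2) • M ^ 2
      KH := -(I / c₁) • (1 - exp (c₁ • P))
      ΔM := exp (c₁ • P) ⊠ M + M ⊠ 1
      ΔK := exp (c₁ • P) ⊠ K + K ⊠ 1 + c₂ • (H * exp (c₁ • P)) ⊠ M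
        - c₃ • (P * exp (c₁ • P)) ⊠ M
      SM := -(M * exp (-c₁ • P))
      SK := -(exp (-c₁ • P) * K) + c₂ • (H * M * exp (-c₁ • P))
        - c₃ • (P * M * exp (-c₁ • P)) }
  | case10 c₁ c₂ =>
    { classical M H P K with
      KH := I • P - (I * c₂ / 2) • M ^ 2
      ΔH := 1 ⊠ H + H ⊠ 1 - c₂ • P ⊠ M
      ΔK := 1 ⊠ K + K ⊠ 1 + (c₁ * c₂ / 2) • (P ^ 2) ⊠ M - c₁ • P ⊠ H
      SH := -H - c₂ • (P * M)
      SK := -K - c₁ • (P * H) - (c₁ * c₂ / 2) • (M * P ^ 2) }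
  | case11 c₁ c₂ =>
    { classical M H P K with
      KH := I • P - (I * c₂ / c₁) • (M * exp (c₁ • M)) + (I * c₂ / c₁ ^ 2) • (exp (c₁ • M) - 1)
      KP := (I / c₁) • (exp (c₁ • M) - 1)
      ΔH := 1 ⊠ H + H ⊠ exp (c₁ • M) - c₂ • P ⊠ (M * exp (c₁ • M))
      ΔP := 1 ⊠ P + P ⊠ exp (c₁ • M)
      SH := -(H * exp (-c₁ • M)) - c₂ • (P * M * exp (-c₁ • M))
      SP := -(P * exp (-c₁ • M)) }
  | case12 c₁ c₂ =>
    { classical M H P K with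
      KP := (I / (2 * c₁ - c₂)) • (1 - exp (-(2 * c₁ - c₂) • M))
      ΔH := 1 ⊠ H + H ⊠ exp (c₂ • M)
      ΔP := 1 ⊠ P + P ⊠ exp ((c₂ - c₁) • M)
      ΔK := 1 ⊠ K + K ⊠ exp (-c₁ • M)
      SH := -(H * exp (-c₂ • M))
      SP := -(P * exp ((c₁ - c₂) • M))
      SK := -(K * exp (c₁ • M)) }
  | case13 c₁ c₂ =>
    { classical M H P K with
      KP := (I / (3 * c₁)) • (1 - exp (-(3 * c₁) • M))
      ΔH := 1 ⊠ H + H ⊠ exp (-c₁ • M)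
      ΔP := 1 ⊠ P + P ⊠ exp (-(2 * c₁) • M)
      ΔK := 1 ⊠ K + K ⊠ exp (-c₁ • M) + c₂ • H ⊠ (M * exp (-c₁ • M))
      SH := -(H * exp (c₁ • M))
      SP := -(P * exp ((2 * c₁) • M))
      SK := -(K * exp (c₁ • M)) + c₂ • (H * M * exp (c₁ • M)) }
  | case14 c₁ c₂ c₃ =>
    { classical M H P K with
      KH := I • P + (I * c₁ * c₃ / c₂ ^ 2) • (M * exp (c₂ • M))
        - (I * c₁ * c₃ / (2 * c₂ ^ 3)) • (exp ((2 * c₂) • M) - 1)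
      KP := (I / c₂) • (exp (c₂ • M) - 1)
      HP := -(I * c₁ / (2 * c₂ ^ 2)) • (exp ((2 * c₂) • M) - 1)
        + (I * c₁ / c₂ ^ 2) • (exp (c₂ • M) - 1)
      ΔH := 1 ⊠ H + H ⊠ exp (c₂ • M) - (c₁ / c₂) • K ⊠ exp (c₂ • M) + (c₁ / c₂) • K ⊠ 1
        + (c₁ * c₃ / c₂) • P ⊠ (M * exp (c₂ • M)) + (c₁ * c₃ / c₂ ^ 2) • P ⊠ 1
        - (c₁ * c₃ / c₂ ^ 2) • P ⊠ exp (c₂ • M)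
      ΔP := 1 ⊠ P + P ⊠ exp (c₂ • M)
      ΔK := 1 ⊠ K + K ⊠ 1 + (c₃ / c₂) • P ⊠ 1 - (c₃ / c₂) • P ⊠ exp (c₂ • M)
      SH := -(H * exp (-c₂ • M)) - (c₁ / c₂) • K + (c₁ / c₂) • (K * exp (-c₂ • M))
        + (c₁ * c₃ / c₂ ^ 2) • (P * exp (-c₂ • M)) - (c₁ * c₃ / c₂ ^ 2) • P
        + (c₁ * c₃ / c₂) • (P * M * exp (-c₂ • M))
      SP := -(P * exp (-c₂ • M))
      SK := -K + (c₃ / c₂) • (P * exp (-c₂ • M)) - (c₃ / c₂) • P }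
  | case15 c₁ c₂ c₃ =>
    let r := root c₁ c₂ c₃
    { classical M H P K with
      KP := (I * (-(c₂ / 2) + r / 2) / (r * (3 * c₂ / 2 + r / 2))) •
          (exp ((3 * c₂ / 2 + r / 2) • M) - 1)
        + (I * (c₂ / 2 + r / 2) / (r * (3 * c₂ / 2 - r / 2))) •
          (exp ((3 * c₂ / 2 - r / 2) • M) - 1)
      HP := (I * c₁ / (r * (3 * c₂ / 2 - r / 2))) • (exp ((3 * c₂ / 2 - r / 2) • M) - 1)
        - (I * c₁ / (r * (3 * c₂ / 2 + r / 2))) • (exp ((3 * c₂ / 2 + r / 2) • M) - 1)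
      ΔH := 1 ⊠ H
        + H ⊠ (exp ((c₂ / 2) • M) * (cosh (-(r / 2) • M) - (c₂ / r) • sinh (-(r / 2) • M)))
        + (2 * c₁ / r) • K ⊠ (exp ((c₂ / 2) • M) * sinh (-(r / 2) • M))
      ΔP := 1 ⊠ P + P ⊠ exp (c₂ • M)
      ΔK := 1 ⊠ K
        + K ⊠ (exp ((c₂ / 2) • M) * (cosh (-(r / 2) • M) + (c₂ / r) • sinh (-(r / 2) • M)))
        - (2 * c₃ / r) • H ⊠ (exp ((c₂ / 2) • M) * sinh (-(r / 2) • M))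
      SH := -(H * exp (-(c₂ / 2) • M) * (cosh ((r / 2) • M) - (c₂ / r) • sinh ((r / 2) • M)))
        - (2 * c₁ / r) • (K * exp (-(c₂ / 2) • M) * sinh ((r / 2) • M))
      SP := -(P * exp (-c₂ • M))
      SK := -(K * exp (-(c₂ / 2) • M) * (cosh ((r / 2) • M) + (c₂ / r) • sinh ((r / 2) • M)))
        + (2 * c₃ / r) • (H * exp (-(c₂ / 2) • M) * sinh ((r / 2) • M)) }
  | case16 c =>
    { classical M H P K with
      KM := (I * c / 2) • M ^ 2
      KH := (I / c) • (1 - exp (-c • P)) - (I * c) • (M * H)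
      ΔM := M ⊠ 1 + (exp (c • P) ⊠ M) * invOneSub ((c ^ 2 / 2) • (H * exp (c • P)) ⊠ M)
      ΔH := exp (-c • P) ⊠ H + H ⊠ 1 - c ^ 2 • H ⊠ (M * H)
        + (c ^ 4 / 4) • (H ^ 2 * exp (c • P)) ⊠ (M ^ 2 * H)
        - (c ^ 2 / 2) • (H ^ 2 * exp (c • P)) ⊠ M
      ΔP := 1 ⊠ P + P ⊠ 1 - (2 / c) • logOneSub ((c ^ 2 / 2) • (H * exp (c • P)) ⊠ M)
      SM := -(M * exp (-c • P)) * invOneSub ((c ^ 2 / 2) • (M * H))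
      SH := -(H * exp (c • P)) + (c ^ 2 / 2) • (M * H ^ 2 * exp (c • P))
      SP := -P - (2 / c) • logOneSub ((c ^ 2 / 2) • (H * M)) }

end Formulas

/-- The denominators that occur in the formulas of the case do not vanish. -/
def Case.Nondegenerate : Case → Prop
  | case2 c | case16 c => c ≠ 0
  | case6 c₁ _ | case7 c₁ _ | case9 c₁ _ _ | case11 c₁ _ | case13 c₁ _ => c₁ ≠ 0
  | case12 c₁ c₂ => 2 * c₁ ≠ c₂
  | case14 _ c₂ _ => c₂ ≠ 0
  | case15 c₁ c₂ c₃ => c₂ ^ 2 ≠ 4 * c₁ * c₃ ∧ 2 * c₂ ^ 2 + c₁ * c₃ ≠ 0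
  | case1 _ | case3 _ | case4 _ | case5 _ | case8 _ _ | case10 _ _ => True

namespace QGalilei

/-- The ordered monomials `m ^ α * τ ^ β * v ^ σ * a ^ γ`. -/
def monomial (q : Case) (α β γ σ : ℕ) : QGalilei q := m q ^ α * τ q ^ β * v q ^ σ * a q ^ γ

/-- The duality pairing that defines the generators `M`, `H`, `P`, `K`. -/
structure IsDualGenerators (q : Case) (M H P K : Dual (QGalilei q)) : Prop where
  M_apply : ∀ α β γ σ, M (monomial q α β γ σ) =
    if α = 1 ∧ β = 0 ∧ γ = 0 ∧ σ = 0 then -I else 0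
  H_apply : ∀ α β γ σ, H (monomial q α β γ σ) =
    if α = 0 ∧ β = 1 ∧ γ = 0 ∧ σ = 0 then I else 0
  P_apply : ∀ α β γ σ, P (monomial q α β γ σ) =
    if α = 0 ∧ β = 0 ∧ γ = 1 ∧ σ = 0 then -I else 0
  K_apply : ∀ α β γ σ, K (monomial q α β γ σ) =
    if α = 0 ∧ β = 0 ∧ γ = 0 ∧ σ = 1 then -I else 0

end QGalilei
end QuantumGalilei

end

/-!
The generators `τ` and `v` are given weight one, `a` weight two and `m` weight three. The sums of
words of weight at most `n` form a filtration (`QGalilei.filtration`) whose zeroth step consists of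
the scalars and which is compatible with the coproduct. A functional that vanishes at the unit
therefore has an `n`-th power that vanishes on all words of weight less than `n`
(`ConnectedFiltration.locallyNilpotent`), and the same holds on the tensor square. The dual is
separated by its quotients by the functionals vanishing on a step of the filtration, in which these
functionals become nilpotent; identities between power series, such as `ConnectedFiltration.exp_add`
and `ConnectedFiltration.exp_logOneSub`, are thereby reduced to identities between polynomials in
nilpotent elements. The ordered monomials span because the commutators of generators have smaller
weight than the products, in a second system of weights (`QGalilei.span_monomial`).

A functional on the algebra is determined by its values on the generators together with a linear
equation for its coproduct, or jointly with finitely many others by a linear system of such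
equations (`QGalilei.eq_of_coproduct_family`), since the coproduct describes the values at products.
Most formulas are proved by this principle.

In the first fifteen cases the span of `1`, `M`, `H`, `P`, `K` is stable under the right
translations by the algebra (the left translations in cases 9 and 10). Writing down the
five-dimensional representation on this span by matrices, one obtains the functionals as matrix
coefficients; their values on ordered monomials can be read off the matrices, and their coproducts
are `ΔXⱼ = ∑ Xₖ ⊗ Tₖⱼ` with the translation matrix `T` (`RightData.exists_functionals`,
`LeftData.exists_functionals`). The matrix `T` is multiplicative, hence determined by its values on
the generators (`QGalilei.eq_of_multiplicative`), and it remains to check that the exponentials in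
the theorem form a multiplicative matrix with these values. For right translations `M` is primitive,
hence central (`QGalilei.central_of_primitive`), so that the commutators `[K, P]`, `[H, P]`, `[K,
H]` satisfy a linear system of coproduct equations, which the asserted values satisfy as well
(`QGalilei.commutators_eq`). The antipodes follow by applying `X ⊗ Y ↦ X * S Y` to the coproducts
(`mulAntipode_coproduct`).

In case 16 no finite-dimensional space of translates suffices. There the algebra has a
representation by matrices of size two in which `v` acts by zero, and its coefficients `A`, `B`,
`C`, `D` commute and satisfy the relations of the coordinates of `SL₂` (`QGalilei.SLCoordinates`).
The dual generators are `M = -i B D⁻¹`, `H = -(2i / c²) C D`, `P = -(2 / c) log D` and a primitive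
functional `K`, which acts on the coordinates by an infinitesimal conjugation. The values on
monomials are computed by iterated translations, for which the translations by `a` and `m` are
derivations on the functionals killed by `v`. The geometric and logarithmic series of the theorem
arise from `ΔD = D ⊗ D + C ⊗ B = (D ⊗ D) (1 + C D⁻¹ ⊗ B D⁻¹)` and `S D = A`.
-/

open scoped TensorProduct

noncomputable section

namespace QuantumGalilei

open Coalgebra
open Complex (I)

local notation:100 X:100 " ⊠ " Y:101 => tens X Y

/-! ### Functionals on coalgebras -/

section Algebra
variable {C D : Type*} [AddCommGroup C] [Module ℂ C] [Coalgebra ℂ C]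
  [AddCommGroup D] [Module ℂ D] [Coalgebra ℂ D]

theorem dual_ext {X Y : Dual C} (h : ∀ φ, X φ = Y φ) : X = Y :=
  WithConv.ext (LinearMap.ext h)

@[simp] theorem dual_add_apply (X Y : Dual C) (φ : C) : (X + Y) φ = X φ + Y φ := rfl
@[simp] theorem dual_sub_apply (X Y : Dual C) (φ : C) : (X - Y) φ = X φ - Y φ := rfl
@[simp] theorem dual_neg_apply (X : Dual C) (φ : C) : (-X) φ = -X φ := rfl
@[simp] theorem dual_zero_apply (φ : C) : (0 : Dual C) φ = 0 := rfl
@[simp] theorem dual_smul_apply (c : ℂ) (X : Dual C) (φ : C) : (c • X) φ = c * X φ := rfl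

theorem dual_one_apply (φ : C) : (1 : Dual C) φ = Coalgebra.counit (R := ℂ) φ := rfl

@[simp] theorem tens_tmul (X : Dual C) (Y : Dual D) (φ : C) (ψ : D) :
    (X ⊠ Y) (φ ⊗ₜ ψ) = X φ * Y ψ := by
  simp [tens]

theorem dual_mul_apply (X Y : Dual C) (φ : C) :
    (X * Y) φ = (X ⊠ Y) (Coalgebra.comul (R := ℂ) φ) := by
  simp [tens]

theorem tens_ext {X Y : Dual (C ⊗[ℂ] D)} (h : ∀ φ ψ, X (φ ⊗ₜ ψ) = Y (φ ⊗ₜ ψ)) : X = Y :=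
  WithConv.ext (TensorProduct.ext' h)

theorem tens_add (X : Dual C) (Y Z : Dual D) : X ⊠ (Y + Z) = X ⊠ Y + X ⊠ Z :=
  tens_ext fun φ ψ => by simp [mul_add]
theorem add_tens (X Y : Dual C) (Z : Dual D) : (X + Y) ⊠ Z = X ⊠ Z + Y ⊠ Z :=
  tens_ext fun φ ψ => by simp [add_mul]
theorem tens_sub (X : Dual C) (Y Z : Dual D) : X ⊠ (Y - Z) = X ⊠ Y - X ⊠ Z :=
  tens_ext fun φ ψ => by simp [mul_sub]
theorem sub_tens (X Y : Dual C) (Z : Dual D) : (X - Y) ⊠ Z = X ⊠ Z - Y ⊠ Z :=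
  tens_ext fun φ ψ => by simp [sub_mul]
theorem tens_neg (X : Dual C) (Y : Dual D) : X ⊠ (-Y) = -(X ⊠ Y) :=
  tens_ext fun φ ψ => by simp
theorem neg_tens (X : Dual C) (Y : Dual D) : (-X) ⊠ Y = -(X ⊠ Y) :=
  tens_ext fun φ ψ => by simp
theorem tens_zero (X : Dual C) : X ⊠ (0 : Dual D) = 0 :=
  tens_ext fun φ ψ => by simp
theorem zero_tens (Y : Dual D) : (0 : Dual C) ⊠ Y = 0 :=
  tens_ext fun φ ψ => by simp
theorem tens_smul (c : ℂ) (X : Dual C) (Y : Dual D) : X ⊠ (c • Y) = c • X ⊠ Y :=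
  tens_ext fun φ ψ => by simp; ring
theorem smul_tens (c : ℂ) (X : Dual C) (Y : Dual D) : (c • X) ⊠ Y = c • (X ⊠ Y) :=
  tens_ext fun φ ψ => by simp; ring

theorem tens_mul_tens (X X' : Dual C) (Y Y' : Dual D) :
    (X ⊠ Y) * (X' ⊠ Y') = (X * X') ⊠ (Y * Y') := by
  have h := TensorProduct.map_convMul_map (f := X) (h := X') (g := Y) (k := Y')
  have h2 := LinearMap.algHom_comp_convMul_distrib (R := ℂ) (Algebra.TensorProduct.lmul' ℂ (S := ℂ))
    (.toConv (TensorProduct.map X.ofConv Y.ofConv)) (.toConv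
      (TensorProduct.map X'.ofConv Y'.ofConv))
  rw [h] at h2
  exact (WithConv.ext h2).symm

theorem tens_one_one : (1 : Dual C) ⊠ (1 : Dual D) = 1 :=
  tens_ext fun φ ψ => by simp [mul_comm]

theorem tens_pow (X : Dual C) (Y : Dual D) (n : ℕ) : (X ⊠ Y) ^ n = (X ^ n) ⊠ (Y ^ n) := by
  induction n with
  | zero => simp [tens_one_one]
  | succ n ih => rw [pow_succ, ih, tens_mul_tens, pow_succ, pow_succ]

end Algebra

/-! ### The Hopf structure of the dual -/

section Hopf
variable {A : Type*} [Ring A] [HopfAlgebra ℂ A]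

@[simp] theorem coproduct_tmul (X : Dual A) (φ ψ : A) : coproduct X (φ ⊗ₜ ψ) = X (φ * ψ) := by
  simp [coproduct]

theorem coproduct_apply (X : Dual A) (z : A ⊗[ℂ] A) :
    coproduct X z = X (LinearMap.mul' ℂ A z) := rfl

theorem coproduct_mul (X Y : Dual A) : coproduct (X * Y) = coproduct X * coproduct Y :=
  WithConv.ext (LinearMap.convMul_comp_coalgHom_distrib X Y (Bialgebra.mulCoalgHom ℂ A))

theorem coproduct_one : coproduct (1 : Dual A) = 1 ⊠ 1 :=
  tens_ext fun φ ψ => by simp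
theorem coproduct_add (X Y : Dual A) : coproduct (X + Y) = coproduct X + coproduct Y := rfl
theorem coproduct_sub (X Y : Dual A) : coproduct (X - Y) = coproduct X - coproduct Y := rfl
theorem coproduct_neg (X : Dual A) : coproduct (-X) = -coproduct X := rfl
theorem coproduct_zero : coproduct (0 : Dual A) = 0 := rfl
theorem coproduct_smul (c : ℂ) (X : Dual A) : coproduct (c • X) = c • coproduct X := rfl

theorem coproduct_pow (X : Dual A) (n : ℕ) : coproduct (X ^ n) = coproduct X ^ n := by
  induction n with
  | zero => simp [coproduct_one, tens_one_one]
  | succ n ih => rw [pow_succ, coproduct_mul, ih, pow_succ]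

/-- The functional `φ ⊗ ψ ↦ Z (φ ⊗ S ψ)` restricted to the diagonal. -/
def mulAntipode : Dual (A ⊗[ℂ] A) →ₗ[ℂ] Dual A where
  toFun Z := .toConv (Z.ofConv ∘ₗ (HopfAlgebra.antipode ℂ).lTensor A ∘ₗ Coalgebra.comul)
  map_add' _ _ := rfl
  map_smul' _ _ := rfl

theorem mulAntipode_tens (X Y : Dual A) : mulAntipode (X ⊠ Y) = X * antipode Y := by
  refine dual_ext fun φ => ?_
  rw [dual_mul_apply]
  change (X ⊠ Y) ((HopfAlgebra.antipode ℂ).lTensor A (Coalgebra.comul (R := ℂ) φ)) = _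
  generalize Coalgebra.comul (R := ℂ) φ = z
  induction z with
  | zero => simp
  | tmul a b => simp [antipode]
  | add a b ha hb => simp only [map_add, ha, hb]

/-- The antipode axiom, transposed to functionals. -/
theorem mulAntipode_coproduct (X : Dual A) : mulAntipode (coproduct X) = X 1 • 1 := by
  refine dual_ext fun φ => ?_
  have := HopfAlgebra.mul_antipode_lTensor_comul_apply (R := ℂ) φ
  change X (LinearMap.mul' ℂ A ((HopfAlgebra.antipode ℂ).lTensor A (Coalgebra.comul (R := ℂ) φ)))
    = _
  rw [this, Algebra.algebraMap_eq_smul_one, map_smul, dual_smul_apply, dual_one_apply, smul_eq_mul,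
    mul_comm]

theorem antipode_one : antipode (1 : Dual A) = 1 :=
  dual_ext fun φ => by simp [antipode]

end Hopf

/-! ### Connected filtrations -/

/-- An exhaustive filtration of a bialgebra whose zeroth step consists of the scalars and which is
respected by the coproduct. -/
structure ConnectedFiltration (B : Type*) [Ring B] [Bialgebra ℂ B] where
  F : ℕ → Submodule ℂ B
  mono : Monotone F
  exists_mem : ∀ x, ∃ n, x ∈ F n
  eq_smul_one : ∀ x ∈ F 0, ∃ c : ℂ, x = c • 1
  comul_mem : ∀ n, ∀ x ∈ F n, Coalgebra.comul (R := ℂ) x ∈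
    Submodule.span ℂ {z : B ⊗[ℂ] B | ∃ i j y w, i + j ≤ n ∧ y ∈ F i ∧ w ∈ F j ∧ y ⊗ₜ w = z}

namespace ConnectedFiltration
variable {B : Type*} [Ring B] [Bialgebra ℂ B] (𝓕 : ConnectedFiltration B)

theorem apply_comul_eq_zero {Z : Dual (B ⊗[ℂ] B)} {n : ℕ} {x : B} (hx : x ∈ 𝓕.F n)
    (h : ∀ i j y w, i + j ≤ n → y ∈ 𝓕.F i → w ∈ 𝓕.F j → Z (y ⊗ₜ w) = 0) :
    Z (Coalgebra.comul (R := ℂ) x) = 0 := by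
  have key : Coalgebra.comul (R := ℂ) x ∈ LinearMap.ker Z.ofConv := by
    refine Submodule.span_le.2 ?_ (𝓕.comul_mem n x hx)
    rintro _ ⟨i, j, y, w, hij, hy, hw, rfl⟩
    exact h i j y w hij hy hw
  exact key

/-- The functionals that vanish on the `n`-th step of the filtration; they form a two-sided ideal,
since the filtration is respected by the coproduct. -/
def J (n : ℕ) : Ideal (Dual B) where
  carrier := {X | ∀ x ∈ 𝓕.F n, X x = 0}
  add_mem' hX hY x hx := by simp [hX x hx, hY x hx]
  zero_mem' x hx := rfl
  smul_mem' Y X hX x hx := by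
    rw [smul_eq_mul, dual_mul_apply]
    refine 𝓕.apply_comul_eq_zero hx fun i j y w hij hy hw => ?_
    rw [tens_tmul, hX w (𝓕.mono (by omega) hw), mul_zero]

theorem mem_J {n : ℕ} {X : Dual B} : X ∈ 𝓕.J n ↔ ∀ x ∈ 𝓕.F n, X x = 0 := Iff.rfl

instance (n : ℕ) : (𝓕.J n).IsTwoSided where
  mul_mem_of_left Y hX x hx := by
    rw [dual_mul_apply]
    refine 𝓕.apply_comul_eq_zero hx fun i j y w hij hy hw => ?_
    rw [tens_tmul, hX y (𝓕.mono (by omega) hy), zero_mul]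

theorem mul_mem_J_succ {n : ℕ} {X Y : Dual B} (hX : X 1 = 0) (hY : Y ∈ 𝓕.J n) :
    X * Y ∈ 𝓕.J (n + 1) := by
  intro x hx
  rw [dual_mul_apply]
  refine 𝓕.apply_comul_eq_zero hx fun i j y w hij hy hw => ?_
  rw [tens_tmul]
  rcases Nat.eq_zero_or_pos i with rfl | hi
  · obtain ⟨c, rfl⟩ := 𝓕.eq_smul_one y hy
    rw [map_smul, hX, smul_zero, zero_mul]
  · rw [hY w (𝓕.mono (by omega) hw), mul_zero]

theorem pow_mem_J {X : Dual B} (hX : X 1 = 0) (n : ℕ) : X ^ (n + 1) ∈ 𝓕.J n := by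
  induction n with
  | zero =>
    intro x hx
    obtain ⟨c, rfl⟩ := 𝓕.eq_smul_one x hx
    rw [zero_add, pow_one, map_smul, hX, smul_zero]
  | succ n ih => rw [pow_succ']; exact 𝓕.mul_mem_J_succ hX ih

theorem pow_mem_J_of_lt {X : Dual B} (hX : X 1 = 0) {k n : ℕ} (h : k < n) : X ^ n ∈ 𝓕.J k := by
  obtain ⟨d, rfl⟩ := Nat.exists_eq_add_of_lt h
  rw [show k + d + 1 = d + (k + 1) by ring, pow_add]
  exact Ideal.mul_mem_left _ _ (𝓕.pow_mem_J hX k)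

include 𝓕 in
theorem locallyNilpotent {X : Dual B} (hX : X 1 = 0) : LocallyNilpotent X := by
  intro φ
  obtain ⟨k, hk⟩ := 𝓕.exists_mem φ
  exact ⟨k + 1, fun n hn => 𝓕.pow_mem_J_of_lt hX hn φ hk⟩

/-- The quotient of the dual by the functionals that vanish on the `n`-th step. -/
abbrev Q (n : ℕ) := Dual B ⧸ 𝓕.J n

/-- The projection to the quotient `𝓕.Q n`. -/
def π (n : ℕ) : Dual B →ₐ[ℂ] 𝓕.Q n := Ideal.Quotient.mkₐ ℂ (𝓕.J n)

theorem π_eq_iff {n : ℕ} {X Y : Dual B} : 𝓕.π n X = 𝓕.π n Y ↔ ∀ x ∈ 𝓕.F n, X x = Y x := by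
  have : 𝓕.π n X = 𝓕.π n Y ↔ X - Y ∈ 𝓕.J n := Ideal.Quotient.eq
  rw [this, mem_J]
  simp only [dual_sub_apply, sub_eq_zero]

theorem ext_π {X Y : Dual B} (h : ∀ n, 𝓕.π n X = 𝓕.π n Y) : X = Y := by
  refine dual_ext fun φ => ?_
  obtain ⟨k, hk⟩ := 𝓕.exists_mem φ
  exact 𝓕.π_eq_iff.1 (h k) φ hk

theorem π_pow_eq_zero {X : Dual B} (hX : X 1 = 0) {k n : ℕ} (h : k < n) : 𝓕.π k X ^ n = 0 := by
  rw [← map_pow, ← map_zero (𝓕.π k), π_eq_iff]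
  exact 𝓕.pow_mem_J_of_lt hX h

theorem π_series (f : ℕ → ℂ) {X : Dual B} (hX : X 1 = 0) (k : ℕ) :
    𝓕.π k (series f X) = ∑ n ∈ Finset.range (k + 1), f n • 𝓕.π k X ^ n := by
  simp only [← map_pow, ← map_smul, ← map_sum]
  rw [π_eq_iff]
  intro x hx
  have hs : ∀ s : Finset ℕ, (∑ n ∈ s, f n • X ^ n : Dual B) x = ∑ n ∈ s, f n * (X ^ n) x := by
    intro s
    induction s using Finset.cons_induction with
    | empty => rfl
    | cons a s ha ih => rw [Finset.sum_cons, Finset.sum_cons, dual_add_apply, ih]; rfl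
  rw [hs, series, dif_pos (𝓕.locallyNilpotent hX)]
  refine finsum_eq_sum_of_support_subset _ fun n hn => ?_
  simp only [Finset.coe_range, Set.mem_Iio]
  by_contra hlt
  exact hn (by simp only [𝓕.pow_mem_J_of_lt hX (by omega : k < n) x hx, mul_zero])

end ConnectedFiltration

/-! ### Truncated power series at nilpotent elements -/

section NilpotentSeries
variable {R : Type*} [Ring R] [Algebra ℂ R]

/-- The polynomial obtained from a power series by truncation, evaluated at `x`. -/
def truncEval (N : ℕ) (f : ℕ → ℂ) (x : R) : R := ∑ n ∈ Finset.range N, f n • x ^ n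

theorem truncEval_exp_add {N : ℕ} {x y : R} (h : Commute x y) (hx : x ^ N = 0) (hy : y ^ N = 0)
    (hxy : (x + y) ^ N = 0) :
    truncEval N (fun n => 1 / (n.factorial : ℂ)) (x + y) =
      truncEval N (fun n => 1 / (n.factorial : ℂ)) x *
        truncEval N (fun n => 1 / (n.factorial : ℂ)) y := by
  let _ : Algebra ℚ R := Algebra.compHom R (algebraMap ℚ ℂ)
  have key : ∀ z : R, z ^ N = 0 →
      truncEval N (fun n => 1 / (n.factorial : ℂ)) z = IsNilpotent.exp z := by
    intro z hz
    rw [IsNilpotent.exp_eq_sum hz]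
    refine Finset.sum_congr rfl fun n _ => ?_
    change _ = (algebraMap ℚ ℂ _) • z ^ n
    simp
  rw [key _ hx, key _ hy, key _ hxy, IsNilpotent.exp_add_of_commute h ⟨N, hx⟩ ⟨N, hy⟩]

open PowerSeries in
/-- The formal identity `exp (log (1 - X)) = 1 - X`, which holds because both sides solve
`(1 - X) g' = -g` with `g 0 = 1`. -/
theorem exp_subst_log_one_sub :
    (PowerSeries.mk fun n => 1 / (n.factorial : ℂ)).subst
      (PowerSeries.mk fun n => if n = 0 then 0 else -(1 / (n : ℂ))) = 1 - (X : ℂ⟦X⟧) := by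
  set e : ℂ⟦X⟧ := PowerSeries.mk fun n => 1 / (n.factorial : ℂ) with he
  set l : ℂ⟦X⟧ := PowerSeries.mk fun n => if n = 0 then 0 else -(1 / (n : ℂ)) with hl
  have hs : HasSubst l := HasSubst.of_constantCoeff_zero' (by simp [hl])
  have hde : d⁄dX ℂ e = e := by
    ext n
    rw [PowerSeries.coeff_derivative, he, coeff_mk, coeff_mk, Nat.factorial_succ]
    have : (n.factorial : ℂ) ≠ 0 := by exact_mod_cast n.factorial_ne_zero
    have : (n : ℂ) + 1 ≠ 0 := by exact_mod_cast n.succ_ne_zero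
    push_cast
    field_simp
  have hdl : d⁄dX ℂ l * (1 - X) = -1 := by
    have : d⁄dX ℂ l = -PowerSeries.mk fun _ => 1 := by
      ext n
      rw [PowerSeries.coeff_derivative, hl, coeff_mk, map_neg, coeff_mk, if_neg n.succ_ne_zero]
      have : (n : ℂ) + 1 ≠ 0 := by exact_mod_cast n.succ_ne_zero
      push_cast
      field_simp
    rw [this, neg_mul]
    exact congrArg _ (PowerSeries.mk_one_mul_one_sub_eq_one ℂ)
  set g : ℂ⟦X⟧ := e.subst l with hg
  have hdg : d⁄dX ℂ g * (1 - X) = -g := by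
    rw [hg, derivative_subst hs, hde, mul_assoc, hdl, mul_neg_one]
  have hg0 : coeff 0 g = 1 := by
    rw [hg, coeff_subst' hs, finsum_eq_single _ 0]
    · simp [he]
    · intro n hn
      simp [hl, hn]
  -- The coefficients of a solution of `(1 - X) g' = -g` satisfy `(n + 1) gₙ₊₁ = (n - 1) gₙ`.
  have hrec : ∀ n : ℕ, ((n : ℂ) + 1) * coeff (n + 1) g = (n - 1) * coeff n g := by
    intro n
    have h := congrArg (coeff n) hdg
    rw [mul_sub, mul_one, map_sub, map_neg, PowerSeries.coeff_derivative] at h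
    cases n with
    | zero =>
      rw [coeff_zero_mul_X] at h
      push_cast at *
      linear_combination h
    | succ n =>
      rw [coeff_succ_mul_X, PowerSeries.coeff_derivative] at h
      push_cast at *
      linear_combination h
  have h1 : coeff 1 g = -1 := by
    have := hrec 0
    rw [hg0] at this
    simpa using this
  have h2 : ∀ n : ℕ, coeff (n + 2) g = 0 := by
    intro n
    induction n with
    | zero =>
      have := hrec 1
      norm_num at this
      exact this
    | succ n ih =>
      have := hrec (n + 2)
      rw [ih, mul_zero] at this
      refine (mul_eq_zero.1 this).resolve_left ?_
      exact_mod_cast (n + 2).succ_ne_zero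
  ext n
  rcases n with _ | _ | n
  · simp [hg0]
  · rw [zero_add, h1]; simp [coeff_one]
  · rw [h2]; simp [coeff_X, coeff_one]

open PowerSeries in
/-- Evaluation of truncated power series at a nilpotent element is multiplicative. -/
theorem truncEval_mul {N : ℕ} {x : R} (hx : x ^ N = 0) (f g : ℂ⟦X⟧) :
    truncEval N (fun n => coeff n (f * g)) x =
      truncEval N (fun n => coeff n f) x * truncEval N (fun n => coeff n g) x := by
  have key : ∀ p : Polynomial ℂ, truncEval N (fun n => p.coeff n) x = Polynomial.aeval x p := by
    intro p
    rw [Polynomial.aeval_eq_sum_range' (n := max N (p.natDegree + 1)) (by omega), truncEval]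
    refine Finset.sum_subset (by simp) fun n _ hn => ?_
    rw [Finset.mem_range, not_lt] at hn
    rw [pow_eq_zero_of_le hn hx, smul_zero]
  have key' : ∀ f : ℂ⟦X⟧, truncEval N (fun n => coeff n f) x =
      Polynomial.aeval x (trunc N f) := by
    intro f
    rw [← key]
    refine Finset.sum_congr rfl fun n hn => ?_
    simp only [coeff_trunc, if_pos (Finset.mem_range.1 hn)]
  rw [key', key', key', ← map_mul, ← key, ← key, truncEval, truncEval]
  refine Finset.sum_congr rfl fun n hn => ?_
  rw [Finset.mem_range] at hn
  have h1 := coeff_mul_eq_coeff_trunc_mul_trunc (f := f) (g := g) hn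
  rw [coeff_trunc, if_pos hn, h1, ← Polynomial.coe_mul, Polynomial.coeff_coe]

open PowerSeries in
theorem truncEval_pow {N : ℕ} (hN : N ≠ 0) {x : R} (hx : x ^ N = 0) (f : ℂ⟦X⟧) (k : ℕ) :
    truncEval N (fun n => coeff n (f ^ k)) x = truncEval N (fun n => coeff n f) x ^ k := by
  induction k with
  | zero =>
    rw [pow_zero, pow_zero, truncEval, Finset.sum_eq_single 0]
    · simp
    · intro n _ hn
      simp [coeff_one, hn]
    · intro h
      simp [hN] at h
  | succ k ih => rw [pow_succ, pow_succ, truncEval_mul hx, ih]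

open PowerSeries in
/-- Evaluation of truncated power series at a nilpotent element respects substitution. -/
theorem truncEval_subst {N : ℕ} (hN : N ≠ 0) {x : R} (hx : x ^ N = 0) (f g : ℂ⟦X⟧)
    (hg : constantCoeff g = 0) :
    truncEval N (fun n => coeff n (f.subst g)) x =
      truncEval N (fun n => coeff n f) (truncEval N (fun n => coeff n g) x) := by
  have hs : HasSubst g := HasSubst.of_constantCoeff_zero' hg
  have hc : ∀ n < N, coeff n (f.subst g) = ∑ k ∈ Finset.range N, coeff k f * coeff n (g ^ k) := by
    intro n hn
    rw [coeff_subst' hs]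
    refine finsum_eq_sum_of_support_subset _ fun k hk => ?_
    simp only [Finset.coe_range, Set.mem_Iio]
    by_contra hlt
    refine hk ?_
    dsimp only
    have hlt' : (n : ℕ∞) < (g ^ k).order :=
      lt_of_lt_of_le (by exact_mod_cast (by omega : n < k))
        (le_order_pow_of_constantCoeff_eq_zero k hg)
    rw [coeff_of_lt_order n hlt', smul_zero]
  conv_rhs => rw [truncEval]
  simp only [← truncEval_pow hN hx]
  simp only [truncEval, Finset.smul_sum]
  rw [Finset.sum_comm]
  refine Finset.sum_congr rfl fun n hn => ?_
  rw [hc n (Finset.mem_range.1 hn), Finset.sum_smul]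
  exact Finset.sum_congr rfl fun k _ => mul_smul _ _ _

end NilpotentSeries

/-! ### Exponential, logarithm and geometric series -/

namespace ConnectedFiltration
variable {B : Type*} [Ring B] [Bialgebra ℂ B] (𝓕 : ConnectedFiltration B)

theorem π_series' (f : ℕ → ℂ) {X : Dual B} (hX : X 1 = 0) (k : ℕ) :
    𝓕.π k (series f X) = truncEval (k + 1) f (𝓕.π k X) := 𝓕.π_series f hX k

include 𝓕

theorem series_apply_one (f : ℕ → ℂ) {X : Dual B} (hX : X 1 = 0) : series f X 1 = f 0 := by
  obtain ⟨k, hk⟩ := 𝓕.exists_mem 1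
  rw [series, dif_pos (𝓕.locallyNilpotent hX)]
  change ∑ᶠ n, f n * (X ^ n) 1 = f 0
  rw [finsum_eq_single _ 0]
  · simp
  · intro n hn
    obtain ⟨n, rfl⟩ := Nat.exists_eq_succ_of_ne_zero hn
    rw [pow_succ, dual_mul_apply, Bialgebra.comul_one, Algebra.TensorProduct.one_def, tens_tmul,
      hX, mul_zero, mul_zero]

theorem exp_add {X Y : Dual B} (hX : X 1 = 0) (hY : Y 1 = 0) (h : Commute X Y) :
    exp (X + Y) = exp X * exp Y := by
  refine 𝓕.ext_π fun k => ?_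
  have hXY : (X + Y) 1 = 0 := by simp [hX, hY]
  rw [map_mul, exp, exp, exp, 𝓕.π_series' _ hX, 𝓕.π_series' _ hY, 𝓕.π_series' _ hXY, map_add]
  refine truncEval_exp_add (h.map (𝓕.π k)) (𝓕.π_pow_eq_zero hX k.lt_succ_self)
    (𝓕.π_pow_eq_zero hY k.lt_succ_self) ?_
  rw [← map_add]
  exact 𝓕.π_pow_eq_zero hXY k.lt_succ_self

theorem exp_zero : exp (0 : Dual B) = 1 := by
  refine 𝓕.ext_π fun k => ?_
  rw [exp, 𝓕.π_series _ rfl, map_zero, Finset.sum_eq_single 0]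
  · simp
  · intro n _ hn
    simp [hn]
  · simp

theorem exp_mul_exp_neg {X : Dual B} (hX : X 1 = 0) : exp X * exp (-X) = 1 := by
  rw [← 𝓕.exp_add hX (by simp [hX]) (Commute.refl X).neg_right, add_neg_cancel, 𝓕.exp_zero]

theorem exp_neg_mul_exp {X : Dual B} (hX : X 1 = 0) : exp (-X) * exp X = 1 := by
  rw [← 𝓕.exp_add (by simp [hX]) hX (Commute.refl X).neg_left, neg_add_cancel, 𝓕.exp_zero]

theorem exp_smul_mul_exp_smul {X : Dual B} (hX : X 1 = 0) (s t : ℂ) :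
    exp (s • X) * exp (t • X) = exp ((s + t) • X) := by
  rw [add_smul, 𝓕.exp_add (by simp [hX]) (by simp [hX])
    (((Commute.refl X).smul_left s).smul_right t)]

theorem commute_series (f : ℕ → ℂ) {X Y : Dual B} (hY : Y 1 = 0) (h : Commute X Y) :
    Commute X (series f Y) := by
  refine 𝓕.ext_π fun k => ?_
  rw [map_mul, map_mul, 𝓕.π_series _ hY]
  exact Commute.sum_right _ _ _ fun n _ => ((h.map (𝓕.π k)).pow_right n).smul_right _

theorem commute_exp {X Y : Dual B} (hY : Y 1 = 0) (h : Commute X Y) : Commute X (exp Y) :=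
  𝓕.commute_series _ hY h

theorem exp_logOneSub {Y : Dual B} (hY : Y 1 = 0) : exp (logOneSub Y) = 1 - Y := by
  refine 𝓕.ext_π fun k => ?_
  have hN := 𝓕.π_pow_eq_zero hY k.lt_succ_self
  have hl : logOneSub Y 1 = 0 := by rw [logOneSub, 𝓕.series_apply_one _ hY, if_pos rfl]
  rw [exp, 𝓕.π_series' _ hl, logOneSub, 𝓕.π_series' _ hY]
  have h := truncEval_subst k.succ_ne_zero hN (PowerSeries.mk fun n => 1 / (n.factorial : ℂ))
    (PowerSeries.mk fun n => if n = 0 then 0 else -(1 / (n : ℂ))) (by simp)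
  rw [exp_subst_log_one_sub] at h
  simp only [PowerSeries.coeff_mk] at h
  rw [← h, truncEval, map_sub, map_one]
  rcases k with _ | k
  · rw [Nat.succ_eq_add_one, zero_add, pow_one] at hN
    simp [hN]
  · rw [Finset.sum_range_succ', Finset.sum_range_succ', Finset.sum_eq_zero]
    · simp [PowerSeries.coeff_one, sub_eq_neg_add]
    · intro n _
      simp [PowerSeries.coeff_one, PowerSeries.coeff_X]

theorem logOneSub_apply_one {Y : Dual B} (hY : Y 1 = 0) : logOneSub Y 1 = 0 := by
  rw [logOneSub, 𝓕.series_apply_one _ hY, if_pos rfl]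

theorem exp_apply_one {Y : Dual B} (hY : Y 1 = 0) : exp Y 1 = 1 := by
  rw [exp, 𝓕.series_apply_one _ hY]; simp

theorem one_sub_mul_invOneSub {Y : Dual B} (hY : Y 1 = 0) : (1 - Y) * invOneSub Y = 1 := by
  refine 𝓕.ext_π fun k => ?_
  rw [map_mul, map_sub, map_one, invOneSub, 𝓕.π_series _ hY]
  simp only [one_smul]
  rw [mul_neg_geom_sum, 𝓕.π_pow_eq_zero hY k.lt_succ_self, sub_zero]

theorem invOneSub_mul_one_sub {Y : Dual B} (hY : Y 1 = 0) : invOneSub Y * (1 - Y) = 1 := by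
  have h : Commute (1 - Y) (invOneSub Y) :=
    𝓕.commute_series _ hY ((Commute.one_left Y).sub_left (Commute.refl Y))
  rw [← h.eq, 𝓕.one_sub_mul_invOneSub hY]

/-- The exponential is injective on commuting functionals: if `exp Z = 1`, then `Z` vanishes on
every step of the filtration. -/
theorem exp_injective_of_commute {X Y : Dual B} (hX : X 1 = 0) (hY : Y 1 = 0) (h : Commute X Y)
    (he : exp X = exp Y) : X = Y := by
  have hn : (-Y) 1 = 0 := by simp [hY]
  have hZ : (X - Y) 1 = 0 := by simp [hX, hY]
  have h1 : exp (X - Y) = 1 := by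
    rw [sub_eq_add_neg, 𝓕.exp_add hX hn h.neg_right, he, 𝓕.exp_mul_exp_neg hY]
  suffices hz : X - Y = 0 from sub_eq_zero.1 hz
  generalize X - Y = Z at h1 hZ
  -- If `Z` vanishes on a step of the filtration, then `exp Z` agrees with `1 + Z` on the next one.
  have key : ∀ k, Z ∈ 𝓕.J k := by
    intro k
    induction k with
    | zero => simpa using 𝓕.pow_mem_J hZ 0
    | succ k ih =>
      have h2 : 𝓕.π (k + 1) Z ^ 2 = 0 := by
        rw [pow_two, ← map_mul, ← map_zero (𝓕.π (k + 1)), π_eq_iff]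
        exact 𝓕.mul_mem_J_succ hZ ih
      have h3 := congrArg (𝓕.π (k + 1)) h1
      rw [exp, 𝓕.π_series _ hZ, Finset.sum_range_succ', Finset.sum_range_succ',
        Finset.sum_eq_zero fun n _ => by rw [pow_eq_zero_of_le (by omega) h2, smul_zero]] at h3
      have h4 : 𝓕.π (k + 1) Z = 𝓕.π (k + 1) 0 := by simpa using h3
      exact 𝓕.π_eq_iff.1 h4
  refine dual_ext fun φ => ?_
  obtain ⟨k, hk⟩ := 𝓕.exists_mem φ
  exact key k φ hk

/-- A linear operator on the dual that is continuous for the filtration and satisfies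
`δ (X ^ (n + 1)) = (n + 1) X ^ n W`, as a derivation with `δ X = W` does, acts termwise on power
series in `X`. -/
theorem map_series (δ : Dual B →ₗ[ℂ] Dual B) (hδ : ∀ k, ∃ N, ∀ X ∈ 𝓕.J N, δ X ∈ 𝓕.J k)
    {X W : Dual B} (hX : X 1 = 0) (h0 : δ 1 = 0)
    (h : ∀ n : ℕ, δ (X ^ (n + 1)) = ((n : ℂ) + 1) • (X ^ n * W)) (f : ℕ → ℂ) :
    δ (series f X) = series (fun n => (n + 1) * f (n + 1)) X * W := by
  refine 𝓕.ext_π fun k => ?_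
  obtain ⟨N, hN⟩ := hδ k
  have h1 : 𝓕.π N (series f X) = 𝓕.π N (∑ n ∈ Finset.range (N + k + 2), f n • X ^ n) := by
    rw [𝓕.π_series _ hX, map_sum]
    simp only [map_smul, map_pow]
    refine Finset.sum_subset (Finset.range_subset_range.2 (by omega)) fun n _ hn => ?_
    rw [Finset.mem_range, not_lt] at hn
    rw [𝓕.π_pow_eq_zero hX hn, smul_zero]
  have h2 : 𝓕.π k (δ (series f X)) =
      𝓕.π k (δ (∑ n ∈ Finset.range (N + k + 2), f n • X ^ n)) := by
    refine 𝓕.π_eq_iff.2 fun φ hφ => ?_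
    have := hN (series f X - ∑ n ∈ Finset.range (N + k + 2),
      f n • X ^ n) fun ψ hψ => sub_eq_zero.2 (𝓕.π_eq_iff.1 h1 ψ hψ)
    rw [map_sub] at this
    exact sub_eq_zero.1 (this φ hφ)
  rw [h2, map_mul, 𝓕.π_series _ hX, Finset.sum_range_succ', map_add, map_sum, pow_zero, map_smul,
    h0, smul_zero, add_zero, map_sum, Finset.sum_mul]
  simp only [map_smul, h, map_mul, map_pow, smul_mul_assoc]
  symm
  refine (Finset.sum_subset (Finset.range_subset_range.2 (by omega)) fun n _ hn => ?_).trans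
    (Finset.sum_congr rfl fun n _ => ?_)
  · rw [Finset.mem_range, not_lt] at hn
    rw [𝓕.π_pow_eq_zero hX hn, zero_mul, smul_zero]
  · rw [smul_smul, mul_comm]

end ConnectedFiltration

/-! ### Power series and coproducts -/

section TensorFiltration
variable {B B' : Type*} [Ring B] [Bialgebra ℂ B] [Ring B'] [Bialgebra ℂ B']

/-- The filtration of a tensor product by the total degree. -/
def ConnectedFiltration.tensor (𝓕 : ConnectedFiltration B) (𝓖 : ConnectedFiltration B') :
    ConnectedFiltration (B ⊗[ℂ] B') where
  F n := Submodule.span ℂ {z | ∃ i j y w, i + j ≤ n ∧ y ∈ 𝓕.F i ∧ w ∈ 𝓖.F j ∧ y ⊗ₜ w = z}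
  mono m n h := Submodule.span_mono (by
    rintro _ ⟨i, j, y, w, hij, hy, hw, rfl⟩
    exact ⟨i, j, y, w, hij.trans h, hy, hw, rfl⟩)
  exists_mem x := by
    induction x with
    | zero => exact ⟨0, zero_mem _⟩
    | tmul y w =>
      obtain ⟨i, hi⟩ := 𝓕.exists_mem y
      obtain ⟨j, hj⟩ := 𝓖.exists_mem w
      exact ⟨i + j, Submodule.subset_span ⟨i, j, y, w, le_rfl, hi, hj, rfl⟩⟩
    | add x y hx hy =>
      obtain ⟨i, hi⟩ := hx
      obtain ⟨j, hj⟩ := hy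
      refine ⟨i + j, add_mem (Submodule.span_mono ?_ hi) (Submodule.span_mono ?_ hj)⟩
      · rintro _ ⟨a, b, y, w, hij, hy, hw, rfl⟩
        exact ⟨a, b, y, w, by omega, hy, hw, rfl⟩
      · rintro _ ⟨a, b, y, w, hij, hy, hw, rfl⟩
        exact ⟨a, b, y, w, by omega, hy, hw, rfl⟩
  eq_smul_one x hx := by
    suffices h : x ∈ Submodule.span ℂ {(1 : B ⊗[ℂ] B')} by
      obtain ⟨c, rfl⟩ := Submodule.mem_span_singleton.1 h
      exact ⟨c, rfl⟩
    refine Submodule.span_le.2 ?_ hx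
    rintro _ ⟨i, j, y, w, hij, hy, hw, rfl⟩
    obtain ⟨rfl, rfl⟩ : i = 0 ∧ j = 0 := by omega
    obtain ⟨c, rfl⟩ := 𝓕.eq_smul_one y hy
    obtain ⟨d, rfl⟩ := 𝓖.eq_smul_one w hw
    rw [TensorProduct.smul_tmul_smul]
    exact Submodule.smul_mem _ _ (Submodule.subset_span rfl)
  comul_mem n x hx := by
    induction hx using Submodule.span_induction with
    | mem x hx =>
      obtain ⟨i, j, y, w, hij, hy, hw, rfl⟩ := hx
      rw [TensorProduct.comul_tmul]
      have h1 := 𝓕.comul_mem i y hy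
      have h2 := 𝓖.comul_mem j w hw
      generalize Coalgebra.comul (R := ℂ) y = u at h1
      generalize Coalgebra.comul (R := ℂ) w = v at h2
      induction h1, h2 using Submodule.span_induction₂ with
      | mem_mem u v hu hv =>
        obtain ⟨i1, i2, y1, y2, hi, hy1, hy2, rfl⟩ := hu
        obtain ⟨j1, j2, w1, w2, hj, hw1, hw2, rfl⟩ := hv
        refine Submodule.subset_span ⟨i1 + j1, i2 + j2, y1 ⊗ₜ w1, y2 ⊗ₜ w2, by omega,
          Submodule.subset_span ⟨i1, j1, y1, w1, le_rfl, hy1, hw1, rfl⟩,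
          Submodule.subset_span ⟨i2, j2, y2, w2, le_rfl, hy2, hw2, rfl⟩, ?_⟩
        simp
      | zero_left v _ => simp
      | zero_right v _ => simp
      | add_left a b v _ _ _ ha hb =>
        rw [TensorProduct.add_tmul, map_add]; exact add_mem ha hb
      | add_right a b v _ _ _ ha hb =>
        rw [TensorProduct.tmul_add, map_add]; exact add_mem ha hb
      | smul_left c a v _ _ ha =>
        rw [← TensorProduct.smul_tmul', map_smul]; exact Submodule.smul_mem _ _ ha
      | smul_right c a v _ _ ha =>
        rw [TensorProduct.tmul_smul, map_smul]; exact Submodule.smul_mem _ _ ha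
    | zero => simp
    | add x y _ _ hx hy => rw [map_add]; exact add_mem hx hy
    | smul c x _ hx => rw [map_smul]; exact Submodule.smul_mem _ _ hx

end TensorFiltration

section SeriesMaps

variable {C D : Type*} [AddCommGroup C] [Module ℂ C] [Coalgebra ℂ C]
  [AddCommGroup D] [Module ℂ D] [Coalgebra ℂ D]

theorem series_apply (f : ℕ → ℂ) {X : Dual C} (hX : LocallyNilpotent X) (φ : C) :
    series f X φ = ∑ᶠ n, f n * (X ^ n) φ := by
  rw [series, dif_pos hX]; rfl

/-- Power series commute with pulling back functionals along a linear map, provided that this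
respects powers. -/
theorem series_pullback (f : ℕ → ℂ) {X : Dual C} (hX : LocallyNilpotent X) {Y : Dual D}
    (ℓ : D →ₗ[ℂ] C) (h : ∀ n φ, (Y ^ n) φ = (X ^ n) (ℓ φ)) (φ : D) :
    series f Y φ = series f X (ℓ φ) := by
  have hY : LocallyNilpotent Y := fun φ => by
    obtain ⟨N, hN⟩ := hX (ℓ φ)
    exact ⟨N, fun n hn => by rw [h, hN n hn]⟩
  rw [series_apply f hY, series_apply f hX]
  simp only [h]

theorem series_tens_one (f : ℕ → ℂ) {X : Dual C} (hX : LocallyNilpotent X) :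
    series f (X ⊠ (1 : Dual D)) = series f X ⊠ 1 := by
  refine tens_ext fun φ ψ => ?_
  rw [series_pullback f hX (TensorProduct.rid ℂ C ∘ₗ
    TensorProduct.map LinearMap.id (Coalgebra.counit : D →ₗ[ℂ] ℂ))]
  · simp [mul_comm]
  · intro n z
    rw [tens_pow, one_pow]
    induction z with
    | zero => simp
    | tmul a b => simp [mul_comm]
    | add a b ha hb => simp only [map_add, ha, hb]

theorem series_one_tens (f : ℕ → ℂ) {X : Dual D} (hX : LocallyNilpotent X) :
    series f ((1 : Dual C) ⊠ X) = 1 ⊠ series f X := by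
  refine tens_ext fun φ ψ => ?_
  rw [series_pullback f hX (TensorProduct.lid ℂ D ∘ₗ
    TensorProduct.map (Coalgebra.counit : C →ₗ[ℂ] ℂ) LinearMap.id)]
  · simp
  · intro n z
    rw [tens_pow, one_pow]
    induction z with
    | zero => simp
    | tmul a b => simp
    | add a b ha hb => simp only [map_add, ha, hb]

variable {A : Type*} [Ring A] [HopfAlgebra ℂ A]

theorem coproduct_series (f : ℕ → ℂ) {X : Dual A} (hX : LocallyNilpotent X) :
    coproduct (series f X) = series f (coproduct X) := by
  refine dual_ext fun z => ?_
  rw [coproduct_apply, ← series_pullback f hX]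
  intro n z
  rw [← coproduct_pow, coproduct_apply]

theorem exp_tens_one {X : Dual C} (hX : LocallyNilpotent X) :
    exp (X ⊠ (1 : Dual D)) = exp X ⊠ 1 := series_tens_one _ hX

theorem exp_one_tens {X : Dual D} (hX : LocallyNilpotent X) :
    exp ((1 : Dual C) ⊠ X) = 1 ⊠ exp X := series_one_tens _ hX

theorem coproduct_exp {X : Dual A} (hX : LocallyNilpotent X) :
    coproduct (exp X) = exp (coproduct X) := coproduct_series _ hX

/-- The exponential of a primitive functional is group-like. -/
theorem coproduct_exp_of_primitive (𝓕 : ConnectedFiltration A) {X : Dual A} (hX : X 1 = 0)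
    (h : coproduct X = 1 ⊠ X + X ⊠ 1) : coproduct (exp X) = exp X ⊠ exp X := by
  have hn := 𝓕.locallyNilpotent hX
  rw [coproduct_exp hn, h, (𝓕.tensor 𝓕).exp_add, exp_one_tens hn, exp_tens_one hn, tens_mul_tens,
    one_mul, mul_one]
  · simp [Algebra.TensorProduct.one_def, hX]
  · simp [Algebra.TensorProduct.one_def, hX]
  · rw [commute_iff_eq, tens_mul_tens, tens_mul_tens, one_mul, mul_one]

end SeriesMaps

namespace QGalilei
variable {q : Case}

/-! ### The filtration by weight -/

/-- The elements that are sums of words of weight at most `n`, where `τ` and `v` have weight one,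
`a` has weight two and `m` has weight three. -/
inductive WordFiltration (q : Case) : ℕ → QGalilei q → Prop
  | scalar (c : ℂ) : WordFiltration q 0 (algebraMap ℂ _ c)
  | τ : WordFiltration q 1 (τ q)
  | v : WordFiltration q 1 (v q)
  | a : WordFiltration q 2 (a q)
  | m : WordFiltration q 3 (m q)
  | add {n x y} : WordFiltration q n x → WordFiltration q n y → WordFiltration q n (x + y)
  | mul {i j x y} : WordFiltration q i x → WordFiltration q j y → WordFiltration q (i + j) (x * y)
  | mono {n k x} : WordFiltration q n x → n ≤ k → WordFiltration q k x

theorem WordFiltration.exists (x : QGalilei q) : ∃ n, WordFiltration q n x := by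
  induction x using QGalilei.induction with
  | hm => exact ⟨_, .m⟩
  | hτ => exact ⟨_, .τ⟩
  | hv => exact ⟨_, .v⟩
  | ha => exact ⟨_, .a⟩
  | hc c => exact ⟨_, .scalar c⟩
  | hadd x y hx hy =>
    obtain ⟨i, hi⟩ := hx
    obtain ⟨j, hj⟩ := hy
    exact ⟨_, .add (hi.mono (le_max_left i j)) (hj.mono (le_max_right i j))⟩
  | hmul x y hx hy =>
    obtain ⟨i, hi⟩ := hx
    obtain ⟨j, hj⟩ := hy
    exact ⟨_, .mul hi hj⟩

theorem WordFiltration.eq_smul_one {n : ℕ} {x : QGalilei q} (h : WordFiltration q n x)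
    (hn : n = 0) : ∃ c : ℂ, x = c • 1 := by
  induction h with
  | scalar c => exact ⟨c, Algebra.algebraMap_eq_smul_one c⟩
  | τ | v | a | m => omega
  | add _ _ hx hy =>
    obtain ⟨c, rfl⟩ := hx hn
    obtain ⟨d, rfl⟩ := hy hn
    exact ⟨c + d, (add_smul _ _ _).symm⟩
  | mul _ _ hx hy =>
    obtain ⟨c, rfl⟩ := hx (by omega)
    obtain ⟨d, rfl⟩ := hy (by omega)
    exact ⟨c * d, by rw [smul_mul_smul_comm, one_mul]⟩
  | mono _ _ hx => exact hx (by omega)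

variable (q) in
/-- The steps of the filtration by the weight of words. -/
def wordFiltration (n : ℕ) : Submodule ℂ (QGalilei q) where
  carrier := {x | WordFiltration q n x}
  add_mem' := .add
  zero_mem' := by
    have := (WordFiltration.scalar (q := q) 0).mono n.zero_le
    rwa [map_zero] at this
  smul_mem' c x hx := by
    have := (WordFiltration.scalar (q := q) c).mul hx
    rwa [zero_add, ← Algebra.smul_def] at this

theorem comul_m : Coalgebra.comul (R := ℂ) (m q) =
    m q ⊗ₜ 1 + 1 ⊗ₜ m q - (1 / 2 : ℂ) • (v q ^ 2) ⊗ₜ τ q - v q ⊗ₜ a q := by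
  rw [comul_eq, lift_m]
theorem comul_τ : Coalgebra.comul (R := ℂ) (τ q) = τ q ⊗ₜ 1 + 1 ⊗ₜ τ q := by
  rw [comul_eq, lift_τ]
theorem comul_v : Coalgebra.comul (R := ℂ) (v q) = v q ⊗ₜ 1 + 1 ⊗ₜ v q := by
  rw [comul_eq, lift_v]
theorem comul_a : Coalgebra.comul (R := ℂ) (a q) = a q ⊗ₜ 1 + 1 ⊗ₜ a q + v q ⊗ₜ τ q := by
  rw [comul_eq, lift_a]
theorem comul_v_sq : Coalgebra.comul (R := ℂ) (v q ^ 2) =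
    (v q ^ 2) ⊗ₜ 1 + (2 : ℂ) • (v q ⊗ₜ v q) + 1 ⊗ₜ (v q ^ 2) := by
  rw [pow_two, Bialgebra.comul_mul, comul_v]
  simp only [mul_add, add_mul, Algebra.TensorProduct.tmul_mul_tmul, mul_one, one_mul]
  module

variable (q) in
/-- The filtration of a quantum Galilei group by the weight of words. -/
def filtration : ConnectedFiltration (QGalilei q) where
  F := wordFiltration q
  mono _ _ h _ hx := WordFiltration.mono hx h
  exists_mem := WordFiltration.exists
  eq_smul_one _ hx := WordFiltration.eq_smul_one hx rfl
  comul_mem n x hx := by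
    have hone : WordFiltration q 0 1 := by simpa using WordFiltration.scalar (q := q) 1
    induction hx with
    | scalar c =>
      refine Submodule.subset_span ⟨0, 0, _, 1, le_rfl, WordFiltration.scalar c, hone, ?_⟩
      rw [Bialgebra.comul_algebraMap, Algebra.TensorProduct.algebraMap_apply]
    | τ =>
      rw [comul_τ]
      exact add_mem (Submodule.subset_span ⟨1, 0, _, _, by omega, .τ, hone, rfl⟩)
        (Submodule.subset_span ⟨0, 1, _, _, by omega, hone, .τ, rfl⟩)
    | v =>
      rw [comul_v]
      exact add_mem (Submodule.subset_span ⟨1, 0, _, _, by omega, .v, hone, rfl⟩)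
        (Submodule.subset_span ⟨0, 1, _, _, by omega, hone, .v, rfl⟩)
    | a =>
      rw [comul_a]
      exact add_mem (add_mem (Submodule.subset_span ⟨2, 0, _, _, by omega, .a, hone, rfl⟩)
        (Submodule.subset_span ⟨0, 2, _, _, by omega, hone, .a, rfl⟩))
        (Submodule.subset_span ⟨1, 1, _, _, by omega, .v, .τ, rfl⟩)
    | m =>
      rw [comul_m]
      refine sub_mem (sub_mem (add_mem
        (Submodule.subset_span ⟨3, 0, _, _, by omega, .m, hone, rfl⟩)
        (Submodule.subset_span ⟨0, 3, _, _, by omega, hone, .m, rfl⟩))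
        (Submodule.smul_mem _ _ (Submodule.subset_span ⟨2, 1, _, _, by omega, ?_, .τ, rfl⟩)))
        (Submodule.subset_span ⟨1, 2, _, _, by omega, .v, .a, rfl⟩)
      rw [pow_two]
      exact WordFiltration.v.mul .v
    | add _ _ hx hy => rw [map_add]; exact add_mem hx hy
    | mul _ _ hx hy =>
      rw [Bialgebra.comul_mul]
      have := Submodule.mul_mem_mul hx hy
      rw [Submodule.span_mul_span] at this
      refine Submodule.span_mono ?_ this
      rintro _ ⟨_, ⟨i, j, y, w, hij, hy, hw, rfl⟩, _, ⟨i', j', y', w', hij', hy', hw', rfl⟩, rfl⟩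
      exact ⟨i + i', j + j', y * y', w * w', by omega, .mul hy hy', .mul hw hw', by simp⟩
    | mono _ h hx =>
      refine Submodule.span_mono ?_ hx
      rintro _ ⟨i, j, y, w, hij, hy, hw, rfl⟩
      exact ⟨i, j, y, w, by omega, hy, hw, rfl⟩

/-! ### Ordered monomials span -/

variable (q) in
/-- The span of the ordered monomials of weight at most `n`. In contrast to the filtration of the
coalgebra, `τ`, `v` and `a` all have weight one here, and `m` has weight three; with these weights
the commutators of `τ`, `v`, `a` have weight at most one and the commutators of these with `m` have
weight at most three. -/
def ordered (n : ℕ) : Submodule ℂ (QGalilei q) :=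
  Submodule.span ℂ {φ | ∃ α β γ σ, 3 * α + β + γ + σ ≤ n ∧ φ = monomial q α β γ σ}

theorem ordered_mono {n k : ℕ} (h : n ≤ k) : ordered q n ≤ ordered q k :=
  Submodule.span_mono (by
    rintro _ ⟨α, β, γ, σ, hw, rfl⟩
    exact ⟨α, β, γ, σ, hw.trans h, rfl⟩)

variable (q) in
/-- The elements whose left multiplication raises the weight of ordered polynomials by at most `j`,
as long as the resulting weight is at most `N`. -/
def raises (N j : ℕ) : Submodule ℂ (QGalilei q) where
  carrier := {x | ∀ k, k + j ≤ N → ∀ y ∈ ordered q k, x * y ∈ ordered q (k + j)}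
  add_mem' hx hy k hk z hz := by rw [add_mul]; exact add_mem (hx k hk z hz) (hy k hk z hz)
  zero_mem' k hk z hz := by rw [zero_mul]; exact zero_mem _
  smul_mem' c x hx k hk z hz := by
    rw [smul_mul_assoc]; exact Submodule.smul_mem _ _ (hx k hk z hz)

theorem raises_of_monomial {N j : ℕ} {x : QGalilei q}
    (h : ∀ α β γ σ, 3 * α + β + γ + σ + j ≤ N →
      x * monomial q α β γ σ ∈ ordered q (3 * α + β + γ + σ + j)) : x ∈ raises q N j := by
  intro k hk y hy
  induction hy using Submodule.span_induction with
  | mem y hy =>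
    obtain ⟨α, β, γ, σ, hw, rfl⟩ := hy
    exact ordered_mono (by omega) (h α β γ σ (by omega))
  | zero => rw [mul_zero]; exact zero_mem _
  | add y z _ _ hy hz => rw [mul_add]; exact add_mem hy hz
  | smul c y _ hy => rw [mul_smul_comm]; exact Submodule.smul_mem _ _ hy

theorem mul_mem_raises {N i j : ℕ} {x y : QGalilei q} (hx : x ∈ raises q N i)
    (hy : y ∈ raises q N j) : x * y ∈ raises q N (j + i) := fun k hk z hz => by
  rw [mul_assoc, ← add_assoc]
  exact hx _ (by omega) _ (hy k (by omega) z hz)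

/-- Raising the weight by `i` up to the bound `N` implies raising the weight by `j ≥ i` up to a
bound that is larger by at most `j - i`. -/
theorem raises_mono {N N' i j : ℕ} {x : QGalilei q} (hx : x ∈ raises q N i) (h : i ≤ j)
    (hN : N' + i ≤ N + j) : x ∈ raises q N' j := fun k hk z hz =>
  ordered_mono (by omega) (hx k (by omega) z hz)

theorem m_mul_monomial (α β γ σ : ℕ) :
    m q * monomial q α β γ σ = monomial q (α + 1) β γ σ := by
  simp only [monomial, pow_succ', mul_assoc]

theorem monomial_mem {α β γ σ n : ℕ} (h : 3 * α + β + γ + σ ≤ n) :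
    monomial q α β γ σ ∈ ordered q n := Submodule.subset_span ⟨α, β, γ, σ, h, rfl⟩

theorem m_mem_raises (N : ℕ) : m q ∈ raises q N 3 :=
  raises_of_monomial fun α β γ σ _ => by
    rw [m_mul_monomial]; exact monomial_mem (by omega)

theorem v_mul_τ_pow (β : ℕ) : v q * τ q ^ β = τ q ^ β * v q :=
  (show Commute (v q) (τ q) from sub_eq_zero.1 (holds q).vτ).pow_right β

/-- Commutators of generators have smaller weight than the products, so that reordering terminates
by induction on the weight. -/
theorem generators_mem_raises (N : ℕ) :
    τ q ∈ raises q N 1 ∧ v q ∈ raises q N 1 ∧ a q ∈ raises q N 1 := by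
  obtain ⟨hva, hvm, hτa, hτm, ham, -⟩ := holds q
  induction N with
  | zero => exact ⟨fun k hk => by omega, fun k hk => by omega, fun k hk => by omega⟩
  | succ N ih =>
    obtain ⟨hτ, hv, ha⟩ := ih
    have hm := m_mem_raises (q := q) N
    have hv2 : v q ^ 2 ∈ raises q N 2 := pow_two (v q) ▸ mul_mem_raises hv hv
    have hτ2 : τ q ^ 2 ∈ raises q N 2 := pow_two (τ q) ▸ mul_mem_raises hτ hτ
    have hv3 : v q ^ 3 ∈ raises q N 3 := by
      rw [pow_succ']; exact mul_mem_raises hv hv2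
    have k1 := raises_mono (N' := N) hv2 (by omega : 2 ≤ 3) (by omega)
    have k2 := raises_mono (N' := N) hτ2 (by omega : 2 ≤ 3) (by omega)
    have k3 := raises_mono (N' := N) hv (by omega : 1 ≤ 3) (by omega)
    have k4 := raises_mono (N' := N) hτ (by omega : 1 ≤ 3) (by omega)
    have k5 := raises_mono (N' := N) ha (by omega : 1 ≤ 3) (by omega)
    have bvm : (q.brackets (m q) (τ q) (v q) (a q)).vm ∈ raises q N 3 := by
      cases q <;> simp only [Case.brackets, neg_smul, neg_mem_iff, Submodule.smul_mem, zero_mem, *]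
    have bτm : (q.brackets (m q) (τ q) (v q) (a q)).τm ∈ raises q N 3 := by
      cases q <;> simp only [Case.brackets, neg_smul, neg_mem_iff, add_mem, Submodule.smul_mem,
        zero_mem, *]
    have bam : (q.brackets (m q) (τ q) (v q) (a q)).am ∈ raises q N 3 := by
      cases q <;> simp only [Case.brackets, neg_smul] <;>
        repeat' first
          | assumption | apply add_mem | apply sub_mem | apply neg_mem | apply Submodule.smul_mem
    have bva : (q.brackets (m q) (τ q) (v q) (a q)).va ∈ raises q N 1 := by
      cases q <;> simp only [Case.brackets, Submodule.smul_mem, zero_mem, *]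
    have bτa : (q.brackets (m q) (τ q) (v q) (a q)).τa ∈ raises q N 1 := by
      cases q <;> simp only [Case.brackets, neg_smul, neg_mem_iff, Submodule.smul_mem, zero_mem, *]
    -- Moving a generator past the leading `m` of a monomial.
    have step : ∀ g b : QGalilei q, g * m q - m q * g = b → g ∈ raises q N 1 →
        b ∈ raises q N 3 → ∀ α β γ σ, 3 * (α + 1) + β + γ + σ + 1 ≤ N + 1 →
        g * monomial q (α + 1) β γ σ ∈ ordered q (3 * (α + 1) + β + γ + σ + 1) := by
      rintro g b hgb hg hb α β γ σ hw
      have : g * monomial q (α + 1) β γ σ =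
          m q * (g * monomial q α β γ σ) + b * monomial q α β γ σ := by
        rw [← m_mul_monomial, ← hgb]; noncomm_ring
      rw [this]
      have h1 := hg _ (by omega) _ (monomial_mem (q := q) (le_refl (3 * α + β + γ + σ)))
      have h2 := m_mem_raises _ _ le_rfl _ h1
      have h3 := hb _ (by omega) _ (monomial_mem (q := q) (le_refl (3 * α + β + γ + σ)))
      exact add_mem (ordered_mono (by omega) h2) (ordered_mono (by omega) h3)
    have Hτ : τ q ∈ raises q (N + 1) 1 := by
      refine raises_of_monomial fun α β γ σ hw => ?_
      rcases α with _ | α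
      · have : τ q * monomial q 0 β γ σ = monomial q 0 (β + 1) γ σ := by
          simp only [monomial, pow_succ', mul_assoc, pow_zero, one_mul]
        rw [this]
        exact monomial_mem (by omega)
      · exact step _ _ hτm hτ bτm α β γ σ hw
    have Hv : v q ∈ raises q (N + 1) 1 := by
      refine raises_of_monomial fun α β γ σ hw => ?_
      rcases α with _ | α
      · have : v q * monomial q 0 β γ σ = monomial q 0 β γ (σ + 1) := by
          simp only [monomial, pow_zero, one_mul]
          rw [← mul_assoc, ← mul_assoc, v_mul_τ_pow, pow_succ']
          simp only [mul_assoc]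
        rw [this]
        exact monomial_mem (by omega)
      · exact step _ _ hvm hv bvm α β γ σ hw
    refine ⟨Hτ, Hv, raises_of_monomial fun α β γ σ hw => ?_⟩
    rcases α with _ | α
    · rcases β with _ | β
      · rcases σ with _ | σ
        · have : a q * monomial q 0 0 γ 0 = monomial q 0 0 (γ + 1) 0 := by
            simp only [monomial, pow_zero, one_mul, pow_succ']
          rw [this]
          exact monomial_mem (by omega)
        · have : a q * monomial q 0 0 γ (σ + 1) = v q * (a q * monomial q 0 0 γ σ) -
              (q.brackets (m q) (τ q) (v q) (a q)).va * monomial q 0 0 γ σ := by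
            rw [← hva]
            simp only [monomial, pow_zero, one_mul, pow_succ']
            noncomm_ring
          rw [this]
          have h0 := monomial_mem (q := q) (le_refl (3 * 0 + 0 + γ + σ))
          have h1 := Hv _ (by omega) _ (ha _ (by omega) _ h0)
          have h2 := bva _ (by omega) _ h0
          exact sub_mem (ordered_mono (by omega) h1) (ordered_mono (by omega) h2)
      · have : a q * monomial q 0 (β + 1) γ σ = τ q * (a q * monomial q 0 β γ σ) -
            (q.brackets (m q) (τ q) (v q) (a q)).τa * monomial q 0 β γ σ := by
          rw [← hτa]
          simp only [monomial, pow_zero, one_mul, pow_succ']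
          noncomm_ring
        rw [this]
        have h0 := monomial_mem (q := q) (le_refl (3 * 0 + β + γ + σ))
        have h1 := Hτ _ (by omega) _ (ha _ (by omega) _ h0)
        have h2 := bτa _ (by omega) _ h0
        exact sub_mem (ordered_mono (by omega) h1) (ordered_mono (by omega) h2)
    · exact step _ _ ham ha bam α β γ σ hw

theorem span_monomial (q : Case) :
    Submodule.span ℂ {φ : QGalilei q | ∃ α β γ σ : ℕ, φ = monomial q α β γ σ} = ⊤ := by
  set S := Submodule.span ℂ {φ : QGalilei q | ∃ α β γ σ : ℕ, φ = monomial q α β γ σ} with hS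
  have hle : ∀ n, ordered q n ≤ S := fun n => Submodule.span_mono (by
    rintro _ ⟨α, β, γ, σ, -, rfl⟩
    exact ⟨α, β, γ, σ, rfl⟩)
  have hmem : ∀ x ∈ S, ∃ n, x ∈ ordered q n := by
    intro x hx
    induction hx using Submodule.span_induction with
    | mem x hx =>
      obtain ⟨α, β, γ, σ, rfl⟩ := hx
      exact ⟨_, monomial_mem le_rfl⟩
    | zero => exact ⟨0, zero_mem _⟩
    | add x y _ _ hx hy =>
      obtain ⟨i, hi⟩ := hx
      obtain ⟨j, hj⟩ := hy
      exact ⟨max i j, add_mem (ordered_mono (le_max_left _ _) hi)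
        (ordered_mono (le_max_right _ _) hj)⟩
    | smul c x _ hx =>
      obtain ⟨i, hi⟩ := hx
      exact ⟨i, Submodule.smul_mem _ _ hi⟩
  have hmul : ∀ x : QGalilei q, ∀ y ∈ S, x * y ∈ S := by
    have hgen : ∀ g j, (∀ N, g ∈ raises q N j) → ∀ y ∈ S, g * y ∈ S := by
      intro g j hg y hy
      obtain ⟨n, hn⟩ := hmem y hy
      exact hle _ (hg (n + j) n le_rfl y hn)
    intro x
    induction x using QGalilei.induction with
    | hm => exact hgen _ 3 m_mem_raises
    | hτ => exact hgen _ 1 fun N => (generators_mem_raises N).1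
    | hv => exact hgen _ 1 fun N => (generators_mem_raises N).2.1
    | ha => exact hgen _ 1 fun N => (generators_mem_raises N).2.2
    | hc c => intro y hy; rw [← Algebra.smul_def]; exact Submodule.smul_mem _ _ hy
    | hadd x y hx hy => intro z hz; rw [add_mul]; exact add_mem (hx z hz) (hy z hz)
    | hmul x y hx hy => intro z hz; rw [mul_assoc]; exact hx _ (hy z hz)
  rw [eq_top_iff]
  intro x _
  have h1 : (1 : QGalilei q) ∈ S := Submodule.subset_span ⟨0, 0, 0, 0, by simp [monomial]⟩
  simpa using hmul x 1 h1
variable {q : Case}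

/-! ### Values at the generators determine functionals -/

section Evaluation
variable (X Y : Dual (QGalilei q))

theorem mul_apply_one : (X * Y) 1 = X 1 * Y 1 := by
  rw [dual_mul_apply, Bialgebra.comul_one, Algebra.TensorProduct.one_def, tens_tmul]

theorem mul_apply_τ : (X * Y) (τ q) = X (τ q) * Y 1 + X 1 * Y (τ q) := by
  rw [dual_mul_apply, comul_τ, map_add, tens_tmul, tens_tmul]

theorem mul_apply_v : (X * Y) (v q) = X (v q) * Y 1 + X 1 * Y (v q) := by
  rw [dual_mul_apply, comul_v, map_add, tens_tmul, tens_tmul]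

theorem mul_apply_a :
    (X * Y) (a q) = X (a q) * Y 1 + X 1 * Y (a q) + X (v q) * Y (τ q) := by
  rw [dual_mul_apply, comul_a, map_add, map_add, tens_tmul, tens_tmul, tens_tmul]

theorem mul_apply_m : (X * Y) (m q) = X (m q) * Y 1 + X 1 * Y (m q)
    - 1 / 2 * (X (v q ^ 2) * Y (τ q)) - X (v q) * Y (a q) := by
  rw [dual_mul_apply, comul_m, map_sub, map_sub, map_add, TensorProduct.smul_tmul']
  simp only [tens_tmul, map_smul, smul_eq_mul, mul_assoc]

theorem mul_apply_v_sq : (X * Y) (v q ^ 2) =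
    X (v q ^ 2) * Y 1 + 2 * (X (v q) * Y (v q)) + X 1 * Y (v q ^ 2) := by
  rw [dual_mul_apply, comul_v_sq, map_add, map_add, map_smul]
  simp only [tens_tmul, smul_eq_mul]

theorem one_apply_one : (1 : Dual (QGalilei q)) 1 = 1 := by
  rw [dual_one_apply, Bialgebra.counit_one]
theorem one_apply_m : (1 : Dual (QGalilei q)) (m q) = 0 := by
  rw [dual_one_apply, counit_eq, lift_m]
theorem one_apply_τ : (1 : Dual (QGalilei q)) (τ q) = 0 := by
  rw [dual_one_apply, counit_eq, lift_τ]
theorem one_apply_v : (1 : Dual (QGalilei q)) (v q) = 0 := by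
  rw [dual_one_apply, counit_eq, lift_v]
theorem one_apply_a : (1 : Dual (QGalilei q)) (a q) = 0 := by
  rw [dual_one_apply, counit_eq, lift_a]
theorem one_apply_v_sq : (1 : Dual (QGalilei q)) (v q ^ 2) = 0 := by
  rw [dual_one_apply, Bialgebra.counit_pow, counit_eq, lift_v, zero_pow two_ne_zero]

/-- The functional vanishes on `1`, `v` and `v ^ 2`. Powers of such functionals vanish on the
generators. -/
structure VanishesOnV : Prop where
  apply_one : X 1 = 0
  apply_v : X (v q) = 0
  apply_v_sq : X (v q ^ 2) = 0

variable {X Y}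

theorem VanishesOnV.smul (h : VanishesOnV X) (c : ℂ) : VanishesOnV (c • X) :=
  ⟨by simp [h.apply_one], by simp [h.apply_v], by simp [h.apply_v_sq]⟩

theorem VanishesOnV.pow_succ (h : VanishesOnV X) (n : ℕ) : VanishesOnV (X ^ (n + 1)) := by
  induction n with
  | zero => simpa using h
  | succ n ih =>
    rw [_root_.pow_succ]
    exact ⟨by rw [mul_apply_one, h.apply_one, mul_zero], by rw [mul_apply_v]; simp [ih.apply_one,
      ih.apply_v], by rw [mul_apply_v_sq]; simp [ih.apply_one, ih.apply_v, ih.apply_v_sq]⟩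

/-- Power series in a functional that vanishes on `1`, `v` and `v ^ 2` are affine at each element at
which the products with functionals of this kind vanish. -/
theorem VanishesOnV.series_apply (h : VanishesOnV X) (f : ℕ → ℂ) {g : QGalilei q}
    (hg : ∀ Y : Dual (QGalilei q), VanishesOnV Y → (Y * X) g = 0) :
    series f X g = f 0 * (1 : Dual (QGalilei q)) g + f 1 * X g := by
  rw [QuantumGalilei.series_apply f ((filtration q).locallyNilpotent h.apply_one),
    finsum_eq_sum_of_support_subset (s := Finset.range 2)]
  · rw [Finset.sum_range_succ, Finset.sum_range_one, pow_zero, pow_one]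
  · intro n hn
    simp only [Finset.coe_range, Set.mem_Iio]
    by_contra hlt
    obtain ⟨n, rfl⟩ : ∃ k, n = k + 1 + 1 := ⟨n - 2, by omega⟩
    refine hn ?_
    simp only
    rw [_root_.pow_succ, hg _ (h.pow_succ n), mul_zero]

theorem VanishesOnV.exp_apply_m (h : VanishesOnV X) : exp X (m q) = X (m q) := by
  rw [exp, h.series_apply _ fun Y hY => by rw [mul_apply_m]; simp [h.apply_one, hY.apply_one,
    hY.apply_v, hY.apply_v_sq], one_apply_m]
  simp
theorem VanishesOnV.exp_apply_a (h : VanishesOnV X) : exp X (a q) = X (a q) := by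
  rw [exp, h.series_apply _ fun Y hY => by rw [mul_apply_a]; simp [h.apply_one, hY.apply_one,
    hY.apply_v], one_apply_a]
  simp
theorem VanishesOnV.exp_apply_τ (h : VanishesOnV X) : exp X (τ q) = X (τ q) := by
  rw [exp, h.series_apply _ fun Y hY => by rw [mul_apply_τ]; simp [h.apply_one, hY.apply_one],
    one_apply_τ]
  simp
theorem VanishesOnV.exp_apply_v (h : VanishesOnV X) : exp X (v q) = 0 := by
  rw [exp, h.series_apply _ fun Y hY => by rw [mul_apply_v]; simp [h.apply_one, hY.apply_one],
    one_apply_v, h.apply_v]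
  simp
theorem VanishesOnV.exp_apply_v_sq (h : VanishesOnV X) : exp X (v q ^ 2) = 0 := by
  rw [exp, h.series_apply _ fun Y hY => by rw [mul_apply_v_sq]; simp [h.apply_one, hY.apply_one,
    hY.apply_v], one_apply_v_sq, h.apply_v_sq]
  simp

end Evaluation

/-- The functionals take the same values on `1` and on the generators. -/
structure AgreeOnGenerators (X Y : Dual (QGalilei q)) : Prop where
  apply_one : X 1 = Y 1
  apply_m : X (m q) = Y (m q)
  apply_τ : X (τ q) = Y (τ q)
  apply_v : X (v q) = Y (v q)
  apply_a : X (a q) = Y (a q)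

/-- Functionals that satisfy the same linear system of coproduct equations and agree on the
generators are equal. -/
theorem eq_of_coproduct_family {ι : Type*} [Fintype ι] {X Y : ι → Dual (QGalilei q)}
    {L R : ι → ι → Dual (QGalilei q)} {T : ι → Dual (QGalilei q ⊗[ℂ] QGalilei q)}
    (hX : ∀ i, coproduct (X i) = ∑ j, (L i j ⊠ X j + X j ⊠ R i j) + T i)
    (hY : ∀ i, coproduct (Y i) = ∑ j, (L i j ⊠ Y j + Y j ⊠ R i j) + T i)
    (h : ∀ i, AgreeOnGenerators (X i) (Y i)) : X = Y := by
  have hs : ∀ (F : ι → Dual (QGalilei q ⊗[ℂ] QGalilei q)) z, (∑ j, F j) z = ∑ j, F j z := by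
    intro F z
    rw [WithConv.ofConv_sum, LinearMap.sum_apply]
  suffices ∀ φ, ∀ i, X i φ = Y i φ from funext fun i => dual_ext fun φ => this φ i
  intro φ
  induction φ using QGalilei.induction with
  | hm => exact fun i => (h i).apply_m
  | hτ => exact fun i => (h i).apply_τ
  | hv => exact fun i => (h i).apply_v
  | ha => exact fun i => (h i).apply_a
  | hc c =>
    intro i
    rw [Algebra.algebraMap_eq_smul_one, map_smul, map_smul, (h i).apply_one]
  | hadd x y hx hy =>
    intro i
    rw [map_add, map_add, hx, hy]
  | hmul x y hx hy =>
    intro i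
    rw [← coproduct_tmul, ← coproduct_tmul, hX, hY]
    simp only [dual_add_apply, hs, tens_tmul, hx, hy]

theorem eq_of_coproduct {X Y L R : Dual (QGalilei q)}
    {T : Dual (QGalilei q ⊗[ℂ] QGalilei q)} (hX : coproduct X = L ⊠ X + X ⊠ R + T)
    (hY : coproduct Y = L ⊠ Y + Y ⊠ R + T) (h : AgreeOnGenerators X Y) : X = Y := by
  have := eq_of_coproduct_family (ι := Unit) (X := fun _ => X) (Y := fun _ => Y)
    (L := fun _ _ => L) (R := fun _ _ => R) (T := fun _ => T)
    (by simpa using hX) (by simpa using hY) (fun _ => h)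
  exact congrFun this ()

/-- A primitive functional that vanishes on `v`, `v ^ 2`, `τ` and `a` is central: both translations
`φ ↦ φ₁ M(φ₂)` and `φ ↦ M(φ₁) φ₂` are derivations of the algebra, and they agree on the
generators. -/
theorem central_of_primitive {M : Dual (QGalilei q)} (hM : coproduct M = 1 ⊠ M + M ⊠ 1)
    (hv : M (v q) = 0) (hv2 : M (v q ^ 2) = 0) (hτ : M (τ q) = 0) (ha : M (a q) = 0)
    (X : Dual (QGalilei q)) : Commute X M := by
  have h1 : M 1 = 0 := by
    have := coproduct_tmul M (1 : QGalilei q) 1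
    rw [hM, dual_add_apply, tens_tmul, tens_tmul, one_apply_one, mul_one, mul_one] at this
    linear_combination this
  have hmul : ∀ x y, M (x * y) = (1 : Dual (QGalilei q)) x * M y + M x * (1 : Dual
    (QGalilei q)) y := by
    intro x y
    rw [← coproduct_tmul, hM, dual_add_apply, tens_tmul, tens_tmul]
  -- The two translation operators defined by a functional.
  let l : Dual (QGalilei q) → QGalilei q ⊗[ℂ] QGalilei q →ₗ[ℂ] QGalilei q := fun Y =>
    (TensorProduct.rid ℂ _).toLinearMap ∘ₗ Y.ofConv.lTensor _
  let r : Dual (QGalilei q) → QGalilei q ⊗[ℂ] QGalilei q →ₗ[ℂ] QGalilei q := fun Y =>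
    (TensorProduct.lid ℂ _).toLinearMap ∘ₗ Y.ofConv.rTensor _
  have hl : ∀ Y x y, l Y (x ⊗ₜ y) = Y y • x := fun Y x y => by simp [l]
  have hr : ∀ Y x y, r Y (x ⊗ₜ y) = Y x • y := fun Y x y => by simp [r]
  have lmul : ∀ z w, l M (z * w) = l 1 z * l M w + l M z * l 1 w := by
    intro z w
    induction z with
    | zero => simp
    | add a b ha hb => simp only [add_mul, map_add, ha, hb]; abel
    | tmul x y =>
      induction w with
      | zero => simp
      | add a b ha hb => simp only [mul_add, map_add, ha, hb]; abel
      | tmul x' y' =>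
        rw [Algebra.TensorProduct.tmul_mul_tmul, hl, hl, hl, hl, hl, hmul]
        simp only [add_smul, mul_smul, smul_mul_assoc, mul_smul_comm]
        rw [smul_comm (M.ofConv y)]
        module
  have rmul : ∀ z w, r M (z * w) = r 1 z * r M w + r M z * r 1 w := by
    intro z w
    induction z with
    | zero => simp
    | add a b ha hb => simp only [add_mul, map_add, ha, hb]; abel
    | tmul x y =>
      induction w with
      | zero => simp
      | add a b ha hb => simp only [mul_add, map_add, ha, hb]; abel
      | tmul x' y' =>
        rw [Algebra.TensorProduct.tmul_mul_tmul, hr, hr, hr, hr, hr, hmul]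
        simp only [add_smul, mul_smul, smul_mul_assoc, mul_smul_comm]
        module
  have l1 : ∀ x : QGalilei q, l 1 (Coalgebra.comul (R := ℂ) x) = x := fun x => by
    have := Coalgebra.lTensor_counit_comul (R := ℂ) x
    change TensorProduct.rid ℂ _ (LinearMap.lTensor _ Coalgebra.counit _) = x
    rw [this]; simp
  have r1 : ∀ x : QGalilei q, r 1 (Coalgebra.comul (R := ℂ) x) = x := fun x => by
    have := Coalgebra.rTensor_counit_comul (R := ℂ) x
    change TensorProduct.lid ℂ _ (LinearMap.rTensor _ Coalgebra.counit _) = x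
    rw [this]; simp
  have key : ∀ x : QGalilei q,
      l M (Coalgebra.comul (R := ℂ) x) = r M (Coalgebra.comul (R := ℂ) x) := by
    intro x
    induction x using QGalilei.induction with
    | hm =>
      rw [comul_m, TensorProduct.smul_tmul']
      simp [hl, hr, h1, hv, hv2, hτ, ha]
    | hτ => rw [comul_τ]; simp [hl, hr, h1, hτ]
    | hv => rw [comul_v]; simp [hl, hr, h1, hv]
    | ha => rw [comul_a]; simp [hl, hr, h1, ha, hv, hτ]
    | hc c =>
      rw [Bialgebra.comul_algebraMap, Algebra.TensorProduct.algebraMap_apply, hl, hr,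
        Algebra.algebraMap_eq_smul_one, map_smul, h1]
      simp
    | hadd x y hx hy => simp only [map_add, hx, hy]
    | hmul x y hx hy =>
      rw [Bialgebra.comul_mul, lmul, rmul, l1, l1, r1, r1, hx, hy]
  have e1 : ∀ z, (X ⊠ M) z = X (l M z) := by
    intro z
    induction z with
    | zero => simp
    | tmul x y => rw [tens_tmul, hl, map_smul, smul_eq_mul, mul_comm]
    | add a b ha hb => simp only [map_add, ha, hb]
  have e2 : ∀ z, (M ⊠ X) z = X (r M z) := by
    intro z
    induction z with
    | zero => simp
    | tmul x y => rw [tens_tmul, hr, map_smul, smul_eq_mul]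
    | add a b ha hb => simp only [map_add, ha, hb]
  exact dual_ext fun x => by rw [dual_mul_apply, dual_mul_apply, e1, e2, key]
variable {q : Case}

/-! ### Matrix coefficients of representations -/

section Monomials
variable {V : Type*} [AddCommGroup V] [Module ℂ V] {m τ v a : Module.End ℂ V} {x y₁ y₂ y₃ y₄ : V}

/-- The images of a vector under ordered products of four operators, applied in the order
`m`, `τ`, `v`, `a`, when all products of two operators, in this order, kill the vector. -/
theorem apply_monomial_right (hm : m x = y₁) (hτ : τ x = y₂) (hv : v x = y₃) (ha : a x = y₄)
    (hm1 : m y₁ = 0) (hτ1 : τ y₁ = 0) (hv1 : v y₁ = 0) (ha1 : a y₁ = 0)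
    (hτ2 : τ y₂ = 0) (hv2 : v y₂ = 0) (ha2 : a y₂ = 0)
    (hv3 : v y₃ = 0) (ha3 : a y₃ = 0) (ha4 : a y₄ = 0) (α β γ σ : ℕ) :
    (a ^ γ) ((v ^ σ) ((τ ^ β) ((m ^ α) x))) =
      (if α = 0 ∧ β = 0 ∧ γ = 0 ∧ σ = 0 then x else 0) +
      (if α = 1 ∧ β = 0 ∧ γ = 0 ∧ σ = 0 then y₁ else 0) +
      (if α = 0 ∧ β = 1 ∧ γ = 0 ∧ σ = 0 then y₂ else 0) +
      (if α = 0 ∧ β = 0 ∧ γ = 0 ∧ σ = 1 then y₃ else 0) +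
      (if α = 0 ∧ β = 0 ∧ γ = 1 ∧ σ = 0 then y₄ else 0) := by
  rcases α with _ | _ | α
  · rcases β with _ | _ | β
    · rcases σ with _ | _ | σ
      · rcases γ with _ | _ | γ <;> simp [pow_succ, *]
      · rcases γ with _ | γ <;> simp [pow_succ, *]
      · simp [pow_succ, *]
    · rcases σ with _ | σ
      · rcases γ with _ | γ <;> simp [pow_succ, *]
      · simp [pow_succ, *]
    · simp [pow_succ, *]
  · rcases β with _ | β
    · rcases σ with _ | σ
      · rcases γ with _ | γ <;> simp [pow_succ, *]
      · simp [pow_succ, *]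
    · simp [pow_succ, *]
  · simp [pow_succ, *]

/-- The images of a vector under ordered products of four operators, applied in the order
`a`, `v`, `τ`, `m`, when all products of two operators, in this order, kill the vector. -/
theorem apply_monomial_left (hm : m x = y₁) (hτ : τ x = y₂) (hv : v x = y₃) (ha : a x = y₄)
    (hm1 : m y₁ = 0) (hm2 : m y₂ = 0) (hm3 : m y₃ = 0) (hm4 : m y₄ = 0)
    (hτ2 : τ y₂ = 0) (hτ3 : τ y₃ = 0) (hτ4 : τ y₄ = 0)
    (hv3 : v y₃ = 0) (hv4 : v y₄ = 0) (ha4 : a y₄ = 0) (α β γ σ : ℕ) :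
    (m ^ α) ((τ ^ β) ((v ^ σ) ((a ^ γ) x))) =
      (if α = 0 ∧ β = 0 ∧ γ = 0 ∧ σ = 0 then x else 0) +
      (if α = 1 ∧ β = 0 ∧ γ = 0 ∧ σ = 0 then y₁ else 0) +
      (if α = 0 ∧ β = 1 ∧ γ = 0 ∧ σ = 0 then y₂ else 0) +
      (if α = 0 ∧ β = 0 ∧ γ = 0 ∧ σ = 1 then y₃ else 0) +
      (if α = 0 ∧ β = 0 ∧ γ = 1 ∧ σ = 0 then y₄ else 0) := by
  rcases γ with _ | _ | γ
  · rcases σ with _ | _ | σ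
    · rcases β with _ | _ | β
      · rcases α with _ | _ | α <;> simp [pow_succ, *]
      · rcases α with _ | α <;> simp [pow_succ, *]
      · simp [pow_succ, *]
    · rcases β with _ | β
      · rcases α with _ | α <;> simp [pow_succ, *]
      · simp [pow_succ, *]
    · simp [pow_succ, *]
  · rcases σ with _ | σ
    · rcases β with _ | β
      · rcases α with _ | α <;> simp [pow_succ, *]
      · simp [pow_succ, *]
    · simp [pow_succ, *]
  · simp [pow_succ, *]

end Monomials

/-- A multiplicative matrix of functionals is determined by its values on the generators. -/
theorem eq_of_multiplicative {ι : Type*} [Fintype ι] {W W' : ι → ι → Dual (QGalilei q)}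
    (hW : ∀ i j, coproduct (W i j) = ∑ k, W i k ⊠ W k j)
    (hW' : ∀ i j, coproduct (W' i j) = ∑ k, W' i k ⊠ W' k j)
    (h : ∀ i j, AgreeOnGenerators (W i j) (W' i j)) (i j : ι) : W i j = W' i j := by
  refine dual_ext fun φ => ?_
  induction φ using QGalilei.induction generalizing i j with
  | hm => exact (h i j).apply_m
  | hτ => exact (h i j).apply_τ
  | hv => exact (h i j).apply_v
  | ha => exact (h i j).apply_a
  | hc c => rw [Algebra.algebraMap_eq_smul_one, map_smul, map_smul, (h i j).apply_one]
  | hadd x y hx hy => rw [map_add, map_add, hx, hy]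
  | hmul x y hx hy =>
    rw [← coproduct_tmul, ← coproduct_tmul, hW, hW', WithConv.ofConv_sum, LinearMap.sum_apply,
      WithConv.ofConv_sum, LinearMap.sum_apply]
    simp only [tens_tmul, hx, hy]

section Coefficients
variable {n : Type*} [Fintype n] [DecidableEq n] (ρ : QGalilei q →ₐ[ℂ] Matrix n n ℂ)

/-- The matrix coefficients of a representation. -/
def coefficient (i j : n) : Dual (QGalilei q) :=
  .toConv (Matrix.entryLinearMap ℂ ℂ i j ∘ₗ ρ.toLinearMap)

theorem coefficient_apply (i j : n) (φ : QGalilei q) : coefficient ρ i j φ = ρ φ i j := rfl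

theorem coproduct_coefficient (i j : n) :
    coproduct (coefficient ρ i j) = ∑ k, coefficient ρ i k ⊠ coefficient ρ k j := by
  refine tens_ext fun φ ψ => ?_
  rw [coproduct_tmul, coefficient_apply, map_mul, Matrix.mul_apply, WithConv.ofConv_sum,
    LinearMap.sum_apply]
  simp only [tens_tmul, coefficient_apply]

/-- A matrix of functionals which is multiplicative and agrees with a representation on the
generators consists of the coefficients of this representation. Only a part of the index set is
considered, on which the representation has to be block triangular. -/
theorem eq_coefficient {ι : Type*} [Fintype ι] (e : ι → n) {W : ι → ι → Dual (QGalilei q)}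
    (hρ : ∀ i j, coproduct (coefficient ρ (e i) (e j)) =
      ∑ k, coefficient ρ (e i) (e k) ⊠ coefficient ρ (e k) (e j))
    (hW : ∀ i j, coproduct (W i j) = ∑ k, W i k ⊠ W k j)
    (h : ∀ i j, AgreeOnGenerators (W i j) (coefficient ρ (e i) (e j))) (i j : ι) :
    W i j = coefficient ρ (e i) (e j) :=
  eq_of_multiplicative hW hρ h i j

/-- Coefficients outside of a block triangular shape vanish. -/
theorem coefficient_eq_zero (z : n → n → Prop) (hz : ∀ i j, z i j → ∀ k, z i k ∨ z k j)
    (hd : ∀ i, ¬ z i i) (hm : ∀ i j, z i j → ρ (m q) i j = 0) (hτ : ∀ i j, z i j → ρ (τ q) i j = 0)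
    (hv : ∀ i j, z i j → ρ (v q) i j = 0) (ha : ∀ i j, z i j → ρ (a q) i j = 0) {i j : n}
    (h : z i j) : coefficient ρ i j = 0 := by
  refine dual_ext fun φ => ?_
  rw [coefficient_apply, dual_zero_apply]
  induction φ using QGalilei.induction generalizing i j with
  | hm => exact hm i j h
  | hτ => exact hτ i j h
  | hv => exact hv i j h
  | ha => exact ha i j h
  | hc c =>
    have : i ≠ j := fun e => hd i (e ▸ h)
    rw [AlgHom.commutes, Matrix.algebraMap_matrix_apply, if_neg this]
  | hadd x y hx hy => rw [map_add, Matrix.add_apply, hx h, hy h, add_zero]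
  | hmul x y hx hy =>
    rw [map_mul, Matrix.mul_apply]
    refine Finset.sum_eq_zero fun k _ => ?_
    rcases hz i j h k with h' | h'
    · rw [hx h', zero_mul]
    · rw [hy h', mul_zero]

end Coefficients

/-- The values of a functional on `1` and on the generators. -/
structure HasValues (X : Dual (QGalilei q)) (c₀ cm cτ cv ca : ℂ) : Prop where
  apply_one : X 1 = c₀
  apply_m : X (m q) = cm
  apply_τ : X (τ q) = cτ
  apply_v : X (v q) = cv
  apply_a : X (a q) = ca

theorem HasValues.agree {X Y : Dual (QGalilei q)} {c₀ cm cτ cv ca : ℂ}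
    (hX : HasValues X c₀ cm cτ cv ca) (hY : HasValues Y c₀ cm cτ cv ca) : AgreeOnGenerators X Y :=
  ⟨hX.1.trans hY.1.symm, hX.2.trans hY.2.symm, hX.3.trans hY.3.symm, hX.4.trans hY.4.symm,
    hX.5.trans hY.5.symm⟩

/-! ### Representations by right translation -/

section Right

/-- The parameters of the representation of the algebra by right translations on the span of `1`,
`M`, `H`, `P`, `K`. The first letter of the name of a parameter stands for one of `H`, `P`, `K`,
whose coefficient it is in the translate by `m` of the functional that the second letter names; `s`
is the coefficient of `P` in the translate of `K` by `τ`. -/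
structure RightData where
  hH : ℂ
  hK : ℂ
  kH : ℂ
  kK : ℂ
  pP : ℂ
  pH : ℂ
  pK : ℂ
  s : ℂ

namespace RightData
open Matrix (single)

/-- The action of `m`; the basis vectors with the numbers `0`, …, `4` are `1`, `M`, `H`, `P`, `K`,
and matrices act on rows. -/
def matM (d : RightData) : Matrix (Fin 5) (Fin 5) ℂ :=
  single 0 1 (-I) + single 2 2 d.hH + single 2 4 d.hK + single 4 2 d.kH + single 4 4 d.kK +
    single 3 3 d.pP + single 3 2 d.pH + single 3 4 d.pK
/-- The action of `τ`. -/
def matτ (d : RightData) : Matrix (Fin 5) (Fin 5) ℂ := single 0 2 I + single 3 4 d.s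
/-- The action of `v`. -/
def matV : Matrix (Fin 5) (Fin 5) ℂ := single 0 4 (-I)
/-- The action of `a`. -/
def matA : Matrix (Fin 5) (Fin 5) ℂ := single 0 3 (-I)

variable (d : RightData)

/-- The conditions on the parameters under which the commutators of the matrices are linear
combinations of the matrices. -/
structure Compatible : Prop where
  kH : d.s * d.kH = 0
  hH : d.s * d.hH = 0
  pH : d.s * d.pH = 0
  kK : d.pP * d.s = d.s * d.kK

theorem va : matV * matA - matA * matV = 0 := by simp [matV, matA]
theorem vτ : matV * d.matτ - d.matτ * matV = 0 := by simp [matV, matτ, mul_add, add_mul]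
theorem v_sq : matV ^ 2 = 0 := by simp [matV, pow_two]
theorem v_cube : matV ^ 3 = 0 := by simp [matV, pow_succ]
theorem τ_sq : d.matτ ^ 2 = 0 := by simp [matτ, pow_two, mul_add, add_mul]
theorem τa : d.matτ * matA - matA * d.matτ = -d.s • matV := by
  simp [matτ, matA, matV, mul_add, add_mul, Matrix.smul_single, mul_comm]

theorem vm (h : d.Compatible) :
    matV * d.matM - d.matM * matV = d.kK • matV - d.kH • d.matτ := by
  have h1 : d.kH * d.s = 0 := by rw [mul_comm, h.kH]
  simp [matτ, matM, matV, mul_add, add_mul, Matrix.smul_single, mul_comm, h1, ← Matrix.single_neg]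
  abel
theorem τm (h : d.Compatible) :
    d.matτ * d.matM - d.matM * d.matτ = d.hH • d.matτ - d.hK • matV := by
  have h1 : d.kH * d.s = 0 := by rw [mul_comm, h.kH]
  have h2 : d.hH * d.s = 0 := by rw [mul_comm, h.hH]
  have h3 : d.pP * d.s = d.kK * d.s := by rw [h.kK, mul_comm]
  simp [matτ, matM, matV, mul_add, add_mul, Matrix.smul_single, mul_comm, h1, h2, h3,
    ← Matrix.single_neg]
theorem am (h : d.Compatible) :
    matA * d.matM - d.matM * matA = d.pP • matA - d.pH • d.matτ + d.pK • matV := by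
  have h1 : d.pH * d.s = 0 := by rw [mul_comm, h.pH]
  simp [matτ, matM, matV, matA, mul_add, add_mul, Matrix.smul_single, mul_comm, h1,
    ← Matrix.single_neg]
  abel

end RightData

end Right
variable {q : Case}

theorem vecMul_pow {n : Type*} [Fintype n] [DecidableEq n] (A : Matrix n n ℂ) (x : n → ℂ) (k : ℕ) :
    Matrix.vecMul x (A ^ k) = ((Matrix.vecMulLinear A : Module.End ℂ (n → ℂ)) ^ k) x := by
  induction k with
  | zero => simp
  | succ k ih => rw [pow_succ, ← Matrix.vecMul_vecMul, ih, pow_succ']; rfl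

theorem mulVec_pow {n : Type*} [Fintype n] [DecidableEq n] (A : Matrix n n ℂ) (x : n → ℂ) (k : ℕ) :
    Matrix.mulVec (A ^ k) x = ((Matrix.mulVecLin A : Module.End ℂ (n → ℂ)) ^ k) x := by
  induction k with
  | zero => simp
  | succ k ih => rw [pow_succ', ← Matrix.mulVec_mulVec, ih, pow_succ']; rfl

/-- Functionals with the values of `1`, `M`, `H`, `P`, `K` on ordered monomials, in the numbering of
the basis vectors of the representations by translation. -/
theorem isDualGenerators_of_apply {X : Fin 5 → Dual (QGalilei q)}
    (h : ∀ i α β γ σ, X i (monomial q α β γ σ) =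
      ((if α = 0 ∧ β = 0 ∧ γ = 0 ∧ σ = 0 then Pi.single 0 1 else 0) +
      (if α = 1 ∧ β = 0 ∧ γ = 0 ∧ σ = 0 then Pi.single 1 (-I) else 0) +
      (if α = 0 ∧ β = 1 ∧ γ = 0 ∧ σ = 0 then Pi.single 2 I else 0) +
      (if α = 0 ∧ β = 0 ∧ γ = 0 ∧ σ = 1 then Pi.single 4 (-I) else 0) +
      (if α = 0 ∧ β = 0 ∧ γ = 1 ∧ σ = 0 then Pi.single 3 (-I) else 0) : Fin 5 → ℂ) i) :
    IsDualGenerators q (X 1) (X 2) (X 3) (X 4) := by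
  constructor <;> intro α β γ σ <;> rw [h] <;>
    simp [ite_apply]

namespace RightData
open Matrix (single)
variable {d : RightData}

/-- A matrix of functionals that describes right translations of `H`, `P` and `K`: it is
multiplicative and takes the prescribed values on the generators. -/
structure IsTranslation (d : RightData) (HH HK KH KK PP PH PK : Dual (QGalilei q)) : Prop where
  coproduct_HH : coproduct HH = HH ⊠ HH + HK ⊠ KH
  coproduct_HK : coproduct HK = HH ⊠ HK + HK ⊠ KK
  coproduct_KH : coproduct KH = KH ⊠ HH + KK ⊠ KH
  coproduct_KK : coproduct KK = KH ⊠ HK + KK ⊠ KK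
  coproduct_PP : coproduct PP = PP ⊠ PP
  coproduct_PH : coproduct PH = PH ⊠ HH + PP ⊠ PH + PK ⊠ KH
  coproduct_PK : coproduct PK = PH ⊠ HK + PP ⊠ PK + PK ⊠ KK
  values_HH : HasValues HH 1 d.hH 0 0 0
  values_HK : HasValues HK 0 d.hK 0 0 0
  values_KH : HasValues KH 0 d.kH 0 0 0
  values_KK : HasValues KK 1 d.kK 0 0 0
  values_PP : HasValues PP 1 d.pP 0 0 0
  values_PH : HasValues PH 0 d.pH 0 0 0
  values_PK : HasValues PK 0 d.pK d.s 0 0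

/-- The index pairs at which the representation vanishes. -/
def vanishing (i j : Fin 5) : Bool :=
  (j = 0 && i != 0) || (i = 1 && j != 1) || (j = 1 && i != 1 && i != 0) || (j
    = 3 && i != 3 && i != 0)

/-- The coefficients in the zeroth row of the representation by right translations are the dual
generators, and their coproducts are given by any matrix of functionals that has the properties of
the matrix of translations. -/
theorem exists_functionals (h : q.Holds d.matM d.matτ matV matA) :
    ∃ M H P K : Dual (QGalilei q), IsDualGenerators q M H P K ∧
      coproduct M = 1 ⊠ M + M ⊠ 1 ∧
      ∀ HH HK KH KK PP PH PK : Dual (QGalilei q), d.IsTranslation HH HK KH KK PP PH PK →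
        coproduct H = 1 ⊠ H + H ⊠ HH + P ⊠ PH + K ⊠ KH ∧
        coproduct P = 1 ⊠ P + P ⊠ PP ∧
        coproduct K = 1 ⊠ K + H ⊠ HK + P ⊠ PK + K ⊠ KK := by
  set ρ := lift h with hρ
  have z : ∀ i j, vanishing i j = true → coefficient ρ i j = 0 := fun i j hij => by
    refine coefficient_eq_zero ρ (fun i j => vanishing i j = true) (by decide) (by decide)
      ?_ ?_ ?_ ?_ hij <;> intro i j hij <;> simp only [hρ, lift_m, lift_τ, lift_v, lift_a]
    all_goals
      fin_cases i <;> fin_cases j <;>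
        first
        | exact absurd hij (by decide)
        | simp [matM, matτ, matV, matA]
  have c0 : ∀ i : Fin 5, i = 0 ∨ i = 1 → coefficient ρ i i = 1 := fun i hi => by
    refine (eq_coefficient ρ (ι := Unit) (fun _ => i) (W := fun _ _ => 1) ?_ ?_ ?_ () ()).symm
    · intro _ _
      rw [coproduct_coefficient]
      simp only [Finset.univ_unique, Finset.sum_singleton]
      refine Finset.sum_eq_single i (fun k _ hk => ?_) (by simp)
      have : vanishing i k = true ∨ vanishing k i = true := by
        rcases hi with rfl | rfl <;> revert k <;> decide
      rcases this with h | h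
      · rw [z _ _ h, zero_tens]
      · rw [z _ _ h, tens_zero]
    · simp [coproduct_one]
    · intro _ _
      constructor <;> simp only [coefficient_apply, one_apply_one, one_apply_m, one_apply_τ,
        one_apply_v, one_apply_a, map_one, hρ, lift_m, lift_τ, lift_v, lift_a] <;>
        rcases hi with rfl | rfl <;> simp [matM, matτ, matV, matA]
  have c1 := c0 0 (Or.inl rfl)
  have c2 := c0 1 (Or.inr rfl)
  have hrow : ∀ α β γ σ, Matrix.vecMul (Pi.single 0 1) (ρ (monomial q α β γ σ)) = _ :=
    fun α β γ σ => by
      simp only [monomial, map_mul, map_pow, ← Matrix.vecMul_vecMul, vecMul_pow, hρ, lift_m,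
        lift_τ, lift_v, lift_a]
      refine apply_monomial_right (y₁ := Pi.single 1 (-I)) (y₂ := Pi.single 2 I)
        (y₃ := Pi.single 4 (-I)) (y₄ := Pi.single 3 (-I)) ?_ ?_ ?_ ?_ ?_ ?_ ?_ ?_ ?_ ?_ ?_ ?_ ?_ ?_
          α β γ σ
      all_goals
        ext i
        fin_cases i <;> simp [matM, matτ, matV, matA]
  have hval : ∀ i α β γ σ, coefficient ρ 0 i (monomial q α β γ σ) = _ := fun i α β γ σ =>
    (congrFun (Matrix.single_one_vecMul 0 (ρ (monomial q α β γ σ))).symm i).trans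
      (congrFun (hrow α β γ σ) i)
  refine ⟨coefficient ρ 0 1, coefficient ρ 0 2, coefficient ρ 0 3, coefficient ρ 0 4,
    isDualGenerators_of_apply (X := coefficient ρ 0) hval, ?_, ?_⟩
  · rw [coproduct_coefficient, Fin.sum_univ_five, c1, c2, z 2 1 rfl, z 3 1 rfl, z 4 1 rfl]
    simp only [tens_zero, add_zero]
  intro HH HK KH KK PP PH PK hW
  have key := eq_coefficient ρ (ι := Fin 3) ![2, 3, 4]
    (W := ![![HH, 0, HK], ![PH, PP, PK], ![KH, 0, KK]]) ?_ ?_ ?_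
  · have e1 := key 0 0
    have e2 := key 0 2
    have e3 := key 1 0
    have e4 := key 1 1
    have e5 := key 1 2
    have e6 := key 2 0
    have e7 := key 2 2
    simp only [Matrix.cons_val] at e1 e2 e3 e4 e5 e6 e7
    simp only [coproduct_coefficient, Fin.sum_univ_five, c1, z 1 2 rfl, z 1 3 rfl, z 1 4 rfl,
      z 2 3 rfl, z 4 3 rfl, tens_zero, add_zero, e1, e2, e3, e4, e5, e6, e7, and_true]
  · intro i j
    rw [coproduct_coefficient, Fin.sum_univ_five, Fin.sum_univ_three]
    fin_cases i <;> simp [z 2 0 rfl, z 3 0 rfl, z 4 0 rfl, z 2 1 rfl, z 3 1 rfl, z 4 1 rfl,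
      zero_tens]
  · obtain ⟨h1, h2, h3, h4, h5, h6, h7, -⟩ := hW
    intro i j
    rw [Fin.sum_univ_three]
    fin_cases i <;> fin_cases j <;>
      simp [h1, h2, h3, h4, h5, h6, h7, coproduct_zero, tens_zero, zero_tens]
  · obtain ⟨-, -, -, -, -, -, -, h1, h2, h3, h4, h5, h6, h7⟩ := hW
    have h0 : HasValues (0 : Dual (QGalilei q)) 0 0 0 0 0 := ⟨rfl, rfl, rfl, rfl, rfl⟩
    have hc : ∀ i j, HasValues (coefficient ρ i j) ((1 : Matrix (Fin 5) (Fin 5) ℂ) i j) (d.matM i j)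
        (d.matτ i j) (matV i j) (matA i j) := by
      intro i j
      constructor <;> simp only [coefficient_apply, map_one, hρ, lift_m, lift_τ, lift_v, lift_a]
    intro i j
    fin_cases i <;> fin_cases j
    · exact h1.agree (by simpa [matM, matτ, matV, matA] using hc 2 2)
    · exact h0.agree (by simpa [matM, matτ, matV, matA] using hc 2 3)
    · exact h2.agree (by simpa [matM, matτ, matV, matA] using hc 2 4)
    · exact h6.agree (by simpa [matM, matτ, matV, matA] using hc 3 2)
    · exact h5.agree (by simpa [matM, matτ, matV, matA] using hc 3 3)
    · exact h7.agree (by simpa [matM, matτ, matV, matA] using hc 3 4)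
    · exact h3.agree (by simpa [matM, matτ, matV, matA] using hc 4 2)
    · exact h0.agree (by simpa [matM, matτ, matV, matA] using hc 4 3)
    · exact h4.agree (by simpa [matM, matτ, matV, matA] using hc 4 4)

end RightData
variable {q : Case}

/-! ### Representations by left translation -/

/-- The parameters of the representation of the algebra by left translations on the span of
`1`, `M`, `H`, `P`, `K`. In the translates by `a`, the functionals `M` and `K` have the coefficient
`x` in their own translates, `M` has the coefficients `y` and `z` in the translates of `K` and `H`,
and `H` has the coefficient `w` in the translate of `K`; the coefficient of `M` in the translate of
`K` by `τ` is `t`. -/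
structure LeftData where
  x : ℂ
  y : ℂ
  z : ℂ
  w : ℂ
  t : ℂ

namespace LeftData
open Matrix (single)

/-- The action of `m`; the basis vectors with the numbers `0`, …, `4` are `1`, `M`, `H`, `P`, `K`,
and matrices act on columns. -/
def matM : Matrix (Fin 5) (Fin 5) ℂ := single 1 0 (-I)
/-- The action of `τ`. -/
def matτ (d : LeftData) : Matrix (Fin 5) (Fin 5) ℂ := single 2 0 I + single 4 1 d.t
/-- The action of `v`. -/
def matV : Matrix (Fin 5) (Fin 5) ℂ := single 4 0 (-I)
/-- The action of `a`. -/
def matA (d : LeftData) : Matrix (Fin 5) (Fin 5) ℂ :=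
  single 3 0 (-I) + single 1 1 d.x + single 4 4 d.x + single 4 1 d.y + single 2 1 d.z +
    single 4 2 d.w

variable (d : LeftData)

theorem vm : matV * matM - matM * matV = 0 := by simp [matV, matM]
theorem vτ : matV * d.matτ - d.matτ * matV = 0 := by simp [matV, matτ, mul_add, add_mul]
theorem v_sq : matV ^ 2 = 0 := by simp [matV, pow_two]
theorem v_cube : matV ^ 3 = 0 := by simp [matV, pow_succ]
theorem va : matV * d.matA - d.matA * matV = -d.x • matV := by
  simp [matV, matA, mul_add, add_mul, Matrix.smul_single, mul_comm]
theorem τa : d.matτ * d.matA - d.matA * d.matτ = d.w • matV := by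
  simp [matτ, matV, matA, mul_add, add_mul, Matrix.smul_single, mul_comm, ← Matrix.single_neg]
theorem τm : d.matτ * matM - matM * d.matτ = d.t • matV := by
  simp [matτ, matV, matM, mul_add, add_mul, Matrix.smul_single]
theorem am (h : d.z * d.t = 0) :
    d.matA * matM - matM * d.matA = d.x • matM + d.y • matV - d.z • d.matτ := by
  simp [matτ, matV, matM, matA, mul_add, add_mul, Matrix.smul_single, mul_comm, h,
    ← Matrix.single_neg]
  abel

variable {d}

/-- A matrix of functionals that describes left translations of `M`, `H` and `K`: it is
multiplicative and takes the prescribed values on the generators. -/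
structure IsTranslation (d : LeftData) (E HM KM KH : Dual (QGalilei q)) : Prop where
  coproduct_E : coproduct E = E ⊠ E
  coproduct_HM : coproduct HM = HM ⊠ E + 1 ⊠ HM
  coproduct_KM : coproduct KM = KM ⊠ E + KH ⊠ HM + E ⊠ KM
  coproduct_KH : coproduct KH = KH ⊠ 1 + E ⊠ KH
  values_E : HasValues E 1 0 0 0 d.x
  values_HM : HasValues HM 0 0 0 0 d.z
  values_KM : HasValues KM 0 0 d.t 0 d.y
  values_KH : HasValues KH 0 0 0 0 d.w

/-- The index pairs at which the representation vanishes. -/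
def vanishing (i j : Fin 5) : Bool :=
  (i = 0 && j != 0) || (i = 3 && j != 3 && j != 0) || (j = 3 && i != 3) || (i = 1 && j = 2) ||
    (i = 1 && j = 4) || (i = 2 && j = 4)

/-- The coefficients in the zeroth column of the representation by left translations are the dual
generators, and their coproducts are given by any matrix of functionals that has the properties of
the matrix of translations. -/
theorem exists_functionals (h : q.Holds matM d.matτ matV d.matA) :
    ∃ M H P K : Dual (QGalilei q), IsDualGenerators q M H P K ∧
      coproduct P = 1 ⊠ P + P ⊠ 1 ∧
      ∀ E HM KM KH : Dual (QGalilei q), d.IsTranslation E HM KM KH →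
        coproduct M = E ⊠ M + M ⊠ 1 ∧
        coproduct H = 1 ⊠ H + H ⊠ 1 + HM ⊠ M ∧
        coproduct K = E ⊠ K + K ⊠ 1 + KM ⊠ M + KH ⊠ H := by
  set ρ := lift h with hρ
  have z : ∀ i j, vanishing i j = true → coefficient ρ i j = 0 := fun i j hij => by
    refine coefficient_eq_zero ρ (fun i j => vanishing i j = true) (by decide) (by decide)
      ?_ ?_ ?_ ?_ hij <;> intro i j hij <;> simp only [hρ, lift_m, lift_τ, lift_v, lift_a]
    all_goals
      fin_cases i <;> fin_cases j <;>
        first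
        | exact absurd hij (by decide)
        | simp [matM, matτ, matV, matA]
  have c0 : ∀ i : Fin 5, i = 0 ∨ i = 2 ∨ i = 3 → coefficient ρ i i = 1 := fun i hi => by
    refine (eq_coefficient ρ (ι := Unit) (fun _ => i) (W := fun _ _ => 1) ?_ ?_ ?_ () ()).symm
    · intro _ _
      rw [coproduct_coefficient]
      simp only [Finset.univ_unique, Finset.sum_singleton]
      refine Finset.sum_eq_single i (fun k _ hk => ?_) (by simp)
      have : vanishing i k = true ∨ vanishing k i = true := by
        rcases hi with rfl | rfl | rfl <;> revert k <;> decide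
      rcases this with h | h
      · rw [z _ _ h, zero_tens]
      · rw [z _ _ h, tens_zero]
    · simp [coproduct_one]
    · intro _ _
      constructor <;> simp only [coefficient_apply, one_apply_one, one_apply_m, one_apply_τ,
        one_apply_v, one_apply_a, map_one, hρ, lift_m, lift_τ, lift_v, lift_a] <;>
        rcases hi with rfl | rfl | rfl <;> simp [matM, matτ, matV, matA]
  have c1 := c0 0 (Or.inl rfl)
  have c2 := c0 2 (Or.inr (Or.inl rfl))
  have c3 := c0 3 (Or.inr (Or.inr rfl))
  have hcol : ∀ α β γ σ, Matrix.mulVec (ρ (monomial q α β γ σ)) (Pi.single 0 1) = _ :=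
    fun α β γ σ => by
      simp only [monomial, map_mul, map_pow, ← Matrix.mulVec_mulVec, mulVec_pow, hρ, lift_m,
        lift_τ, lift_v, lift_a]
      refine apply_monomial_left (y₁ := Pi.single 1 (-I)) (y₂ := Pi.single 2 I)
        (y₃ := Pi.single 4 (-I)) (y₄ := Pi.single 3 (-I)) ?_ ?_ ?_ ?_ ?_ ?_ ?_ ?_ ?_ ?_ ?_ ?_ ?_ ?_
          α β γ σ
      all_goals
        ext i
        fin_cases i <;> simp [matM, matτ, matV, matA]
  have hval : ∀ i α β γ σ, coefficient ρ i 0 (monomial q α β γ σ) = _ := fun i α β γ σ =>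
    (congrFun (Matrix.mulVec_single_one (ρ (monomial q α β γ σ)) 0).symm i).trans
      (congrFun (hcol α β γ σ) i)
  refine ⟨coefficient ρ 1 0, coefficient ρ 2 0, coefficient ρ 3 0, coefficient ρ 4 0,
    isDualGenerators_of_apply (X := fun i => coefficient ρ i 0) hval, ?_, ?_⟩
  · rw [coproduct_coefficient, Fin.sum_univ_five, c1, c3, z 3 1 rfl, z 3 2 rfl, z 3 4 rfl]
    simp only [zero_tens, add_zero]
    abel
  intro E HM KM KH hW
  have key := eq_coefficient ρ (ι := Fin 3) ![1, 2, 4]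
    (W := ![![E, 0, 0], ![HM, 1, 0], ![KM, KH, E]]) ?_ ?_ ?_
  · have e1 := key 0 0
    have e2 := key 1 0
    have e3 := key 2 0
    have e4 := key 2 1
    have e5 := key 2 2
    simp only [Matrix.cons_val] at e1 e2 e3 e4 e5
    simp only [coproduct_coefficient, Fin.sum_univ_five, c1, c2, z 1 2 rfl, z 1 3 rfl, z 1 4 rfl,
      z 2 3 rfl, z 2 4 rfl, z 4 3 rfl, zero_tens, add_zero, ← e1, ← e2, ← e3, ← e4, ← e5]
    refine ⟨?_, ?_, ?_⟩ <;> abel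
  · intro i j
    rw [coproduct_coefficient, Fin.sum_univ_five, Fin.sum_univ_three]
    fin_cases j <;> simp [z 0 1 rfl, z 0 2 rfl, z 0 4 rfl, z 3 1 rfl, z 3 2 rfl, z 3 4 rfl,
      tens_zero]
  · obtain ⟨h1, h2, h3, h4, -⟩ := hW
    intro i j
    rw [Fin.sum_univ_three]
    fin_cases i <;> fin_cases j <;>
      simp [h1, h2, h3, h4, coproduct_zero, coproduct_one, tens_zero, zero_tens]
  · obtain ⟨-, -, -, -, h1, h2, h3, h4⟩ := hW
    have h0 : HasValues (0 : Dual (QGalilei q)) 0 0 0 0 0 := ⟨rfl, rfl, rfl, rfl, rfl⟩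
    have hone : HasValues (1 : Dual (QGalilei q)) 1 0 0 0 0 :=
      ⟨one_apply_one, one_apply_m, one_apply_τ, one_apply_v, one_apply_a⟩
    have hc : ∀ i j, HasValues (coefficient ρ i j) ((1 : Matrix (Fin 5) (Fin 5) ℂ) i j) (matM i j)
        (d.matτ i j) (matV i j) (d.matA i j) := by
      intro i j
      constructor <;> simp only [coefficient_apply, map_one, hρ, lift_m, lift_τ, lift_v, lift_a]
    intro i j
    fin_cases i <;> fin_cases j
    · exact h1.agree (by simpa [matM, matτ, matV, matA] using hc 1 1)
    · exact h0.agree (by simpa [matM, matτ, matV, matA] using hc 1 2)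
    · exact h0.agree (by simpa [matM, matτ, matV, matA] using hc 1 4)
    · exact h2.agree (by simpa [matM, matτ, matV, matA] using hc 2 1)
    · exact hone.agree (by simpa [matM, matτ, matV, matA] using hc 2 2)
    · exact h0.agree (by simpa [matM, matτ, matV, matA] using hc 2 4)
    · exact h3.agree (by simpa [matM, matτ, matV, matA] using hc 4 1)
    · exact h4.agree (by simpa [matM, matτ, matV, matA] using hc 4 2)
    · exact h1.agree (by simpa [matM, matτ, matV, matA] using hc 4 4)

end LeftData

end QGalilei

/-! ### Antipodes -/

section Neg
variable {C : Type*} [AddCommGroup C] [Module ℂ C] [Coalgebra ℂ C]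

-- The general lemmas on signs do not unify with the negation of `WithConv` by rewriting.
theorem dual_mul_neg (X Y : Dual C) : X * -Y = -(X * Y) := mul_neg X Y
theorem dual_neg_mul (X Y : Dual C) : -X * Y = -(X * Y) := neg_mul X Y
theorem dual_neg_neg (X : Dual C) : - -X = X := neg_neg X
theorem dual_smul_neg (c : ℂ) (X : Dual C) : c • -X = -(c • X) := smul_neg c X
theorem dual_neg_smul (c : ℂ) (X : Dual C) : -c • X = -(c • X) := neg_smul c X

end Neg

section Antipode
variable {A : Type*} [Ring A] [HopfAlgebra ℂ A]

theorem antipode_add (X Y : Dual A) : antipode (X + Y) = antipode X + antipode Y := rfl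
theorem antipode_sub (X Y : Dual A) : antipode (X - Y) = antipode X - antipode Y := rfl
theorem antipode_smul (c : ℂ) (X : Dual A) : antipode (c • X) = c • antipode X := rfl
theorem antipode_zero : antipode (0 : Dual A) = 0 := rfl

theorem antipode_of_primitive {X : Dual A} (h : coproduct X = 1 ⊠ X + X ⊠ 1) (h1 : X 1 = 0) :
    antipode X = -X := by
  have := mulAntipode_coproduct X
  rw [h, map_add, mulAntipode_tens, mulAntipode_tens, antipode_one, one_mul, mul_one, h1,
    zero_smul] at this
  exact eq_neg_of_add_eq_zero_left this

theorem antipode_of_groupLike {g g' : Dual A} (h : coproduct g = g ⊠ g) (h1 : g 1 = 1)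
    (hg : g' * g = 1) : antipode g = g' := by
  have := mulAntipode_coproduct g
  rw [h, mulAntipode_tens, h1, one_smul] at this
  calc antipode g = g' * g * antipode g := by rw [hg, one_mul]
    _ = g' := by rw [mul_assoc, this, mul_one]

/-- The antipode of the product of a primitive and a group-like functional that commute. -/
theorem antipode_primitive_mul_groupLike {X g g' : Dual A} (hX : coproduct X = 1 ⊠ X + X ⊠ 1)
    (hX1 : X 1 = 0) (h : coproduct g = g ⊠ g) (h1 : g 1 = 1) (hg : g' * g = 1)
    (hXg : Commute X g) : antipode (X * g) = -(X * g') := by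
  have := mulAntipode_coproduct (X * g)
  have h0 : (X * g) 1 = 0 := by
    rw [dual_mul_apply, Bialgebra.comul_one, Algebra.TensorProduct.one_def, tens_tmul, hX1,
      zero_mul]
  have hgX : g' * X * g = X := by rw [mul_assoc, hXg.eq, ← mul_assoc, hg, one_mul]
  have hg2 := mulAntipode_coproduct g
  rw [h, mulAntipode_tens, h1, one_smul, antipode_of_groupLike h h1 hg] at hg2
  have hgX' : g' * X = X * g' := by
    calc g' * X = g' * X * (g * g') := by rw [hg2, mul_one]
      _ = X * g' := by rw [← mul_assoc, hgX]
  rw [coproduct_mul, hX, h, add_mul, tens_mul_tens, tens_mul_tens, one_mul, map_add,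
    mulAntipode_tens, mulAntipode_tens, h0, zero_smul, antipode_of_groupLike h h1 hg, mul_assoc X,
    hg2, mul_one] at this
  calc antipode (X * g) = g' * (g * antipode (X * g)) := by rw [← mul_assoc, hg, one_mul]
    _ = -(X * g') := by rw [eq_neg_of_add_eq_zero_left this, dual_mul_neg, hgX']

theorem antipode_sq_of_primitive {X : Dual A} (h : coproduct X = 1 ⊠ X + X ⊠ 1) (h1 : X 1 = 0) :
    antipode (X ^ 2) = X ^ 2 := by
  have := mulAntipode_coproduct (X ^ 2)
  have h0 : (X ^ 2) 1 = 0 := by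
    rw [pow_two, dual_mul_apply, Bialgebra.comul_one, Algebra.TensorProduct.one_def, tens_tmul, h1,
      zero_mul]
  have h0' : (X * X) 1 = 0 := by rw [← pow_two, h0]
  rw [pow_two, coproduct_mul, h] at this
  simp only [add_mul, mul_add, tens_mul_tens, one_mul, mul_one, map_add, mulAntipode_tens,
    antipode_one, antipode_of_primitive h h1, h0', zero_smul, dual_mul_neg] at this
  rw [pow_two]
  rw [← sub_eq_zero, ← this]
  abel

end Antipode

namespace QGalilei
variable {q : Case} {M H P K : Dual (QGalilei q)}

/-! ### Values on the generators -/

section Values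
variable {X Y : Dual (QGalilei q)} {c₀ cm cτ cv ca d₀ dm dτ dv da : ℂ}

theorem HasValues.of_eq {c₀' cm' cτ' cv' ca' : ℂ} (h : HasValues X c₀ cm cτ cv ca) (h0 : c₀ = c₀')
    (hm : cm = cm') (hτ : cτ = cτ') (hv : cv = cv') (ha : ca = ca') :
    HasValues X c₀' cm' cτ' cv' ca' := by
  subst h0 hm hτ hv ha; exact h

theorem HasValues.add (h : HasValues X c₀ cm cτ cv ca) (h' : HasValues Y d₀ dm dτ dv da) :
    HasValues (X + Y) (c₀ + d₀) (cm + dm) (cτ + dτ) (cv + dv) (ca + da) := by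
  constructor <;> simp [h.1, h.2, h.3, h.4, h.5, h'.1, h'.2, h'.3, h'.4, h'.5]

theorem HasValues.smul (h : HasValues X c₀ cm cτ cv ca) (c : ℂ) :
    HasValues (c • X) (c * c₀) (c * cm) (c * cτ) (c * cv) (c * ca) := by
  constructor <;> simp [h.1, h.2, h.3, h.4, h.5]

theorem HasValues.sub (h : HasValues X c₀ cm cτ cv ca) (h' : HasValues Y d₀ dm dτ dv da) :
    HasValues (X - Y) (c₀ - d₀) (cm - dm) (cτ - dτ) (cv - dv) (ca - da) := by
  constructor <;> simp [h.1, h.2, h.3, h.4, h.5, h'.1, h'.2, h'.3, h'.4, h'.5]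

theorem HasValues.zero : HasValues (0 : Dual (QGalilei q)) 0 0 0 0 0 := ⟨rfl, rfl, rfl, rfl, rfl⟩

theorem HasValues.one : HasValues (1 : Dual (QGalilei q)) 1 0 0 0 0 :=
  ⟨one_apply_one, one_apply_m, one_apply_τ, one_apply_v, one_apply_a⟩

theorem HasValues.commutator (h : HasValues X c₀ cm cτ cv ca) (h' : HasValues Y d₀ dm dτ dv da)
    (hX : X (v q ^ 2) = 0) (hY : Y (v q ^ 2) = 0) :
    HasValues (X * Y - Y * X) 0 (dv * ca - cv * da) 0 0 (cv * dτ - dv * cτ) := by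
  constructor <;> rw [dual_sub_apply]
  · rw [mul_apply_one, mul_apply_one, mul_comm, sub_self]
  · rw [mul_apply_m, mul_apply_m, h.1, h'.1, h.2, h'.2, h.4, h'.4, h.5, h'.5, hX, hY]; ring
  · rw [mul_apply_τ, mul_apply_τ, h.1, h'.1, h.3, h'.3]; ring
  · rw [mul_apply_v, mul_apply_v, h.1, h'.1, h.4, h'.4]; ring
  · rw [mul_apply_a, mul_apply_a, h.1, h'.1, h.3, h'.3, h.4, h'.4, h.5, h'.5]; ring

theorem monomial_zero : monomial q 0 0 0 0 = 1 := by simp [monomial]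
theorem monomial_m : monomial q 1 0 0 0 = m q := by simp [monomial]
theorem monomial_τ : monomial q 0 1 0 0 = τ q := by simp [monomial]
theorem monomial_v : monomial q 0 0 0 1 = v q := by simp [monomial]
theorem monomial_a : monomial q 0 0 1 0 = a q := by simp [monomial]
theorem monomial_v_sq : monomial q 0 0 0 2 = v q ^ 2 := by simp [monomial]

namespace IsDualGenerators
variable (h : IsDualGenerators q M H P K)
include h

theorem values_M : HasValues M 0 (-I) 0 0 0 := by
  constructor <;> simp [← monomial_zero, ← monomial_m, ← monomial_τ, ← monomial_v, ← monomial_a,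
    h.M_apply]
theorem values_H : HasValues H 0 0 I 0 0 := by
  constructor <;> simp [← monomial_zero, ← monomial_m, ← monomial_τ, ← monomial_v, ← monomial_a,
    h.H_apply]
theorem values_P : HasValues P 0 0 0 0 (-I) := by
  constructor <;> simp [← monomial_zero, ← monomial_m, ← monomial_τ, ← monomial_v, ← monomial_a,
    h.P_apply]
theorem values_K : HasValues K 0 0 0 (-I) 0 := by
  constructor <;> simp [← monomial_zero, ← monomial_m, ← monomial_τ, ← monomial_v, ← monomial_a,
    h.K_apply]
theorem M_apply_v_sq : M (v q ^ 2) = 0 := by simp [← monomial_v_sq, h.M_apply]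
theorem H_apply_v_sq : H (v q ^ 2) = 0 := by simp [← monomial_v_sq, h.H_apply]
theorem P_apply_v_sq : P (v q ^ 2) = 0 := by simp [← monomial_v_sq, h.P_apply]
theorem K_apply_v_sq : K (v q ^ 2) = 0 := by simp [← monomial_v_sq, h.K_apply]

theorem values_KP : HasValues (K * P - P * K) 0 1 0 0 0 :=
  (h.values_K.commutator h.values_P h.K_apply_v_sq h.P_apply_v_sq).of_eq rfl (by simp) rfl rfl
    (by simp)
theorem values_HP : HasValues (H * P - P * H) 0 0 0 0 0 :=
  (h.values_H.commutator h.values_P h.H_apply_v_sq h.P_apply_v_sq).of_eq rfl (by simp) rfl rfl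
    (by simp)
theorem values_KH : HasValues (K * H - H * K) 0 0 0 0 1 :=
  (h.values_K.commutator h.values_H h.K_apply_v_sq h.H_apply_v_sq).of_eq rfl (by simp) rfl rfl
    (by simp)

end IsDualGenerators

end Values

/-! ### Duals with primitive central charge -/

/-- A central functional with values `c₀` at `1` and `cm` at `m`, which vanishes at the other
generators and at `v ^ 2`. Power series in a primitive `M` are of this kind. -/
structure CentralValues (X : Dual (QGalilei q)) (c₀ cm : ℂ) : Prop where
  central : ∀ Y, Commute Y X
  values : HasValues X c₀ cm 0 0 0
  apply_v_sq : X (v q ^ 2) = 0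

namespace CentralValues
variable {X Y : Dual (QGalilei q)} {c₀ cm d₀ dm : ℂ}

theorem hasValues (h : CentralValues X c₀ cm) (h0 : c₀ = d₀) (hm : cm = dm) :
    HasValues X d₀ dm 0 0 0 := by
  subst h0 hm; exact h.values

theorem one : CentralValues (1 : Dual (QGalilei q)) 1 0 :=
  ⟨Commute.one_right, .one, one_apply_v_sq⟩

theorem add (h : CentralValues X c₀ cm) (h' : CentralValues Y d₀ dm) :
    CentralValues (X + Y) (c₀ + d₀) (cm + dm) :=
  ⟨fun Z => (h.central Z).add_right (h'.central Z),
    (h.values.add h'.values).of_eq rfl rfl (add_zero _) (add_zero _) (add_zero _),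
    by rw [dual_add_apply, h.apply_v_sq, h'.apply_v_sq, add_zero]⟩

theorem smul (h : CentralValues X c₀ cm) (c : ℂ) : CentralValues (c • X) (c * c₀) (c * cm) :=
  ⟨fun Z => (h.central Z).smul_right c,
    (h.values.smul c).of_eq rfl rfl (mul_zero _) (mul_zero _) (mul_zero _),
    by rw [dual_smul_apply, h.apply_v_sq, mul_zero]⟩

theorem sub (h : CentralValues X c₀ cm) (h' : CentralValues Y d₀ dm) :
    CentralValues (X - Y) (c₀ - d₀) (cm - dm) := by
  have := h.add (h'.smul (-1))
  simpa [sub_eq_add_neg] using this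

theorem mul (h : CentralValues X c₀ cm) (h' : CentralValues Y d₀ dm) :
    CentralValues (X * Y) (c₀ * d₀) (cm * d₀ + c₀ * dm) := by
  refine ⟨fun Z => (h.central Z).mul_right (h'.central Z), ⟨?_, ?_, ?_, ?_, ?_⟩, ?_⟩
  · rw [mul_apply_one, h.values.1, h'.values.1]
  · rw [mul_apply_m, h.values.1, h'.values.1, h.values.2, h'.values.2, h.values.4,
      h.apply_v_sq]; ring
  · rw [mul_apply_τ, h.values.3, h'.values.3]; ring
  · rw [mul_apply_v, h.values.4, h'.values.4]; ring
  · rw [mul_apply_a, h.values.5, h'.values.5, h.values.4]; ring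
  · rw [mul_apply_v_sq, h.values.4, h.apply_v_sq, h'.apply_v_sq]; ring

theorem sq (h : CentralValues X c₀ cm) : CentralValues (X ^ 2) (c₀ * c₀) (cm * c₀ + c₀ * cm) := by
  rw [pow_two]; exact h.mul h

theorem exp (h : CentralValues X 0 cm) : CentralValues (exp X) 1 cm := by
  have hv : VanishesOnV X := ⟨h.values.1, h.values.4, h.apply_v_sq⟩
  exact ⟨fun Z => (filtration q).commute_exp h.values.1 (h.central Z),
    ⟨(filtration q).exp_apply_one h.values.1, hv.exp_apply_m.trans h.values.2,
      hv.exp_apply_τ.trans h.values.3, hv.exp_apply_v, hv.exp_apply_a.trans h.values.5⟩,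
    hv.exp_apply_v_sq⟩

theorem exp_smul (h : CentralValues X 0 cm) (c : ℂ) :
    CentralValues (QuantumGalilei.exp (c • X)) 1 (c * cm) := by
  have := h.smul c
  rw [mul_zero] at this
  exact this.exp

end CentralValues

theorem IsDualGenerators.centralValues (h : IsDualGenerators q M H P K)
    (hM : coproduct M = 1 ⊠ M + M ⊠ 1) : CentralValues M 0 (-I) :=
  ⟨central_of_primitive hM h.values_M.4 h.M_apply_v_sq h.values_M.3 h.values_M.5, h.values_M,
    h.M_apply_v_sq⟩

section Primitive
variable {X : Dual (QGalilei q)} (hX : coproduct X = 1 ⊠ X + X ⊠ 1) (h1 : X 1 = 0) (c : ℂ)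
include hX

theorem coproduct_smul_of_primitive : coproduct (c • X) = 1 ⊠ (c • X) + (c • X) ⊠ 1 := by
  rw [coproduct_smul, hX, smul_add, tens_smul, smul_tens]

include h1

theorem coproduct_exp_smul : coproduct (exp (c • X)) = exp (c • X) ⊠ exp (c • X) :=
  coproduct_exp_of_primitive (filtration q) (by rw [dual_smul_apply, h1, mul_zero])
    (coproduct_smul_of_primitive hX c)

theorem antipode_exp_smul : antipode (exp (c • X)) = exp (-c • X) := by
  have h0 : (c • X) 1 = 0 := by rw [dual_smul_apply, h1, mul_zero]
  refine antipode_of_groupLike (coproduct_exp_smul hX h1 c) ((filtration q).exp_apply_one h0) ?_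
  rw [neg_smul, (filtration q).exp_neg_mul_exp h0]

theorem antipode_mul_exp_smul {Y : Dual (QGalilei q)} (hY : coproduct Y = 1 ⊠ Y + Y ⊠ 1)
    (hY1 : Y 1 = 0) (h : Commute Y X) :
    antipode (Y * exp (c • X)) = -(Y * exp (-c • X)) := by
  have h0 : (c • X) 1 = 0 := by rw [dual_smul_apply, h1, mul_zero]
  refine antipode_primitive_mul_groupLike hY hY1 (coproduct_exp_smul hX h1 c)
    ((filtration q).exp_apply_one h0) ?_ ((filtration q).commute_exp h0 (h.smul_right c))
  rw [neg_smul, (filtration q).exp_neg_mul_exp h0]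

end Primitive

/-- The commutators of `K` with `P`, of `H` with `P` and of `K` with `H` satisfy a linear system of
coproduct equations, in which the second exterior power of the translation matrix appears. They
are therefore equal to any solution of this system that has the right values on the generators. -/
theorem commutators_eq (h : IsDualGenerators q M H P K)
    {HH HK KH KK PP PH PK KP' HP' KH' : Dual (QGalilei q)}
    (hH : coproduct H = 1 ⊠ H + H ⊠ HH + P ⊠ PH + K ⊠ KH) (hP : coproduct P = 1 ⊠ P + P ⊠ PP)
    (hK : coproduct K = 1 ⊠ K + H ⊠ HK + P ⊠ PK + K ⊠ KK)
    (cHH : ∀ Y, Commute Y HH) (cHK : ∀ Y, Commute Y HK) (cKH : ∀ Y, Commute Y KH)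
    (cKK : ∀ Y, Commute Y KK) (cPP : ∀ Y, Commute Y PP) (cPH : ∀ Y, Commute Y PH)
    (cPK : Commute P PK) (cPK' : Commute H PK)
    (hKP' : coproduct KP' = 1 ⊠ KP' + HP' ⊠ (HK * PP) + KP' ⊠ (KK * PP))
    (hHP' : coproduct HP' = 1 ⊠ HP' + HP' ⊠ (HH * PP) + KP' ⊠ (KH * PP))
    (hKH' : coproduct KH' = 1 ⊠ KH' + KH' ⊠ (KK * HH - HK * KH) + KP' ⊠ (KK * PH - PK * KH)
      + HP' ⊠ (HK * PH - PK * HH))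
    (vKP : HasValues KP' 0 1 0 0 0) (vHP : HasValues HP' 0 0 0 0 0)
    (vKH : HasValues KH' 0 0 0 0 1) :
    K * P - P * K = KP' ∧ H * P - P * H = HP' ∧ K * H - H * K = KH' := by
  have key := eq_of_coproduct_family (ι := Fin 3)
    (X := ![K * P - P * K, H * P - P * H, K * H - H * K]) (Y := ![KP', HP', KH'])
    (L := ![![1, 0, 0], ![0, 1, 0], ![0, 0, 1]])
    (R := ![![KK * PP, HK * PP, 0], ![KH * PP, HH * PP, 0],
      ![KK * PH - PK * KH, HK * PH - PK * HH, KK * HH - HK * KH]]) (T := fun _ => 0) ?_ ?_ ?_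
  · exact ⟨congrFun key 0, congrFun key 1, congrFun key 2⟩
  · have e1 := (cPP K).eq
    have e3 := (cPP H).eq
    have e4 := (cPP PK).eq
    have e5 := (cPP HK).eq
    have e6 := (cPP KK).eq
    have e7 := (cPP HH).eq
    have e8 := (cPP KH).eq
    have e9 := (cPP PH).eq
    have f1 := (cHH K).eq
    have f2 := (cHH P).eq
    have f4 := (cHH PK).eq
    have f5 := (cHH HK).eq
    have f6 := (cHH KK).eq
    have g1 := (cPH K).eq
    have g2 := (cPH P).eq
    have g4 := (cPH PK).eq
    have g5 := (cPH HK).eq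
    have g6 := (cPH KK).eq
    have k1 := (cKH K).eq
    have k2 := (cKH P).eq
    have k4 := (cKH PK).eq
    have k5 := (cKH HK).eq
    have k6 := (cKH KK).eq
    have l1 := (cHK H).eq
    have l2 := (cHK P).eq
    have m1 := (cKK H).eq
    have m2 := (cKK P).eq
    have n1 := cPK.eq
    have n2 := cPK'.eq
    intro i
    fin_cases i <;>
      simp only [Fin.zero_eta, Fin.mk_one, Fin.reduceFinMk, Matrix.cons_val, Fin.sum_univ_three,
        coproduct_sub, coproduct_mul, hH, hP,
        hK, mul_add, add_mul, tens_mul_tens, one_mul, mul_one, zero_tens, tens_zero, sub_tens,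
        tens_sub, e1, e3, e4, e5, e6, e7, e8, e9, f1, f2, f4, f5, f6, g1, g2, g4, g5, g6,
        k1, k2, k4, k5, k6, l1, l2, m1, m2, n1, n2] <;>
      abel
  · intro i
    fin_cases i <;>
      simp only [Fin.zero_eta, Fin.mk_one, Fin.reduceFinMk, Matrix.cons_val, Fin.sum_univ_three,
        hKP', hHP', hKH', zero_tens, tens_zero] <;> abel
  · intro i
    fin_cases i
    · exact h.values_KP.agree vKP
    · exact h.values_HP.agree vHP
    · exact h.values_KH.agree vKH

/-- The relations and the Hopf algebra structure that are described by the formulas hold. -/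
structure Satisfies (F : Formulas (Dual (QGalilei q)) (Dual (QGalilei q ⊗[ℂ] QGalilei q)))
    (M H P K : Dual (QGalilei q)) : Prop where
  KM : K * M - M * K = F.KM
  KP : K * P - P * K = F.KP
  KH : K * H - H * K = F.KH
  HP : H * P - P * H = F.HP
  MP : M * P - P * M = F.MP
  MH : M * H - H * M = F.MH
  ΔM : coproduct M = F.ΔM
  ΔH : coproduct H = F.ΔH
  ΔP : coproduct P = F.ΔP
  ΔK : coproduct K = F.ΔK
  SM : antipode M = F.SM
  SH : antipode H = F.SH
  SP : antipode P = F.SP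
  SK : antipode K = F.SK

/-- The commutators with a primitive `M` and the antipodes are determined by the translation
matrix. -/
theorem Satisfies.of_right {F : Formulas (Dual (QGalilei q)) (Dual (QGalilei q ⊗[ℂ] QGalilei q))}
    (h : IsDualGenerators q M H P K) (hM : coproduct M = 1 ⊠ M + M ⊠ 1)
    {HH HK KH KK PP PH PK : Dual (QGalilei q)}
    (hH : coproduct H = 1 ⊠ H + H ⊠ HH + P ⊠ PH + K ⊠ KH) (hP : coproduct P = 1 ⊠ P + P ⊠ PP)
    (hK : coproduct K = 1 ⊠ K + H ⊠ HK + P ⊠ PK + K ⊠ KK)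
    (com : K * P - P * K = F.KP ∧ H * P - P * H = F.HP ∧ K * H - H * K = F.KH)
    (KM : F.KM = 0) (MP : F.MP = 0) (MH : F.MH = 0)
    (ΔM : F.ΔM = 1 ⊠ M + M ⊠ 1)
    (ΔH : F.ΔH = 1 ⊠ H + H ⊠ HH + P ⊠ PH + K ⊠ KH) (ΔP : F.ΔP = 1 ⊠ P + P ⊠ PP)
    (ΔK : F.ΔK = 1 ⊠ K + H ⊠ HK + P ⊠ PK + K ⊠ KK) (SM : F.SM = -M)
    (SH : F.SH = -(H * antipode HH + P * antipode PH + K * antipode KH))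
    (SP : F.SP = -(P * antipode PP))
    (SK : F.SK = -(H * antipode HK + P * antipode PK + K * antipode KK)) :
    Satisfies F M H P K := by
  have c := (h.centralValues hM).central
  obtain ⟨c1, c2, c3⟩ := com
  constructor
  · rw [KM, (c K).eq, sub_self]
  · exact c1
  · exact c3
  · exact c2
  · rw [MP, (c P).eq, sub_self]
  · rw [MH, (c H).eq, sub_self]
  · rw [ΔM, hM]
  · rw [ΔH, hH]
  · rw [ΔP, hP]
  · rw [ΔK, hK]
  · rw [SM, antipode_of_primitive hM h.values_M.1]
  · have := mulAntipode_coproduct H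
    rw [hH, h.values_H.1, zero_smul] at this
    simp only [map_add, mulAntipode_tens, one_mul] at this
    rw [SH, ← sub_eq_zero, ← this]
    abel
  · have := mulAntipode_coproduct P
    rw [hP, h.values_P.1, zero_smul] at this
    simp only [map_add, mulAntipode_tens, one_mul] at this
    rw [SP, ← sub_eq_zero, ← this]
    abel
  · have := mulAntipode_coproduct K
    rw [hK, h.values_K.1, zero_smul] at this
    simp only [map_add, mulAntipode_tens, one_mul] at this
    rw [SK, ← sub_eq_zero, ← this]
    abel

/-! ### Cases with a central translation matrix -/

/-- The assertion of the theorem on the functionals `M`, `H`, `P`, `K` in the given case. -/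
def HasDual (q : Case) : Prop :=
  ∃ M H P K : Dual (QGalilei q), IsDualGenerators q M H P K ∧ Satisfies (q.formulas M H P K) M H P K

/-- If strictly upper triangular matrices of size two satisfy the commutation relations, then their
upper right entries are the values on the generators of a primitive functional, which is a
coefficient of the resulting representation. -/
theorem exists_primitive {q : Case} {xm xτ xv xa : ℂ}
    (h : q.Holds (Matrix.single 0 1 xm : Matrix (Fin 2) (Fin 2) ℂ) (Matrix.single 0 1 xτ)
      (Matrix.single 0 1 xv) (Matrix.single 0 1 xa)) :
    ∃ X : Dual (QGalilei q), coproduct X = 1 ⊠ X + X ⊠ 1 ∧ HasValues X 0 xm xτ xv xa := by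
  have z : coefficient (lift h) 1 0 = 0 := by
    refine coefficient_eq_zero _ (fun i j => i = 1 ∧ j = 0) (by decide) (by decide)
      ?_ ?_ ?_ ?_ ⟨rfl, rfl⟩ <;> rintro _ _ ⟨rfl, rfl⟩ <;> simp
  have c : ∀ i, coefficient (lift h) i i = 1 := fun i => by
    refine (eq_coefficient _ (ι := Unit) (fun _ => i) (W := fun _ _ => 1) ?_ ?_ ?_ () ()).symm
    · intro _ _
      rw [coproduct_coefficient]
      simp only [Finset.univ_unique, Finset.sum_singleton, Fin.sum_univ_two]
      fin_cases i <;> simp [z, tens_zero, zero_tens]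
    · simp [coproduct_one]
    · intro _ _
      constructor <;> simp only [coefficient_apply, one_apply_one, one_apply_m, one_apply_τ,
        one_apply_v, one_apply_a, map_one, lift_m, lift_τ, lift_v, lift_a] <;>
        fin_cases i <;> simp
  refine ⟨coefficient (lift h) 0 1, ?_, ?_⟩
  · rw [coproduct_coefficient, Fin.sum_univ_two, c, c]
  · constructor <;> simp [coefficient_apply]

theorem hasDual_case2 (c : ℂ) (hc : c ≠ 0) : HasDual (.case2 c) := by
  let d : RightData := ⟨0, 0, 0, I * c, I * c, 0, 0, 0⟩
  have hd : d.Compatible := by constructor <;> simp [d]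
  obtain ⟨M, H, P, K, hD, hM, hW⟩ := d.exists_functionals (q := .case2 c) (by
    constructor <;>
      simp only [Case.brackets, RightData.va, RightData.vτ, d.vm hd, d.τm hd, d.am hd, d.τa, d] <;>
      module)
  have h1 := hD.values_M.1
  have cM := hD.centralValues hM
  have cg := cM.exp_smul (-c)
  have hg := coproduct_exp_smul hM h1 (-c)
  have hg2 := coproduct_exp_smul hM h1 (-(2 * c))
  have hgg : exp (-c • M) * exp (-c • M) = exp (-(2 * c) • M) := by
    rw [(filtration _).exp_smul_mul_exp_smul h1]; congr 2; ring
  obtain ⟨hH, hP, hK⟩ := hW 1 0 0 (exp (-c • M)) (exp (-c • M)) 0 0 (by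
    refine ⟨?_, ?_, ?_, ?_, ?_, ?_, ?_, .one, .zero, .zero, cg.hasValues rfl (by simp [d]; ring),
      cg.hasValues rfl (by simp [d]; ring), .zero, .zero⟩ <;>
      simp only [coproduct_one, coproduct_zero, tens_zero, zero_tens, hg] <;>
      module)
  refine ⟨M, H, P, K, hD, .of_right hD hM hH hP hK ?_ rfl rfl rfl rfl ?_ ?_ ?_ rfl ?_ ?_ ?_⟩
  · refine commutators_eq hD hH hP hK Commute.one_right Commute.zero_right Commute.zero_right
      cg.central cg.central Commute.zero_right (Commute.zero_right _) (Commute.zero_right _) ?_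
      ?_ ?_ ?_ ?_ ?_
    · simp only [Case.formulas, classical, coproduct_smul, coproduct_sub, coproduct_one, tens_smul,
        smul_tens, tens_sub, sub_tens, zero_tens, hg2, hgg]
      module
    · simp only [Case.formulas, classical, coproduct_zero, tens_zero, zero_tens, add_zero, zero_mul]
    · simp only [Case.formulas, classical, coproduct_smul, hP, tens_smul, smul_tens, tens_zero,
        mul_one, mul_zero, sub_zero]
      module
    · exact ((CentralValues.one.sub (cM.exp_smul _)).smul _).hasValues (by simp)
        (by field_simp; linear_combination (-2 * c) * Complex.I_sq)
    · exact .zero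
    · have hv := hD.values_P.smul I
      exact hv.of_eq (by simp) (by simp) (by simp) (by simp) (by simp)
  · simp only [Case.formulas, classical, tens_zero]
    module
  · simp only [Case.formulas, classical]
  · simp only [Case.formulas, classical, tens_zero]
    module
  · simp only [Case.formulas, classical, antipode_one, antipode_zero, mul_one, mul_zero]
    module
  · simp only [Case.formulas, classical, neg_neg, antipode_exp_smul hM h1]
  · simp only [Case.formulas, classical, antipode_zero, neg_neg, mul_zero, antipode_exp_smul hM h1]
    module

theorem hasDual_case3 (c : ℂ) : HasDual (.case3 c) := by
  let d : RightData := ⟨0, -(I * c), 0, 0, 0, 0, 0, 0⟩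
  have hd : d.Compatible := by constructor <;> simp [d]
  obtain ⟨M, H, P, K, hD, hM, hW⟩ := d.exists_functionals (q := .case3 c) (by
    constructor <;>
      simp only [Case.brackets, RightData.va, RightData.vτ, d.vm hd, d.τm hd, d.am hd, d.τa,
        RightData.v_sq, d] <;>
      module)
  have h1 := hD.values_M.1
  have cM := hD.centralValues hM
  obtain ⟨hH, hP, hK⟩ := hW 1 (c • M) 0 1 1 0 0 (by
    refine ⟨?_, ?_, ?_, ?_, ?_, ?_, ?_, .one, (cM.smul c).hasValues (by simp) (by simp [d]; ring),
      .zero, .one, .one, .zero, .zero⟩ <;>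
      simp only [coproduct_smul, coproduct_one, coproduct_zero, hM, tens_smul, smul_tens,
        tens_zero, zero_tens] <;>
      module)
  refine ⟨M, H, P, K, hD, .of_right hD hM hH hP hK ?_ rfl rfl rfl rfl ?_ ?_ ?_ rfl ?_ ?_ ?_⟩
  · refine commutators_eq hD hH hP hK Commute.one_right (cM.smul c).central
      Commute.zero_right Commute.one_right Commute.one_right Commute.zero_right
      (Commute.zero_right _) (Commute.zero_right _) ?_ ?_ ?_ ?_ ?_ ?_
    · simp only [Case.formulas, classical, coproduct_smul, tens_smul, smul_tens, zero_tens,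
        mul_one, hM]
      module
    · simp only [Case.formulas, classical, coproduct_zero, tens_zero, zero_tens, add_zero, zero_mul]
    · simp only [Case.formulas, classical, coproduct_smul, hP, tens_smul, smul_tens, tens_zero,
        mul_one, mul_zero, sub_zero]
      module
    · exact (cM.smul I).hasValues (by simp) (by simp)
    · exact .zero
    · have hv := hD.values_P.smul I
      exact hv.of_eq (by simp) (by simp) (by simp) (by simp) (by simp)
  · simp only [Case.formulas, classical, tens_zero]
    module
  · simp only [Case.formulas, classical]
  · simp only [Case.formulas, classical, tens_smul, tens_zero]
    module
  · simp only [Case.formulas, classical, antipode_one, antipode_zero, mul_one, mul_zero]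
    module
  · simp only [Case.formulas, classical, antipode_one, mul_one]
  · simp only [Case.formulas, classical, antipode_one, antipode_zero, antipode_smul,
      antipode_of_primitive hM h1, mul_one, mul_zero, mul_smul_comm, dual_mul_neg]
    module

theorem hasDual_case4 (c : ℂ) : HasDual (.case4 c) := by
  let d : RightData := ⟨0, 0, 0, 0, 0, I * c, 0, 0⟩
  have hd : d.Compatible := by constructor <;> simp [d]
  obtain ⟨M, H, P, K, hD, hM, hW⟩ := d.exists_functionals (q := .case4 c) (by
    constructor <;>
      simp only [Case.brackets, RightData.va, RightData.vτ, d.vm hd, d.τm hd, d.am hd, d.τa, d] <;>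
      module)
  have h1 := hD.values_M.1
  have cM := hD.centralValues hM
  obtain ⟨hH, hP, hK⟩ := hW 1 0 0 1 1 (-c • M) 0 (by
    refine ⟨?_, ?_, ?_, ?_, ?_, ?_, ?_, .one, .zero, .zero, .one, .one,
      (cM.smul (-c)).hasValues (by simp) (by simp [d]; ring), .zero⟩ <;>
      simp only [coproduct_smul, coproduct_one, coproduct_zero, hM, tens_smul, smul_tens,
        tens_zero, zero_tens] <;>
      module)
  refine ⟨M, H, P, K, hD, .of_right hD hM hH hP hK ?_ rfl rfl rfl rfl ?_ ?_ ?_ rfl ?_ ?_ ?_⟩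
  · refine commutators_eq hD hH hP hK Commute.one_right Commute.zero_right
      Commute.zero_right Commute.one_right Commute.one_right (cM.smul (-c)).central
      (Commute.zero_right _) (Commute.zero_right _) ?_ ?_ ?_ ?_ ?_ ?_
    · simp only [Case.formulas, classical, coproduct_smul, tens_smul, smul_tens, zero_tens,
        mul_one, hM]
      module
    · simp only [Case.formulas, classical, coproduct_zero, tens_zero, zero_tens, add_zero, zero_mul]
    · simp only [Case.formulas, classical, pow_two, coproduct_smul, coproduct_sub, coproduct_mul,
        hM, hP, tens_smul, smul_tens, tens_sub, sub_tens, tens_zero, one_mul, mul_one, mul_zero,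
        zero_mul, sub_zero, add_mul, mul_add, tens_mul_tens]
      module
    · exact (cM.smul I).hasValues (by simp) (by simp)
    · exact .zero
    · have hv := ((hD.values_P.smul I).sub (cM.sq.smul (I * c / 2)).values)
      exact hv.of_eq (by simp) (by simp) (by simp) (by simp) (by simp)
  · simp only [Case.formulas, classical, tens_smul, tens_zero]
    module
  · simp only [Case.formulas, classical]
  · simp only [Case.formulas, classical, tens_zero]
    module
  · simp only [Case.formulas, classical, antipode_one, antipode_zero, antipode_smul,
      antipode_of_primitive hM h1, mul_one, mul_zero, mul_smul_comm, dual_mul_neg]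
    module
  · simp only [Case.formulas, classical, antipode_one, mul_one]
  · simp only [Case.formulas, classical, antipode_one, antipode_zero, mul_one, mul_zero]
    module

theorem hasDual_case5 (c : ℂ) : HasDual (.case5 c) := by
  let d : RightData := ⟨0, 0, 0, 0, 0, 0, I * c, 0⟩
  have hd : d.Compatible := by constructor <;> simp [d]
  obtain ⟨M, H, P, K, hD, hM, hW⟩ := d.exists_functionals (q := .case5 c) (by
    constructor <;>
      simp only [Case.brackets, RightData.va, RightData.vτ, d.vm hd, d.τm hd, d.am hd, d.τa, d] <;>
      module)
  have h1 := hD.values_M.1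
  have cM := hD.centralValues hM
  obtain ⟨hH, hP, hK⟩ := hW 1 0 0 1 1 0 (-c • M) (by
    refine ⟨?_, ?_, ?_, ?_, ?_, ?_, ?_, .one, .zero, .zero, .one, .one, .zero,
      (cM.smul (-c)).hasValues (by simp) (by simp [d]; ring)⟩ <;>
      simp only [coproduct_smul, coproduct_one, coproduct_zero, hM, tens_smul, smul_tens,
        tens_zero, zero_tens] <;>
      module)
  refine ⟨M, H, P, K, hD, .of_right hD hM hH hP hK ?_ rfl rfl rfl rfl ?_ ?_ ?_ rfl ?_ ?_ ?_⟩
  · refine commutators_eq hD hH hP hK Commute.one_right Commute.zero_right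
      Commute.zero_right Commute.one_right Commute.one_right Commute.zero_right ((cM.smul
      (-c)).central _) ((cM.smul (-c)).central _) ?_ ?_ ?_ ?_ ?_ ?_
    · simp only [Case.formulas, classical, coproduct_smul, tens_smul, smul_tens, zero_tens,
        mul_one, hM]
      module
    · simp only [Case.formulas, classical, coproduct_zero, tens_zero, zero_tens, add_zero, zero_mul]
    · simp only [Case.formulas, classical, coproduct_smul, hP, tens_smul, smul_tens, zero_tens,
        tens_zero, mul_one, mul_zero, sub_zero, zero_sub]
      module
    · exact (cM.smul I).hasValues (by simp) (by simp)
    · exact .zero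
    · have hv := hD.values_P.smul I
      exact hv.of_eq (by simp) (by simp) (by simp) (by simp) (by simp)
  · simp only [Case.formulas, classical, tens_zero]
    module
  · simp only [Case.formulas, classical]
  · simp only [Case.formulas, classical, tens_smul, tens_zero]
    module
  · simp only [Case.formulas, classical, antipode_one, antipode_zero, mul_one, mul_zero]
    module
  · simp only [Case.formulas, classical, antipode_one, mul_one]
  · simp only [Case.formulas, classical, antipode_one, antipode_zero, antipode_smul,
      antipode_of_primitive hM h1, mul_one, mul_zero, mul_smul_comm, dual_mul_neg]
    module

theorem hasDual_case6 (c₁ c₂ : ℂ) (hc : c₁ ≠ 0) : HasDual (.case6 c₁ c₂) := by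
  let d : RightData := ⟨0, 0, 0, I * c₁, I * c₁, 0, I * c₂, 0⟩
  have hd : d.Compatible := by constructor <;> simp [d]
  obtain ⟨M, H, P, K, hD, hM, hW⟩ := d.exists_functionals (q := .case6 c₁ c₂) (by
    constructor <;>
      simp only [Case.brackets, RightData.va, RightData.vτ, d.vm hd, d.τm hd, d.am hd, d.τa, d] <;>
      module)
  have h1 := hD.values_M.1
  have cM := hD.centralValues hM
  have cg := cM.exp_smul (-c₁)
  have hg := coproduct_exp_smul hM h1 (-c₁)
  have hg2 := coproduct_exp_smul hM h1 (-(2 * c₁))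
  have hgg : exp (-c₁ • M) * exp (-c₁ • M) = exp (-(2 * c₁) • M) := by
    rw [(filtration _).exp_smul_mul_exp_smul h1]; congr 2; ring
  have cPK := (cM.mul cg).smul (-c₂)
  obtain ⟨hH, hP, hK⟩ := hW 1 0 0 (exp (-c₁ • M)) (exp (-c₁ • M)) 0 (-c₂ • (M * exp (-c₁ • M))) (by
    refine ⟨?_, ?_, ?_, ?_, ?_, ?_, ?_, .one, .zero, .zero, cg.hasValues rfl (by simp [d]; ring),
      cg.hasValues rfl (by simp [d]; ring), .zero, cPK.hasValues (by simp) (by simp [d]; ring)⟩ <;>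
      simp only [coproduct_smul, coproduct_mul, coproduct_one, coproduct_zero, hM, add_mul,
        tens_mul_tens, one_mul, tens_smul, smul_tens, tens_zero, zero_tens, hg] <;>
      module)
  refine ⟨M, H, P, K, hD, .of_right hD hM hH hP hK ?_ rfl rfl rfl rfl ?_ ?_ ?_ rfl ?_ ?_ ?_⟩
  · refine commutators_eq hD hH hP hK Commute.one_right Commute.zero_right Commute.zero_right
      cg.central cg.central Commute.zero_right (cPK.central _) (cPK.central _) ?_ ?_ ?_ ?_ ?_ ?_
    · simp only [Case.formulas, classical, coproduct_smul, coproduct_sub, coproduct_one, tens_smul,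
        smul_tens, tens_sub, sub_tens, zero_tens, hg2, hgg]
      module
    · simp only [Case.formulas, classical, coproduct_zero, tens_zero, zero_tens, add_zero, zero_mul]
    · simp only [Case.formulas, classical, coproduct_smul, hP, tens_smul, smul_tens, zero_tens,
        tens_zero, mul_one, mul_zero, sub_zero, zero_sub]
      module
    · exact ((CentralValues.one.sub (cM.exp_smul _)).smul _).hasValues (by simp)
        (by field_simp; linear_combination (-2 * c₁) * Complex.I_sq)
    · exact .zero
    · have hv := hD.values_P.smul I
      exact hv.of_eq (by simp) (by simp) (by simp) (by simp) (by simp)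
  · simp only [Case.formulas, classical, tens_zero]
    module
  · simp only [Case.formulas, classical]
  · simp only [Case.formulas, classical, tens_smul, tens_zero]
    module
  · simp only [Case.formulas, classical, antipode_one, antipode_zero, mul_one, mul_zero, mul_assoc]
    module
  · simp only [Case.formulas, classical, neg_neg, mul_assoc, antipode_exp_smul hM h1]
  · simp only [Case.formulas, classical, antipode_zero, antipode_smul, neg_neg, mul_zero,
      mul_smul_comm, dual_mul_neg, mul_assoc, antipode_exp_smul hM h1,
      antipode_mul_exp_smul hM h1 _ hM h1 (Commute.refl M)]
    module

theorem hasDual_case8 (c₁ c₂ : ℂ) : HasDual (.case8 c₁ c₂) := by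
  let d : RightData := ⟨0, -(I * c₁), 0, 0, 0, I * c₂, 0, 0⟩
  have hd : d.Compatible := by constructor <;> simp [d]
  obtain ⟨M, H, P, K, hD, hM, hW⟩ := d.exists_functionals (q := .case8 c₁ c₂) (by
    constructor <;>
      simp only [Case.brackets, RightData.va, RightData.vτ, d.vm hd, d.τm hd, d.am hd, d.τa,
        RightData.v_sq, d] <;>
      module)
  have h1 := hD.values_M.1
  have cM := hD.centralValues hM
  have cPK := (cM.mul cM).smul (-(c₁ * c₂ / 2))
  obtain ⟨hH, hP, hK⟩ := hW 1 (c₁ • M) 0 1 1 (-c₂ • M) (-(c₁ * c₂ / 2) • (M * M)) (by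
    refine ⟨?_, ?_, ?_, ?_, ?_, ?_, ?_, .one, (cM.smul c₁).hasValues (by simp) (by simp [d]; ring),
      .zero, .one, .one, (cM.smul (-c₂)).hasValues (by simp) (by simp [d]; ring),
      cPK.hasValues (by simp) (by simp [d])⟩ <;>
      simp only [coproduct_smul, coproduct_mul, coproduct_one, coproduct_zero, hM, add_mul,
        mul_add, tens_mul_tens, one_mul, mul_one, tens_smul, smul_tens, tens_zero, zero_tens] <;>
      module)
  refine ⟨M, H, P, K, hD, .of_right hD hM hH hP hK ?_ rfl rfl rfl rfl ?_ ?_ ?_ rfl ?_ ?_ ?_⟩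
  · refine commutators_eq hD hH hP hK Commute.one_right (cM.smul c₁).central
      Commute.zero_right Commute.one_right Commute.one_right (cM.smul (-c₂)).central
      (cPK.central _) (cPK.central _) ?_ ?_ ?_ ?_ ?_ ?_
    · simp only [Case.formulas, classical, coproduct_smul, tens_smul, smul_tens, zero_tens,
        mul_one, hM]
      module
    · simp only [Case.formulas, classical, coproduct_zero, tens_zero, zero_tens, add_zero, zero_mul]
    · simp only [Case.formulas, classical, pow_two, coproduct_smul, coproduct_sub, coproduct_mul,
        hM, hP, tens_smul, smul_tens, tens_sub, sub_tens, zero_tens, one_mul, mul_one, mul_zero,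
        sub_zero, zero_sub, add_mul, mul_add, tens_mul_tens]
      module
    · exact (cM.smul I).hasValues (by simp) (by simp)
    · exact .zero
    · have hv := ((hD.values_P.smul I).sub (cM.sq.smul (I * c₂ / 2)).values)
      exact hv.of_eq (by simp) (by simp) (by simp) (by simp) (by simp)
  · simp only [Case.formulas, classical, tens_smul, tens_zero, pow_two]
    module
  · simp only [Case.formulas, classical, pow_two]
  · simp only [Case.formulas, classical, tens_smul, pow_two]
    module
  · simp only [Case.formulas, classical, antipode_one, antipode_zero, antipode_smul,
      antipode_of_primitive hM h1, mul_one, mul_zero, mul_smul_comm, dual_mul_neg]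
    module
  · simp only [Case.formulas, classical, antipode_one, mul_one]
  · simp only [Case.formulas, classical, antipode_one, antipode_smul, antipode_of_primitive hM h1,
      mul_one, mul_smul_comm, dual_mul_neg, ← pow_two, antipode_sq_of_primitive hM h1]
    module

theorem hasDual_case11 (c₁ c₂ : ℂ) (hc : c₁ ≠ 0) : HasDual (.case11 c₁ c₂) := by
  let d : RightData := ⟨-(I * c₁), 0, 0, 0, -(I * c₁), I * c₂, 0, 0⟩
  have hd : d.Compatible := by constructor <;> simp [d]
  obtain ⟨M, H, P, K, hD, hM, hW⟩ := d.exists_functionals (q := .case11 c₁ c₂) (by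
    constructor <;>
      simp only [Case.brackets, RightData.va, RightData.vτ, d.vm hd, d.τm hd, d.am hd, d.τa, d] <;>
      module)
  have h1 := hD.values_M.1
  have cM := hD.centralValues hM
  have cg := cM.exp_smul c₁
  have hg := coproduct_exp_smul hM h1 c₁
  have cPH := (cM.mul cg).smul (-c₂)
  obtain ⟨hH, hP, hK⟩ := hW (exp (c₁ • M)) 0 0 1 (exp (c₁ • M)) (-c₂ • (M * exp (c₁ • M))) 0 (by
    refine ⟨?_, ?_, ?_, ?_, ?_, ?_, ?_, cg.hasValues rfl (by simp [d]; ring), .zero, .zero, .one,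
      cg.hasValues rfl (by simp [d]; ring), cPH.hasValues (by simp) (by simp [d]; ring), .zero⟩ <;>
      simp only [coproduct_smul, coproduct_mul, coproduct_one, coproduct_zero, hM, add_mul,
        tens_mul_tens, one_mul, tens_smul, smul_tens, tens_zero, zero_tens, hg] <;>
      module)
  refine ⟨M, H, P, K, hD, .of_right hD hM hH hP hK ?_ rfl rfl rfl rfl ?_ ?_ ?_ rfl ?_ ?_ ?_⟩
  · refine commutators_eq hD hH hP hK cg.central Commute.zero_right Commute.zero_right
      Commute.one_right cg.central cPH.central (Commute.zero_right _) (Commute.zero_right _) ?_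
      ?_ ?_ ?_ ?_ ?_
    · simp only [Case.formulas, classical, coproduct_smul, coproduct_sub, coproduct_one, tens_smul,
        smul_tens, tens_sub, sub_tens, zero_tens, one_mul, hg]
      module
    · simp only [Case.formulas, classical, coproduct_zero, tens_zero, zero_tens, add_zero, zero_mul]
    · simp only [Case.formulas, classical, coproduct_smul, coproduct_sub, coproduct_add,
        coproduct_one, coproduct_mul, hM, hP, tens_smul, smul_tens, tens_sub, sub_tens, add_tens,
        tens_add, tens_zero, one_mul, mul_zero, zero_mul, sub_zero, add_mul, tens_mul_tens, hg]
      module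
    · exact ((cg.sub .one).smul _).hasValues (by simp)
        (by field_simp; linear_combination (-c₁) * Complex.I_sq)
    · exact .zero
    · have hv := (((hD.values_P.smul I).sub ((cM.mul cg).smul (I * c₂ / c₁)).values).add
        ((cg.sub .one).smul (I * c₂ / c₁ ^ 2)).values)
      exact hv.of_eq (by simp) (by simp; field_simp; ring) (by simp) (by simp) (by simp)
  · simp only [Case.formulas, classical, tens_smul, tens_zero]
    module
  · simp only [Case.formulas, classical]
  · simp only [Case.formulas, classical, tens_zero]
    module
  · simp only [Case.formulas, classical, antipode_zero, antipode_smul, mul_zero, mul_smul_comm,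
      dual_mul_neg, mul_assoc, antipode_exp_smul hM h1,
      antipode_mul_exp_smul hM h1 _ hM h1 (Commute.refl M)]
    module
  · simp only [Case.formulas, classical, mul_assoc, antipode_exp_smul hM h1]
  · simp only [Case.formulas, classical, antipode_one, antipode_zero, mul_one, mul_zero, mul_assoc]
    module

theorem hasDual_case12 (c₁ c₂ : ℂ) (hc : 2 * c₁ ≠ c₂) : HasDual (.case12 c₁ c₂) := by
  let d : RightData := ⟨-(I * c₂), 0, 0, I * c₁, I * (c₁ - c₂), 0, 0, 0⟩
  have hd : d.Compatible := by constructor <;> simp [d]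
  obtain ⟨M, H, P, K, hD, hM, hW⟩ := d.exists_functionals (q := .case12 c₁ c₂) (by
    constructor <;>
      simp only [Case.brackets, RightData.va, RightData.vτ, d.vm hd, d.τm hd, d.am hd, d.τa, d] <;>
      module)
  have h1 := hD.values_M.1
  have cM := hD.centralValues hM
  have hc' : 2 * c₁ - c₂ ≠ 0 := sub_ne_zero.2 hc
  have ch := cM.exp_smul c₂
  have hh := coproduct_exp_smul hM h1 c₂
  have cp := cM.exp_smul (c₂ - c₁)
  have hp := coproduct_exp_smul hM h1 (c₂ - c₁)
  have ck := cM.exp_smul (-c₁)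
  have hk := coproduct_exp_smul hM h1 (-c₁)
  have hg := coproduct_exp_smul hM h1 (-(2 * c₁ - c₂))
  have hkp : exp (-c₁ • M) * exp ((c₂ - c₁) • M) = exp (-(2 * c₁ - c₂) • M) := by
    rw [(filtration _).exp_smul_mul_exp_smul h1]; congr 2; ring
  have hkh : exp (-c₁ • M) * exp (c₂ • M) = exp ((c₂ - c₁) • M) := by
    rw [(filtration _).exp_smul_mul_exp_smul h1]; congr 2; ring
  obtain ⟨hH, hP, hK⟩ := hW (exp (c₂ • M)) 0 0 (exp (-c₁ • M)) (exp ((c₂ - c₁) • M)) 0 0 (by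
    refine ⟨?_, ?_, ?_, ?_, ?_, ?_, ?_, ch.hasValues rfl (by simp [d]; ring), .zero, .zero,
      ck.hasValues rfl (by simp [d]; ring), cp.hasValues rfl (by simp [d]; ring), .zero, .zero⟩ <;>
      simp only [coproduct_zero, tens_zero, zero_tens, hh, hp, hk] <;>
      module)
  refine ⟨M, H, P, K, hD, .of_right hD hM hH hP hK ?_ rfl rfl rfl rfl ?_ ?_ ?_ rfl ?_ ?_ ?_⟩
  · refine commutators_eq hD hH hP hK ch.central Commute.zero_right
      Commute.zero_right ck.central cp.central Commute.zero_right (Commute.zero_right _)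
      (Commute.zero_right _) ?_ ?_ ?_ ?_ ?_ ?_
    · simp only [Case.formulas, classical, coproduct_smul, coproduct_sub, coproduct_one, tens_smul,
        smul_tens, tens_sub, sub_tens, zero_tens, hg, hkp]
      module
    · simp only [Case.formulas, classical, coproduct_zero, tens_zero, zero_tens, add_zero, zero_mul]
    · simp only [Case.formulas, classical, coproduct_smul, hP, tens_smul, smul_tens, tens_zero,
        mul_zero, zero_mul, sub_zero, hkh]
      module
    · exact ((CentralValues.one.sub (cM.exp_smul _)).smul _).hasValues (by simp)
        (by field_simp; linear_combination (-(2 * c₁ - c₂)) * Complex.I_sq)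
    · exact .zero
    · have hv := hD.values_P.smul I
      exact hv.of_eq (by simp) (by simp) (by simp) (by simp) (by simp)
  · simp only [Case.formulas, classical, tens_zero]
    module
  · simp only [Case.formulas, classical]
  · simp only [Case.formulas, classical, tens_zero]
    module
  · simp only [Case.formulas, classical, antipode_zero, mul_zero, antipode_exp_smul hM h1, neg_sub]
    module
  · simp only [Case.formulas, classical, antipode_exp_smul hM h1, neg_sub]
  · simp only [Case.formulas, classical, antipode_zero, neg_neg, mul_zero, antipode_exp_smul hM h1,
      neg_sub]
    module

theorem hasDual_case13 (c₁ c₂ : ℂ) (hc : c₁ ≠ 0) : HasDual (.case13 c₁ c₂) := by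
  let d : RightData := ⟨I * c₁, -(I * c₂), 0, I * c₁, 2 * I * c₁, 0, 0, 0⟩
  have hd : d.Compatible := by constructor <;> simp [d]
  obtain ⟨M, H, P, K, hD, hM, hW⟩ := d.exists_functionals (q := .case13 c₁ c₂) (by
    constructor <;>
      simp only [Case.brackets, RightData.va, RightData.vτ, d.vm hd, d.τm hd, d.am hd, d.τa,
        RightData.v_sq, d] <;>
      module)
  have h1 := hD.values_M.1
  have cM := hD.centralValues hM
  have ch := cM.exp_smul (-c₁)
  have hh := coproduct_exp_smul hM h1 (-c₁)
  have cp := cM.exp_smul (-(2 * c₁))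
  have hp := coproduct_exp_smul hM h1 (-(2 * c₁))
  have cHK := (cM.mul ch).smul c₂
  have hg := coproduct_exp_smul hM h1 (-(3 * c₁))
  have hhp : exp (-c₁ • M) * exp (-(2 * c₁) • M) = exp (-(3 * c₁) • M) := by
    rw [(filtration _).exp_smul_mul_exp_smul h1]; congr 2; ring
  have hhh : exp (-c₁ • M) * exp (-c₁ • M) = exp (-(2 * c₁) • M) := by
    rw [(filtration _).exp_smul_mul_exp_smul h1]; congr 2; ring
  obtain ⟨hH, hP, hK⟩ := hW (exp (-c₁ • M)) (c₂ • (M * exp (-c₁ • M))) 0 (exp (-c₁ • M))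
      (exp (-(2 * c₁) • M)) 0 0 (by
    refine ⟨?_, ?_, ?_, ?_, ?_, ?_, ?_, ch.hasValues rfl (by simp [d]; ring),
      cHK.hasValues (by simp) (by simp [d]; ring), .zero, ch.hasValues rfl (by simp [d]; ring),
      cp.hasValues rfl (by simp [d]; ring), .zero, .zero⟩ <;>
      simp only [coproduct_smul, coproduct_mul, coproduct_zero, hM, add_mul, tens_mul_tens,
        one_mul, tens_smul, smul_tens, tens_zero, zero_tens, hh, hp] <;>
      module)
  refine ⟨M, H, P, K, hD, .of_right hD hM hH hP hK ?_ rfl rfl rfl rfl ?_ ?_ ?_ rfl ?_ ?_ ?_⟩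
  · refine commutators_eq hD hH hP hK ch.central cHK.central
      Commute.zero_right ch.central cp.central Commute.zero_right (Commute.zero_right _)
      (Commute.zero_right _) ?_ ?_ ?_ ?_ ?_ ?_
    · simp only [Case.formulas, classical, coproduct_smul, coproduct_sub, coproduct_one, tens_smul,
        smul_tens, tens_sub, sub_tens, zero_tens, hg, hhp]
      module
    · simp only [Case.formulas, classical, coproduct_zero, tens_zero, zero_tens, add_zero, zero_mul]
    · simp only [Case.formulas, classical, coproduct_smul, hP, tens_smul, smul_tens, tens_zero,
        mul_zero, zero_mul, sub_zero, hhh]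
      module
    · exact ((CentralValues.one.sub (cM.exp_smul _)).smul _).hasValues (by simp)
        (by field_simp; linear_combination (-3 * c₁) * Complex.I_sq)
    · exact .zero
    · have hv := hD.values_P.smul I
      exact hv.of_eq (by simp) (by simp) (by simp) (by simp) (by simp)
  · simp only [Case.formulas, classical, tens_zero]
    module
  · simp only [Case.formulas, classical]
  · simp only [Case.formulas, classical, tens_smul, tens_zero]
    module
  · simp only [Case.formulas, classical, antipode_zero, neg_neg, mul_zero, mul_assoc,
      antipode_exp_smul hM h1]
    module
  · simp only [Case.formulas, classical, neg_neg, mul_assoc, antipode_exp_smul hM h1]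
  · simp only [Case.formulas, classical, antipode_zero, antipode_smul, neg_neg, mul_zero,
      mul_smul_comm, dual_mul_neg, mul_assoc, antipode_exp_smul hM h1,
      antipode_mul_exp_smul hM h1 _ hM h1 (Commute.refl M)]
    module

/-! ### Further cases with right translations -/

/-- A primitive functional is determined by its values on the generators. -/
theorem eq_of_primitive {q : Case} {X Y : Dual (QGalilei q)} (hX : coproduct X = 1 ⊠ X + X ⊠ 1)
    (hY : coproduct Y = 1 ⊠ Y + Y ⊠ 1) (h : AgreeOnGenerators X Y) : X = Y :=
  eq_of_coproduct (T := 0) (by rw [hX, add_zero]) (by rw [hY, add_zero]) h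

theorem hasDual_case1 (c : ℂ) : HasDual (.case1 c) := by
  let d : RightData := ⟨0, 0, 0, 0, 0, 0, 0, -(I * c)⟩
  have hd : d.Compatible := by constructor <;> simp [d]
  obtain ⟨M, H, P, K, hD, hM, hW⟩ := d.exists_functionals (q := .case1 c) (by
    constructor <;>
      simp only [Case.brackets, RightData.va, RightData.vτ, d.vm hd, d.τm hd, d.am hd, d.τa,
        RightData.v_sq, RightData.v_cube, d] <;>
      module)
  have h1 := hD.values_M.1
  have cM := hD.centralValues hM
  -- The translation matrix contains `H`. A primitive functional `H'` with the same values on the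
  -- generators is used to write down the matrix; it turns out to be equal to `H`.
  obtain ⟨H', hH', vH'⟩ := exists_primitive (q := .case1 c) (xm := 0) (xτ := I) (xv := 0) (xa := 0)
    (by constructor <;> simp [Case.brackets])
  obtain ⟨hH, hP, hK⟩ := hW 1 0 0 1 1 0 (-c • H') (by
    refine ⟨?_, ?_, ?_, ?_, ?_, ?_, ?_, .one, .zero, .zero, .one, .one, .zero,
      (vH'.smul (-c)).of_eq (by simp) (by simp [d]) (by simp [d]; ring) (by simp) (by simp)⟩ <;>
      simp only [coproduct_smul, coproduct_one, coproduct_zero, hH', tens_smul, smul_tens,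
        tens_zero, zero_tens] <;>
      module)
  obtain rfl : H = H' := by
    refine eq_of_primitive ?_ hH' (hD.values_H.agree vH')
    rw [hH]; simp only [tens_zero, add_zero]
  have hHP : H * P - P * H = 0 := by
    refine eq_of_primitive ?_ ?_ (hD.values_HP.agree .zero)
    · simp only [coproduct_sub, coproduct_mul, hH', hP, add_mul, mul_add, tens_mul_tens, one_mul,
        mul_one, sub_tens, tens_sub]
      abel
    · simp only [coproduct_zero, tens_zero, zero_tens, add_zero]
  have cP : Commute P (-c • H) := Commute.smul_right (sub_eq_zero.1 hHP).symm _
  refine ⟨M, H, P, K, hD, .of_right hD hM hH hP hK ?_ rfl rfl rfl rfl ?_ ?_ ?_ rfl ?_ ?_ ?_⟩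
  · refine commutators_eq hD hH hP hK Commute.one_right Commute.zero_right Commute.zero_right
      Commute.one_right Commute.one_right Commute.zero_right cP ((Commute.refl H).smul_right _)
      ?_ ?_ ?_ ?_ .zero ?_
    · simp only [Case.formulas, classical, coproduct_smul, hM, mul_one, tens_smul, smul_tens,
        tens_zero]
      module
    · simp only [Case.formulas, classical, coproduct_zero, tens_zero, zero_tens, add_zero, zero_mul]
    · simp only [Case.formulas, classical, coproduct_smul, hP, mul_one, mul_zero, sub_zero,
        zero_sub, tens_smul, smul_tens, tens_zero, zero_tens]
      module
    · exact (hD.values_M.smul I).of_eq (by simp) (by simp) (by simp) (by simp) (by simp)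
    · exact (hD.values_P.smul I).of_eq (by simp) (by simp) (by simp) (by simp) (by simp)
  · simp only [Case.formulas, classical, tens_zero]; abel
  · rfl
  · simp only [Case.formulas, classical, tens_smul, tens_zero]; module
  · simp only [Case.formulas, classical, antipode_one, antipode_zero, mul_one, mul_zero, add_zero]
  · simp only [Case.formulas, classical, antipode_one, mul_one]
  · simp only [Case.formulas, classical, antipode_one, antipode_zero, antipode_smul,
      antipode_of_primitive hH' vH'.1, mul_one, mul_zero, mul_smul_comm, dual_mul_neg]
    module

theorem hasDual_case7 (c₁ c₂ : ℂ) (hc : c₁ ≠ 0) : HasDual (.case7 c₁ c₂) := by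
  let d : RightData := ⟨0, 0, 0, I * c₁, I * c₁, 0, 0, -(I * c₂)⟩
  have hd : d.Compatible := by constructor <;> simp [d]; ring
  obtain ⟨M, H, P, K, hD, hM, hW⟩ := d.exists_functionals (q := .case7 c₁ c₂) (by
    constructor <;>
      simp only [Case.brackets, RightData.va, RightData.vτ, d.vm hd, d.τm hd, d.am hd, d.τa,
        RightData.v_sq, RightData.v_cube, d] <;>
      module)
  have h1 := hD.values_M.1
  have cM := hD.centralValues hM
  have cg := cM.exp_smul (-c₁)
  have hg := coproduct_exp_smul hM h1 (-c₁)
  have hg2 := coproduct_exp_smul hM h1 (-(2 * c₁))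
  have hgg : exp (-c₁ • M) * exp (-c₁ • M) = exp (-(2 * c₁) • M) := by
    rw [(filtration _).exp_smul_mul_exp_smul h1]; congr 2; ring
  -- The translation matrix contains `H`. A primitive functional `H'` with the same values on the
  -- generators is used to write down the matrix; it turns out to be equal to `H`.
  obtain ⟨H', hH', vH'⟩ := exists_primitive (q := .case7 c₁ c₂) (xm := 0) (xτ := I) (xv := 0)
    (xa := 0) (by constructor <;> simp [Case.brackets, pow_succ])
  have vPK : HasValues (-c₂ • (H' * exp (-c₁ • M))) 0 d.pK d.s 0 0 := by
    constructor <;> rw [dual_smul_apply]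
    · rw [mul_apply_one, vH'.1]; ring
    · rw [mul_apply_m, vH'.1, vH'.2, vH'.4, cg.values.3]; simp [d]
    · rw [mul_apply_τ, vH'.1, vH'.3, cg.values.1]; simp [d]; ring
    · rw [mul_apply_v, vH'.1, vH'.4]; ring
    · rw [mul_apply_a, vH'.1, vH'.4, vH'.5]; ring
  obtain ⟨hH, hP, hK⟩ := hW 1 0 0 (exp (-c₁ • M)) (exp (-c₁ • M)) 0 (-c₂ • (H' * exp (-c₁ • M))) (by
    refine ⟨?_, ?_, ?_, ?_, ?_, ?_, ?_, .one, .zero, .zero, cg.hasValues rfl (by simp [d]; ring),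
      cg.hasValues rfl (by simp [d]; ring), .zero, vPK⟩ <;>
      simp only [coproduct_smul, coproduct_mul, coproduct_one, coproduct_zero, hH', hg, add_mul,
        tens_mul_tens, one_mul, tens_smul, smul_tens, tens_zero, zero_tens] <;>
      module)
  obtain rfl : H = H' := by
    refine eq_of_primitive ?_ hH' (hD.values_H.agree vH')
    rw [hH]; simp only [tens_zero, add_zero]
  have hHP : H * P - P * H = 0 := by
    refine eq_of_coproduct (L := 1) (R := exp (-c₁ • M)) (T := 0) ?_ ?_ (hD.values_HP.agree .zero)
    · simp only [coproduct_sub, coproduct_mul, hH', hP, add_mul, mul_add, tens_mul_tens, one_mul,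
        mul_one, sub_tens, tens_sub, (cg.central H).eq]
      abel
    · simp only [coproduct_zero, tens_zero, zero_tens, add_zero]
  have cP : Commute P (-c₂ • (H * exp (-c₁ • M))) :=
    (Commute.mul_right (sub_eq_zero.1 hHP).symm (cg.central P)).smul_right _
  refine ⟨M, H, P, K, hD, .of_right hD hM hH hP hK ?_ rfl rfl rfl rfl ?_ ?_ ?_ rfl ?_ ?_ ?_⟩
  · refine commutators_eq hD hH hP hK Commute.one_right Commute.zero_right Commute.zero_right
      cg.central cg.central Commute.zero_right cP
      (((Commute.refl H).mul_right (cg.central H)).smul_right _) ?_ ?_ ?_ ?_ .zero ?_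
    · simp only [Case.formulas, classical, coproduct_smul, coproduct_sub, coproduct_one, hg2, hgg,
        tens_smul, smul_tens, tens_sub, sub_tens, zero_tens]
      module
    · simp only [Case.formulas, classical, coproduct_zero, tens_zero, zero_tens, add_zero, zero_mul]
    · simp only [Case.formulas, classical, coproduct_smul, hP, mul_one, mul_zero, sub_zero,
        zero_sub, tens_smul, smul_tens, tens_zero, zero_tens]
      module
    · exact ((CentralValues.one.sub (cM.exp_smul _)).smul _).hasValues (by simp)
        (by field_simp; linear_combination (-2 * c₁) * Complex.I_sq)
    · exact (hD.values_P.smul I).of_eq (by simp) (by simp) (by simp) (by simp) (by simp)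
  · simp only [Case.formulas, classical, tens_zero]; abel
  · rfl
  · simp only [Case.formulas, classical, tens_smul, tens_zero]; module
  · simp only [Case.formulas, classical, antipode_one, antipode_zero, mul_one, mul_zero, add_zero]
  · simp only [Case.formulas, classical, antipode_exp_smul hM h1, neg_neg]
  · simp only [Case.formulas, classical, antipode_exp_smul hM h1, antipode_zero, antipode_smul,
      antipode_mul_exp_smul hM h1 _ hH' vH'.1 (cM.central H), neg_neg, mul_zero, mul_smul_comm,
      dual_mul_neg, mul_assoc]
    module

theorem hasDual_case14 (c₁ c₂ c₃ : ℂ) (hc : c₂ ≠ 0) : HasDual (.case14 c₁ c₂ c₃) := by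
  let d : RightData := ⟨-(I * c₂), 0, I * c₁, 0, -(I * c₂), 0, I * c₃, 0⟩
  have hd : d.Compatible := by constructor <;> simp [d]
  obtain ⟨M, H, P, K, hD, hM, hW⟩ := d.exists_functionals (q := .case14 c₁ c₂ c₃) (by
    constructor <;>
      simp only [Case.brackets, RightData.va, RightData.vτ, d.vm hd, d.τm hd, d.am hd, d.τa,
        RightData.τ_sq, d] <;>
      module)
  have h1 := hD.values_M.1
  have cM := hD.centralValues hM
  have ce := cM.exp_smul c₂
  have he := coproduct_exp_smul hM h1 c₂
  have he2 := coproduct_exp_smul hM h1 (2 * c₂)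
  have hee : exp (c₂ • M) * exp (c₂ • M) = exp ((2 * c₂) • M) := by
    rw [(filtration _).exp_smul_mul_exp_smul h1]; congr 2; ring
  have cKH := (CentralValues.one.sub ce).smul (c₁ / c₂)
  have cPK := (CentralValues.one.sub ce).smul (c₃ / c₂)
  have cPH := ((cM.mul ce).smul (c₁ * c₃ / c₂)).add
    ((CentralValues.one.sub ce).smul (c₁ * c₃ / c₂ ^ 2))
  obtain ⟨hH, hP, hK⟩ := hW (exp (c₂ • M)) 0 _ 1 (exp (c₂ • M)) _ _ (by
    refine ⟨?_, ?_, ?_, ?_, ?_, ?_, ?_, ce.hasValues rfl (by simp [d]; ring), .zero,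
      cKH.hasValues (by simp) (by simp [d]; field_simp), .one, ce.hasValues rfl (by simp [d]; ring),
      cPH.hasValues (by simp) (by simp [d]; field_simp; ring),
      cPK.hasValues (by simp) (by simp [d]; field_simp)⟩ <;>
      simp only [coproduct_smul, coproduct_mul, coproduct_one, coproduct_zero, coproduct_add,
        coproduct_sub, hM, he, add_mul, tens_mul_tens, one_mul, tens_smul, smul_tens, tens_zero,
        zero_tens, tens_add, add_tens, tens_sub, sub_tens] <;>
      module)
  refine ⟨M, H, P, K, hD, .of_right hD hM hH hP hK ?_ rfl rfl rfl rfl ?_ rfl ?_ rfl ?_ ?_ ?_⟩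
  · refine commutators_eq hD hH hP hK ce.central Commute.zero_right cKH.central Commute.one_right
      ce.central cPH.central (cPK.central _) (cPK.central _) ?_ ?_ ?_ ?_ ?_ ?_
    · simp only [Case.formulas, classical, coproduct_smul, coproduct_sub, coproduct_one, he,
        one_mul, zero_mul, tens_zero, tens_smul, smul_tens, tens_sub, sub_tens]
      module
    · simp only [Case.formulas, classical, coproduct_smul, coproduct_sub, coproduct_add,
        coproduct_one, he, he2, one_mul, sub_mul, smul_mul_assoc, hee, tens_smul, smul_tens,
        tens_sub, sub_tens, tens_add, add_tens]
      module
    · simp only [Case.formulas, classical, coproduct_smul, coproduct_sub, coproduct_add,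
        coproduct_one, coproduct_mul, hP, hM, he, he2, one_mul, mul_one, zero_mul, zero_sub,
        sub_zero, add_mul, tens_mul_tens, sub_mul, mul_sub, smul_mul_assoc, mul_smul_comm, hee,
        tens_smul, smul_tens, tens_sub, sub_tens, tens_add, add_tens, tens_neg, tens_zero]
      module
    · exact ((ce.sub .one).smul _).hasValues (by simp)
        (by field_simp; linear_combination (-c₂) * Complex.I_sq)
    · exact ((((cM.exp_smul (2 * c₂)).sub .one).smul (-(I * c₁ / (2 * c₂ ^ 2)))).add
        ((ce.sub .one).smul (I * c₁ / c₂ ^ 2))).hasValues (by simp) (by field_simp; ring)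
    · have hv := ((hD.values_P.smul I).add ((cM.mul ce).smul (I * c₁ * c₃ / c₂ ^ 2)).values).sub
        (((cM.exp_smul (2 * c₂)).sub .one).smul (I * c₁ * c₃ / (2 * c₂ ^ 3))).values
      exact hv.of_eq (by simp) (by simp; field_simp; ring) (by simp) (by simp) (by simp)
  · simp only [Case.formulas, classical, tens_smul, tens_sub, tens_add]; module
  · simp only [Case.formulas, classical, tens_smul, tens_sub, tens_zero]; module
  · simp only [Case.formulas, classical, antipode_exp_smul hM h1, antipode_smul, antipode_add,
      antipode_sub, antipode_one, antipode_mul_exp_smul hM h1 _ hM h1 (Commute.refl M), mul_add,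
      mul_sub, mul_one, mul_smul_comm, dual_mul_neg, mul_assoc]
    module
  · simp only [Case.formulas, classical, antipode_exp_smul hM h1]
  · simp only [Case.formulas, classical, antipode_exp_smul hM h1, antipode_smul, antipode_sub,
      antipode_one, antipode_zero, mul_sub, mul_one, mul_zero, mul_smul_comm]
    module

/-- The chosen root is a square root of the discriminant; only this property is used, so that the
choice of the branch is irrelevant. -/
theorem root_sq (c₁ c₂ c₃ : ℂ) : root c₁ c₂ c₃ ^ 2 = c₂ ^ 2 - 4 * c₁ * c₃ := by
  rw [root, one_div]
  exact_mod_cast Complex.cpow_nat_inv_pow _ (two_ne_zero)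

theorem hasDual_case15 (c₁ c₂ c₃ : ℂ) (hr0 : c₂ ^ 2 ≠ 4 * c₁ * c₃)
    (hρ : 2 * c₂ ^ 2 + c₁ * c₃ ≠ 0) : HasDual (.case15 c₁ c₂ c₃) := by
  let d : RightData := ⟨-(I * c₂), -(I * c₃), I * c₁, 0, -(I * c₂), 0, 0, 0⟩
  have hd : d.Compatible := by constructor <;> simp [d]
  obtain ⟨M, H, P, K, hD, hM, hW⟩ := d.exists_functionals (q := .case15 c₁ c₂ c₃) (by
    constructor <;>
      simp only [Case.brackets, RightData.va, RightData.vτ, d.vm hd, d.τm hd, d.am hd, d.τa,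
        RightData.τ_sq, RightData.v_sq, d] <;>
      module)
  have h1 := hD.values_M.1
  have cM := hD.centralValues hM
  obtain ⟨r, hr⟩ : ∃ r, root c₁ c₂ c₃ = r := ⟨_, rfl⟩
  have hr2 : r ^ 2 = c₂ ^ 2 - 4 * c₁ * c₃ := hr ▸ root_sq c₁ c₂ c₃
  have r0 : r ≠ 0 := fun h => hr0 (by rw [h] at hr2; linear_combination -hr2)
  have hρρ : (3 * c₂ / 2 + r / 2) * (3 * c₂ / 2 - r / 2) ≠ 0 := by
    convert hρ using 1
    linear_combination (-1 / 4) * hr2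
  have hρ₁ := left_ne_zero_of_mul hρρ
  have hρ₂ := right_ne_zero_of_mul hρρ
  -- The translation matrix is `e ^ ((c₂ - r) / 2 * M)` times a projection plus
  -- `e ^ ((c₂ + r) / 2 * M)` times the complementary projection.
  obtain ⟨α, hα⟩ : ∃ α, α = (1 - c₂ / r) / 2 := ⟨_, rfl⟩
  obtain ⟨x, hx⟩ : ∃ x, x = c₁ / r := ⟨_, rfl⟩
  obtain ⟨y, hy⟩ : ∃ y, y = c₃ / r := ⟨_, rfl⟩
  obtain ⟨u, hu⟩ : ∃ u, u = I / (3 * c₂ / 2 + r / 2) := ⟨_, rfl⟩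
  obtain ⟨w, hw⟩ : ∃ w, w = I / (3 * c₂ / 2 - r / 2) := ⟨_, rfl⟩
  have huρ : u * (3 * c₂ / 2 + r / 2) = I := by rw [hu, div_mul_cancel₀ _ hρ₁]
  have hwρ : w * (3 * c₂ / 2 - r / 2) = I := by rw [hw, div_mul_cancel₀ _ hρ₂]
  have hxy : x * y = -(α * (1 - α)) := by
    rw [hx, hy, hα]; field_simp; linear_combination hr2
  have e1 : c₂ / r = 1 - 2 * α := by rw [hα]; ring
  have e2 : 2 * c₁ / r = 2 * x := by rw [hx]; ring
  have e3 : 2 * c₃ / r = 2 * y := by rw [hy]; ring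
  have e4 : I * (-(c₂ / 2) + r / 2) / (r * (3 * c₂ / 2 + r / 2)) = α * u := by
    rw [hα, hu]; field_simp; ring
  have e5 : I * (c₂ / 2 + r / 2) / (r * (3 * c₂ / 2 - r / 2)) = (1 - α) * w := by
    rw [hα, hw]; field_simp; ring
  have e6 : I * c₁ / (r * (3 * c₂ / 2 - r / 2)) = x * w := by rw [hx, hw]; field_simp
  have e7 : I * c₁ / (r * (3 * c₂ / 2 + r / 2)) = x * u := by rw [hx, hu]; field_simp
  have cg := cM.exp_smul ((c₂ - r) / 2)
  have ck := cM.exp_smul ((c₂ + r) / 2)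
  have cp := cM.exp_smul c₂
  have hg := coproduct_exp_smul hM h1 ((c₂ - r) / 2)
  have hk := coproduct_exp_smul hM h1 ((c₂ + r) / 2)
  have hp := coproduct_exp_smul hM h1 c₂
  have h₁ := coproduct_exp_smul hM h1 (3 * c₂ / 2 + r / 2)
  have h₂ := coproduct_exp_smul hM h1 (3 * c₂ / 2 - r / 2)
  have sg := antipode_exp_smul hM h1 ((c₂ - r) / 2)
  have sk := antipode_exp_smul hM h1 ((c₂ + r) / 2)
  have mul_exp := (filtration (.case15 c₁ c₂ c₃)).exp_smul_mul_exp_smul h1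
  have hgk : exp (((c₂ - r) / 2) • M) * exp (((c₂ + r) / 2) • M) = exp (c₂ • M) := by
    rw [mul_exp]; congr 2; ring
  have hgp : exp (((c₂ - r) / 2) • M) * exp (c₂ • M) = exp ((3 * c₂ / 2 - r / 2) • M) := by
    rw [mul_exp]; congr 2; ring
  have hkp : exp (((c₂ + r) / 2) • M) * exp (c₂ • M) = exp ((3 * c₂ / 2 + r / 2) • M) := by
    rw [mul_exp]; congr 2; ring
  have hcosh : exp ((c₂ / 2) • M) * cosh (-(r / 2) • M) =
      (1 / 2 : ℂ) • (exp (((c₂ - r) / 2) • M) + exp (((c₂ + r) / 2) • M)) := by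
    rw [cosh, ← dual_neg_smul, mul_smul_comm, mul_add, mul_exp, mul_exp]
    congr 4 <;> ring
  have hsinh : exp ((c₂ / 2) • M) * sinh (-(r / 2) • M) =
      (1 / 2 : ℂ) • (exp (((c₂ - r) / 2) • M) - exp (((c₂ + r) / 2) • M)) := by
    rw [sinh, ← dual_neg_smul, mul_smul_comm, mul_sub, mul_exp, mul_exp]
    congr 4 <;> ring
  have hcosh' : exp (-(c₂ / 2) • M) * cosh ((r / 2) • M) =
      (1 / 2 : ℂ) • (exp (-((c₂ - r) / 2) • M) + exp (-((c₂ + r) / 2) • M)) := by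
    rw [cosh, ← dual_neg_smul, mul_smul_comm, mul_add, mul_exp, mul_exp]
    congr 4 <;> ring
  have hsinh' : exp (-(c₂ / 2) • M) * sinh ((r / 2) • M) =
      (1 / 2 : ℂ) • (exp (-((c₂ - r) / 2) • M) - exp (-((c₂ + r) / 2) • M)) := by
    rw [sinh, ← dual_neg_smul, mul_smul_comm, mul_sub, mul_exp, mul_exp]
    congr 4 <;> ring
  generalize exp (((c₂ - r) / 2) • M) = g at *
  generalize exp (((c₂ + r) / 2) • M) = k at *
  have cHH := (cg.smul α).add (ck.smul (1 - α))
  have cKK := (cg.smul (1 - α)).add (ck.smul α)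
  have cHK := (cg.sub ck).smul (-y)
  have cKH := (cg.sub ck).smul x
  have hkg : k * g = g * k := (cg.central k).eq
  have det : ((1 - α) • g + α • k) * (α • g + (1 - α) • k) - (-y • (g - k)) * (x • (g - k)) =
      exp (c₂ • M) := by
    simp only [add_mul, mul_add, sub_mul, mul_sub, smul_mul_assoc, mul_smul_comm, smul_sub, hkg,
      smul_smul, hgk]
    match_scalars <;> first | linear_combination hxy | linear_combination (-2) * hxy
  obtain ⟨hH, hP, hK⟩ := hW _ _ _ _ (exp (c₂ • M)) 0 0 (by
    refine ⟨?_, ?_, ?_, ?_, hp, ?_, ?_, cHH.hasValues (by simp) ?_, cHK.hasValues (by simp) ?_,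
      cKH.hasValues (by simp) ?_, cKK.hasValues (by simp) ?_, cp.hasValues rfl (by simp [d]; ring),
      .zero, .zero⟩
    iterate 4
      rotate_right
      · simp [d, hα, hx, hy]
        field_simp
        ring
    all_goals
      simp only [coproduct_smul, coproduct_add, coproduct_sub, coproduct_zero, hg, hk, tens_smul,
        smul_tens, tens_add, add_tens, tens_sub, sub_tens, tens_zero, zero_tens]
      match_scalars <;>
        first
        | ring1
        | linear_combination hxy
        | linear_combination (-1 : ℂ) * hxy)
  refine ⟨M, H, P, K, hD, .of_right hD hM hH hP hK ?_ rfl rfl rfl rfl ?_ ?_ ?_ rfl ?_ ?_ ?_⟩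
  · refine commutators_eq hD hH hP hK cHH.central cHK.central cKH.central cKK.central cp.central
      Commute.zero_right (Commute.zero_right _) (Commute.zero_right _) ?_ ?_ ?_ ?_ ?_ ?_
    · simp only [Case.formulas, classical, hr, e4, e5, e6, e7, coproduct_smul, coproduct_sub,
        coproduct_add, coproduct_one, h₁, h₂, add_mul, sub_mul, smul_mul_assoc, hgp, hkp, tens_smul,
        smul_tens, tens_sub, sub_tens, tens_add, add_tens]
      match_scalars <;>
        first
        | ring1
        | linear_combination u * hxy
        | linear_combination -u * hxy
        | linear_combination w * hxy
        | linear_combination -w * hxy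
        | linear_combination (u - w) * hxy
        | linear_combination (w - u) * hxy
    · simp only [Case.formulas, classical, hr, e4, e5, e6, e7, coproduct_smul, coproduct_sub,
        coproduct_one, h₁, h₂, add_mul, sub_mul, smul_mul_assoc, hgp, hkp, tens_smul,
        smul_tens, tens_sub, sub_tens, tens_add, add_tens]
      match_scalars <;> ring
    · simp only [det, mul_zero, zero_mul, sub_zero, tens_zero, add_zero]
      simp only [Case.formulas, classical, coproduct_smul, hP, tens_smul, smul_tens, smul_add]
    · refine ((((cM.exp_smul _).sub .one).smul _).add
        (((cM.exp_smul _).sub .one).smul _)).hasValues (by simp) ?_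
      rw [hr, e4, e5]
      linear_combination (-I * α) * huρ + (-I * (1 - α)) * hwρ - Complex.I_sq
    · refine ((((cM.exp_smul _).sub .one).smul _).sub
        (((cM.exp_smul _).sub .one).smul _)).hasValues (by simp) ?_
      rw [hr, e6, e7]
      linear_combination (-I * x) * hwρ + I * x * huρ
    · exact (hD.values_P.smul I).of_eq (by simp) (by simp) (by simp) (by simp) (by simp)
  · simp only [Case.formulas, classical, hr, e1, e2, mul_sub, mul_smul_comm, hcosh, hsinh,
      tens_smul, tens_sub, tens_add, tens_zero]
    module
  · simp only [Case.formulas, classical]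
  · simp only [Case.formulas, classical, hr, e1, e3, mul_add, mul_smul_comm, hcosh, hsinh,
      tens_smul, tens_sub, tens_add, tens_zero]
    module
  · simp only [Case.formulas, classical, hr, e1, e2, mul_sub, mul_assoc, mul_smul_comm, hcosh',
      hsinh', antipode_smul, antipode_add, antipode_sub, antipode_zero, sg, sk, mul_add, mul_zero]
    module
  · simp only [Case.formulas, classical, antipode_exp_smul hM h1]
  · simp only [Case.formulas, classical, hr, e1, e3, mul_sub, mul_assoc, mul_smul_comm, hcosh',
      hsinh', antipode_smul, antipode_add, antipode_sub, antipode_zero, sg, sk, mul_add, mul_zero]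
    module

/-! ### Cases with left translations -/

theorem hasDual_case10 (c₁ c₂ : ℂ) : HasDual (.case10 c₁ c₂) := by
  let d : LeftData := ⟨0, 0, I * c₂, I * c₁, 0⟩
  obtain ⟨M, H, P, K, hD, hP, hW⟩ := d.exists_functionals (q := .case10 c₁ c₂) (by
    constructor <;>
      simp only [Case.brackets, d.va, d.vτ, LeftData.vm, d.τm, d.am (mul_zero _), d.τa,
        LeftData.v_sq, LeftData.v_cube, d] <;>
      module)
  have vP := hD.values_P
  have vPP : HasValues ((c₁ * c₂ / 2) • (P * P)) 0 0 d.t 0 d.y := by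
    constructor <;> rw [dual_smul_apply]
    · rw [mul_apply_one, vP.1]; ring
    · rw [mul_apply_m, vP.1, vP.4, hD.P_apply_v_sq]; ring
    · rw [mul_apply_τ, vP.1]; ring
    · rw [mul_apply_v, vP.1]; ring
    · rw [mul_apply_a, vP.1, vP.4]; ring
  obtain ⟨hM, hH, hK⟩ := hW 1 (-c₂ • P) ((c₁ * c₂ / 2) • (P * P)) (-c₁ • P) (by
    refine ⟨?_, ?_, ?_, ?_, .one, (vP.smul _).of_eq (by simp) (by simp) (by simp) (by simp)
      (by simp [d]; ring), vPP, (vP.smul _).of_eq (by simp) (by simp) (by simp) (by simp)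
      (by simp [d]; ring)⟩ <;>
      simp only [coproduct_smul, coproduct_mul, coproduct_one, hP, add_mul, mul_add, tens_mul_tens,
        one_mul, mul_one, tens_smul, smul_tens] <;>
      module)
  have cM := (hD.centralValues hM).central
  have hHP : H * P = P * H := by
    refine sub_eq_zero.1 (eq_of_primitive ?_ ?_ (hD.values_HP.agree .zero))
    · simp only [coproduct_sub, coproduct_mul, hH, hP, add_mul, mul_add, tens_mul_tens, one_mul,
        mul_one, sub_tens, tens_sub, smul_tens, mul_smul_comm, smul_mul_assoc, (cM P).eq]
      module
    · simp only [coproduct_zero, tens_zero, zero_tens, add_zero]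
  have hKP : K * P - P * K = I • M := by
    refine eq_of_primitive ?_ ?_ (hD.values_KP.agree
      ((hD.values_M.smul I).of_eq (by simp) (by simp) (by simp) (by simp) (by simp)))
    · simp only [coproduct_sub, coproduct_mul, hK, hP, add_mul, mul_add, tens_mul_tens, one_mul,
        mul_one, sub_tens, tens_sub, smul_tens, mul_smul_comm, smul_mul_assoc, (cM P).eq, hHP,
        mul_assoc]
      module
    · simp only [coproduct_smul, hM, tens_smul, smul_tens, smul_add]
  have hKH : K * H - H * K = I • P - (I * c₂ / 2) • M ^ 2 := by
    have hKP' : K * P = P * K + I • M := by rw [← hKP]; abel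
    refine eq_of_coproduct (L := 1) (R := 1) (T := -(I * c₂) • M ⊠ M) ?_ ?_ (hD.values_KH.agree ?_)
    · have e : H * (P * P) = P * P * H := by rw [← mul_assoc, hHP, mul_assoc, hHP, ← mul_assoc]
      simp only [coproduct_sub, coproduct_mul, hK, hH, add_mul, mul_add, tens_mul_tens, one_mul,
        mul_one, sub_tens, tens_sub, smul_tens, mul_smul_comm, smul_mul_assoc, hKP', hHP, e,
        (cM K).eq, (cM H).eq, add_tens, mul_assoc]
      module
    · simp only [coproduct_sub, coproduct_smul, hP, pow_two, coproduct_mul, hM, add_mul, mul_add,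
        tens_mul_tens, one_mul, mul_one, sub_tens, tens_sub, smul_tens, tens_smul]
      module
    · have hv := (hD.values_P.smul I).sub ((hD.centralValues hM).sq.smul (I * c₂ / 2)).values
      exact hv.of_eq (by simp) (by simp) (by simp) (by simp) (by simp)
  have SM := antipode_of_primitive hM hD.values_M.1
  have SH : antipode H = -H - c₂ • (P * M) := by
    have := mulAntipode_coproduct H
    rw [hH, hD.values_H.1, zero_smul] at this
    simp only [map_add, smul_tens, map_smul, mulAntipode_tens, one_mul, antipode_one, mul_one,
      SM, dual_mul_neg, dual_smul_neg] at this
    rw [← sub_eq_zero, ← this]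
    module
  refine ⟨M, H, P, K, hD, sub_eq_zero.2 (cM K).eq, hKP, hKH, sub_eq_zero.2 hHP,
    sub_eq_zero.2 (cM P).eq.symm, sub_eq_zero.2 (cM H).eq.symm, hM, ?_, hP, ?_, SM, SH,
    antipode_of_primitive hP vP.1, ?_⟩
  · simp only [Case.formulas, classical, hH, smul_tens]; module
  · simp only [Case.formulas, classical, hK, smul_tens, pow_two]; module
  · have := mulAntipode_coproduct K
    rw [hK, hD.values_K.1, zero_smul] at this
    simp only [map_add, smul_tens, map_smul, mulAntipode_tens, one_mul, antipode_one, mul_one,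
      SM, SH, dual_mul_neg, dual_smul_neg, mul_sub, mul_smul_comm] at this
    simp only [Case.formulas, classical]
    rw [← sub_eq_zero, ← this, pow_two, ← (cM (P * P)).eq]
    simp only [← mul_assoc]
    module

theorem hasDual_case9 (c₁ c₂ c₃ : ℂ) (hc : c₁ ≠ 0) : HasDual (.case9 c₁ c₂ c₃) := by
  let d : LeftData := ⟨-(I * c₁), I * c₃, 0, 0, I * c₂⟩
  obtain ⟨M, H, P, K, hD, hP, hW⟩ := d.exists_functionals (q := .case9 c₁ c₂ c₃) (by
    constructor <;>
      simp only [Case.brackets, d.va, d.vτ, LeftData.vm, d.τm, d.am (zero_mul _), d.τa,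
        LeftData.v_sq, d] <;>
      module)
  have vP := hD.values_P
  have vH := hD.values_H
  have vM := hD.values_M
  -- The translation matrix contains `H`. A primitive functional `H'` with the same values on the
  -- generators is used to write down the matrix; it turns out to be equal to `H`.
  obtain ⟨H', hH', vH'⟩ := exists_primitive (q := .case9 c₁ c₂ c₃) (xm := 0) (xτ := I) (xv := 0)
    (xa := 0) (by constructor <;> simp [Case.brackets, pow_succ])
  have hE := coproduct_exp_smul hP vP.1 c₁
  have SE := antipode_exp_smul hP vP.1 c₁
  have hcP : (c₁ • P) 1 = 0 := by rw [dual_smul_apply, vP.1, mul_zero]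
  have hEE : exp (-c₁ • P) * exp (c₁ • P) = 1 := by
    rw [dual_neg_smul, (filtration _).exp_neg_mul_exp hcP]
  have hEE' : exp (c₁ • P) * exp (-c₁ • P) = 1 := by
    rw [dual_neg_smul, (filtration _).exp_mul_exp_neg hcP]
  have vE : HasValues (exp (c₁ • P)) 1 0 0 0 d.x := by
    have hv : VanishesOnV (c₁ • P) := VanishesOnV.smul ⟨vP.1, vP.4, hD.P_apply_v_sq⟩ _
    exact ⟨(filtration _).exp_apply_one hcP,
      by rw [hv.exp_apply_m, dual_smul_apply, vP.2, mul_zero],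
      by rw [hv.exp_apply_τ, dual_smul_apply, vP.3, mul_zero], hv.exp_apply_v,
      by rw [hv.exp_apply_a, dual_smul_apply, vP.5]; simp [d]; ring⟩
  have vE2 : exp (c₁ • P) (v _ ^ 2) = 0 :=
    (VanishesOnV.smul ⟨vP.1, vP.4, hD.P_apply_v_sq⟩ c₁).exp_apply_v_sq
  have commute_E : ∀ X, X * P = P * X → X * exp (c₁ • P) = exp (c₁ • P) * X := fun X h =>
    (filtration _).commute_exp hcP (Commute.smul_right h _)
  have commute_E' : ∀ X, X * P = P * X → X * exp (-c₁ • P) = exp (-c₁ • P) * X := fun X h =>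
    (filtration _).commute_exp (by rw [dual_smul_apply, vP.1, mul_zero]) (Commute.smul_right h _)
  have hPE := commute_E P rfl
  generalize hE0 : exp (c₁ • P) = E at *
  have vKM : HasValues (c₂ • (H' * E) - c₃ • (P * E)) 0 0 d.t 0 d.y := by
    constructor <;> rw [dual_sub_apply, dual_smul_apply, dual_smul_apply]
    · rw [mul_apply_one, mul_apply_one, vP.1, vH'.1]; ring
    · rw [mul_apply_m, mul_apply_m, vP.1, vP.2, vP.4, vH'.1, vH'.2, vH'.4, vE.3]; ring
    · rw [mul_apply_τ, mul_apply_τ, vP.1, vP.3, vH'.1, vH'.3, vE.1]; simp [d]; ring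
    · rw [mul_apply_v, mul_apply_v, vP.1, vP.4, vH'.1, vH'.4]; ring
    · rw [mul_apply_a, mul_apply_a, vP.1, vP.4, vP.5, vH'.1, vH'.4, vH'.5, vE.1]; simp [d]; ring
  obtain ⟨hM, hH, hK⟩ := hW E 0 (c₂ • (H' * E) - c₃ • (P * E)) 0 (by
    refine ⟨?_, ?_, ?_, ?_, vE, .zero, vKM, .zero⟩ <;>
      simp only [coproduct_smul, coproduct_sub, coproduct_mul, coproduct_zero, hE, hP, hH', add_mul,
        tens_mul_tens, one_mul, tens_smul, smul_tens, sub_tens, tens_sub, tens_zero, zero_tens] <;>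
      module)
  obtain rfl : H = H' := by
    refine eq_of_primitive ?_ hH' (vH.agree vH')
    rw [hH]; simp only [zero_tens, add_zero]
  have hHP : H * P = P * H := by
    refine sub_eq_zero.1 (eq_of_primitive ?_ ?_ (hD.values_HP.agree .zero))
    · simp only [coproduct_sub, coproduct_mul, hH', hP, add_mul, mul_add, tens_mul_tens, one_mul,
        mul_one, sub_tens, tens_sub]
      abel
    · simp only [coproduct_zero, tens_zero, zero_tens, add_zero]
  have hHE := commute_E H hHP
  have hMP : M * P = P * M := by
    refine sub_eq_zero.1 (eq_of_coproduct (L := E) (R := 1) (T := 0) ?_ ?_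
      (((vM.commutator vP hD.M_apply_v_sq hD.P_apply_v_sq).of_eq rfl (by simp) rfl rfl
        (by simp)).agree .zero))
    · simp only [coproduct_sub, coproduct_mul, hM, hP, add_mul, mul_add, tens_mul_tens, one_mul,
        mul_one, sub_tens, tens_sub, hPE]
      abel
    · simp only [coproduct_zero, tens_zero, zero_tens, add_zero]
  have hME := commute_E M hMP
  have hMH : M * H = H * M := by
    refine sub_eq_zero.1 (eq_of_coproduct (L := E) (R := 1) (T := 0) ?_ ?_
      (((vM.commutator vH hD.M_apply_v_sq hD.H_apply_v_sq).of_eq rfl (by simp) rfl rfl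
        (by simp)).agree .zero))
    · simp only [coproduct_sub, coproduct_mul, hM, hH', add_mul, mul_add, tens_mul_tens, one_mul,
        mul_one, sub_tens, tens_sub, hHE]
      abel
    · simp only [coproduct_zero, tens_zero, zero_tens, add_zero]
  have f1 : ∀ X, H * (P * X) = P * (H * X) := fun X => by rw [← mul_assoc, hHP, mul_assoc]
  have f2 : ∀ X, H * (E * X) = E * (H * X) := fun X => by rw [← mul_assoc, hHE, mul_assoc]
  have f3 : ∀ X, P * (E * X) = E * (P * X) := fun X => by rw [← mul_assoc, hPE, mul_assoc]
  have f4 : ∀ X, M * (P * X) = P * (M * X) := fun X => by rw [← mul_assoc, hMP, mul_assoc]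
  have f5 : ∀ X, M * (E * X) = E * (M * X) := fun X => by rw [← mul_assoc, hME, mul_assoc]
  have f6 : ∀ X, M * (H * X) = H * (M * X) := fun X => by rw [← mul_assoc, hMH, mul_assoc]
  have hKP : K * P - P * K = I • M := by
    refine eq_of_coproduct (L := E) (R := 1) (T := 0) ?_ ?_ (hD.values_KP.agree
      ((hD.values_M.smul I).of_eq (by simp) (by simp) (by simp) (by simp) (by simp)))
    · simp only [coproduct_sub, coproduct_mul, hK, hP, add_mul, mul_add, sub_mul, mul_sub,
        tens_mul_tens, one_mul, mul_one, sub_tens, tens_sub, smul_tens, mul_smul_comm,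
        smul_mul_assoc, mul_assoc, zero_tens, add_zero, hPE, hMP, hHE, hHP,
        f3]
      module
    · simp only [coproduct_smul, hM, tens_smul, smul_tens, smul_add, add_zero]
  have hKH : K * H - H * K = -(I / c₁) • (1 - E) := by
    refine eq_of_coproduct (L := E) (R := 1) (T := 0) ?_ ?_ (hD.values_KH.agree ?_)
    · simp only [coproduct_sub, coproduct_mul, hK, hH', add_mul, mul_add, sub_mul, mul_sub,
        tens_mul_tens, one_mul, mul_one, sub_tens, tens_sub, smul_tens, mul_smul_comm,
        smul_mul_assoc, mul_assoc, zero_tens, add_zero, hHE, hMH, f1,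
        f2, f3]
      module
    · simp only [coproduct_smul, coproduct_sub, coproduct_one, hE, tens_smul, smul_tens, tens_sub,
        sub_tens]
      module
    · refine ((HasValues.one.sub vE).smul _).of_eq (by simp) (by simp) (by simp) (by simp) ?_
      simp only [d]
      field_simp
      linear_combination (-c₁) * Complex.I_sq
  have hKE : K * E = E * K + (I * c₁) • (E * M) := by
    suffices h : K * E - E * K = (I * c₁) • (E * M) by rw [← h]; abel
    refine eq_of_coproduct (L := E * E) (R := E) (T := 0) ?_ ?_
      ((hD.values_K.commutator vE hD.K_apply_v_sq vE2).agree ?_)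
    · simp only [coproduct_sub, coproduct_mul, hK, hE, add_mul, mul_add, sub_mul, mul_sub,
        tens_mul_tens, one_mul, mul_one, sub_tens, tens_sub, smul_tens, mul_smul_comm,
        smul_mul_assoc, mul_assoc, zero_tens, add_zero, hPE, hME, hHE]
      module
    · simp only [coproduct_smul, coproduct_mul, hM, hE, mul_add, tens_mul_tens, tens_smul,
        smul_tens, mul_one]
      module
    · constructor <;> rw [dual_smul_apply]
      · rw [mul_apply_one, vM.1]; ring
      · rw [mul_apply_m, vM.1, vM.2, vE.1, vE.4, vE2]; simp [d]; ring
      · rw [mul_apply_τ, vM.1, vM.3]; ring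
      · rw [mul_apply_v, vM.1, vM.4]; ring
      · rw [mul_apply_a, vM.1, vM.3, vM.5]; simp
  have hKM : K * M - M * K = (I * c₁ / 2) • M ^ 2 := by
    refine eq_of_coproduct (L := E * E) (R := 1) (T := (I * c₁) • (E * M) ⊠ M) ?_ ?_
      ((hD.values_K.commutator vM hD.K_apply_v_sq hD.M_apply_v_sq).agree ?_)
    · simp only [coproduct_sub, coproduct_mul, hK, hM, add_mul, mul_add, sub_mul, mul_sub,
        tens_mul_tens, one_mul, mul_one, sub_tens, tens_sub, smul_tens, mul_smul_comm,
        smul_mul_assoc, mul_assoc, zero_tens, add_zero, hPE, hME, hHE,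
        f5, hMP, hMH, hKE, add_tens]
      module
    · simp only [coproduct_smul, pow_two, coproduct_mul, hM, mul_add, add_mul, tens_mul_tens,
        tens_smul, smul_tens, mul_one, one_mul, hME]
      module
    · rw [pow_two]
      constructor <;> rw [dual_smul_apply]
      · rw [mul_apply_one, vM.1]; ring
      · rw [mul_apply_m, vM.1, vM.4, vM.5, hD.M_apply_v_sq]; simp
      · rw [mul_apply_τ, vM.1]; ring
      · rw [mul_apply_v, vM.1]; ring
      · rw [mul_apply_a, vM.1, vM.3, vM.4]; simp
  have SM : antipode M = -(M * exp (-c₁ • P)) := by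
    have := mulAntipode_coproduct M
    rw [hM, vM.1, zero_smul, map_add, mulAntipode_tens, mulAntipode_tens, antipode_one,
      mul_one] at this
    calc antipode M = exp (-c₁ • P) * (E * antipode M) := by rw [← mul_assoc, hEE, one_mul]
      _ = _ := by rw [eq_neg_of_add_eq_zero_left this, dual_mul_neg, commute_E' M hMP]
  refine ⟨M, H, P, K, hD, hKM, hKP, ?_, sub_eq_zero.2 hHP, sub_eq_zero.2 hMP, sub_eq_zero.2 hMH,
    ?_, hH', hP, ?_, SM, antipode_of_primitive hH' vH.1, antipode_of_primitive hP vP.1, ?_⟩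
  · simp only [Case.formulas, hE0]
    exact hKH
  · simp only [Case.formulas, hE0]
    exact hM
  · simp only [Case.formulas, hE0, hK, sub_tens, smul_tens, zero_tens, add_zero]
    module
  · have := mulAntipode_coproduct K
    rw [hK, hD.values_K.1, zero_smul] at this
    simp only [map_add, mulAntipode_tens, antipode_one, mul_one, SM, dual_mul_neg, zero_tens,
      add_zero] at this
    have e1 : exp (-c₁ • P) * (c₂ • (H * E) - c₃ • (P * E)) * (M * exp (-c₁ • P)) =
        c₂ • (H * M * exp (-c₁ • P)) - c₃ • (P * M * exp (-c₁ • P)) := by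
      have g1 : ∀ X, exp (-c₁ • P) * (E * X) = X := fun X => by rw [← mul_assoc, hEE, one_mul]
      simp only [hHE, hPE, mul_sub, sub_mul, mul_smul_comm, smul_mul_assoc, mul_assoc, g1]
    simp only [Case.formulas]
    have e2 : E * antipode K = (c₂ • (H * E) - c₃ • (P * E)) * (M * exp (-c₁ • P)) - K := by
      rw [← sub_eq_zero, ← this]; abel
    calc antipode K = exp (-c₁ • P) * (E * antipode K) := by rw [← mul_assoc, hEE, one_mul]
      _ = _ := by rw [e2, mul_sub, ← mul_assoc, e1]; abel
variable {q : Case}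

/-! ### The antipode of products and of power series -/

section Antipode

variable (q) in
/-- The linear map `x ⊗ y ↦ S y ⊗ S x`. -/
def swapAntipode : QGalilei q ⊗[ℂ] QGalilei q →ₗ[ℂ] QGalilei q ⊗[ℂ] QGalilei q :=
  TensorProduct.map (antipodeLin q) (antipodeLin q) ∘ₗ (TensorProduct.comm ℂ _ _).toLinearMap

theorem swapAntipode_tmul (x y : QGalilei q) :
    swapAntipode q (x ⊗ₜ y) = antipodeLin q y ⊗ₜ antipodeLin q x := rfl

theorem swapAntipode_mul (z w : QGalilei q ⊗[ℂ] QGalilei q) :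
    swapAntipode q (z * w) = swapAntipode q w * swapAntipode q z := by
  induction z with
  | zero => simp
  | add a b ha hb => simp only [add_mul, map_add, mul_add, ha, hb]
  | tmul x y =>
    induction w with
    | zero => simp
    | add a b ha hb => simp only [add_mul, map_add, mul_add, ha, hb]
    | tmul x' y' =>
      simp only [swapAntipode_tmul, Algebra.TensorProduct.tmul_mul_tmul, antipodeLin_mul]

/-- The antipode is an anti-homomorphism of coalgebras. -/
theorem comul_antipodeLin (x : QGalilei q) :
    Coalgebra.comul (R := ℂ) (antipodeLin q x) = swapAntipode q (Coalgebra.comul (R := ℂ) x) := by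
  have hvτ : v q * τ q = τ q * v q := sub_eq_zero.1 (holds q).vτ
  have hv2 : antipodeLin q (v q ^ 2) = v q ^ 2 := by
    rw [pow_two, antipodeLin_mul, antipodeLin_v, neg_mul_neg]
  induction x using QGalilei.induction with
  | hm =>
    rw [comul_m, TensorProduct.smul_tmul', antipodeLin_m]
    simp only [map_add, map_sub, map_neg, map_smul, Bialgebra.comul_mul, comul_m, comul_v_sq,
      comul_τ, comul_v, comul_a, swapAntipode_tmul, antipodeLin_m, antipodeLin_v, antipodeLin_τ,
      antipodeLin_a, antipodeLin_one, hv2, TensorProduct.smul_tmul', TensorProduct.tmul_add,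
      TensorProduct.add_tmul, TensorProduct.tmul_sub, TensorProduct.sub_tmul,
      TensorProduct.tmul_neg, TensorProduct.neg_tmul, TensorProduct.tmul_smul, add_mul, mul_add,
      smul_mul_assoc, Algebra.TensorProduct.tmul_mul_tmul, one_mul, mul_one]
    simp only [hvτ, ← pow_two, ← TensorProduct.smul_tmul']
    module
  | hτ => simp [comul_τ, swapAntipode_tmul, TensorProduct.neg_tmul, TensorProduct.tmul_neg]
  | hv => simp [comul_v, swapAntipode_tmul, TensorProduct.neg_tmul, TensorProduct.tmul_neg]
  | ha =>
    simp [comul_a, comul_v, comul_τ, swapAntipode_tmul, TensorProduct.neg_tmul,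
      TensorProduct.tmul_neg, TensorProduct.tmul_add, TensorProduct.add_tmul, add_mul, mul_add]
    abel
  | hc c =>
    rw [antipodeLin_algebraMap, Bialgebra.comul_algebraMap,
      Algebra.TensorProduct.algebraMap_apply, swapAntipode_tmul, antipodeLin_algebraMap,
      antipodeLin_one, Algebra.algebraMap_eq_smul_one, TensorProduct.tmul_smul,
      TensorProduct.smul_tmul']
  | hadd x y hx hy => simp only [map_add, hx, hy]
  | hmul x y hx hy =>
    rw [antipodeLin_mul, Bialgebra.comul_mul, Bialgebra.comul_mul, swapAntipode_mul, hx, hy]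

/-- The antipode of the dual reverses products. -/
theorem antipode_mul (X Y : Dual (QGalilei q)) : antipode (X * Y) = antipode Y * antipode X := by
  refine dual_ext fun φ => ?_
  have h : ∀ z, (X ⊠ Y) (swapAntipode q z) = (antipode Y ⊠ antipode X) z := by
    intro z
    induction z with
    | zero => simp
    | tmul x y => rw [swapAntipode_tmul, tens_tmul, tens_tmul, mul_comm]; rfl
    | add a b ha hb => simp only [map_add, ha, hb]
  rw [dual_mul_apply, ← h, ← comul_antipodeLin, ← dual_mul_apply]
  rfl

theorem antipode_pow (X : Dual (QGalilei q)) (n : ℕ) : antipode (X ^ n) = antipode X ^ n := by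
  induction n with
  | zero => simp [antipode_one]
  | succ n ih => rw [pow_succ, antipode_mul, ih, pow_succ']

theorem antipode_series (f : ℕ → ℂ) {X : Dual (QGalilei q)} (hX : X 1 = 0) :
    antipode (series f X) = series f (antipode X) := by
  refine dual_ext fun φ => ?_
  rw [series_pullback f ((filtration q).locallyNilpotent hX) (HopfAlgebra.antipode ℂ)
    fun n φ => by rw [← antipode_pow]; rfl]
  rfl

end Antipode

/-! ### Operators of translation -/

section Translation

/-- The translation `X ↦ X ∘ ℓ` of functionals by a linear map. -/
def pull (ℓ : QGalilei q →ₗ[ℂ] QGalilei q) : Dual (QGalilei q) →ₗ[ℂ] Dual (QGalilei q) where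
  toFun X := .toConv (X.ofConv ∘ₗ ℓ)
  map_add' _ _ := rfl
  map_smul' _ _ := rfl

theorem pull_apply (ℓ : QGalilei q →ₗ[ℂ] QGalilei q) (X : Dual (QGalilei q)) (φ : QGalilei q) :
    pull ℓ X φ = X (ℓ φ) := rfl

theorem continuous_pull_mulRight (x : QGalilei q) (k : ℕ) : ∃ N, ∀ X ∈ (filtration q).J N,
    pull (LinearMap.mulRight ℂ x) X ∈ (filtration q).J k := by
  obtain ⟨j, hj⟩ := WordFiltration.exists x
  exact ⟨k + j, fun X hX φ hφ => hX _ (WordFiltration.mul hφ hj)⟩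

theorem continuous_pull_mulLeft (x : QGalilei q) (k : ℕ) : ∃ N, ∀ X ∈ (filtration q).J N,
    pull (LinearMap.mulLeft ℂ x) X ∈ (filtration q).J k := by
  obtain ⟨j, hj⟩ := WordFiltration.exists x
  exact ⟨j + k, fun X hX φ hφ => hX _ (WordFiltration.mul hj hφ)⟩

theorem tens_mul_tmul (X Y : Dual (QGalilei q)) (z : QGalilei q ⊗[ℂ] QGalilei q)
    (x y : QGalilei q) : (X ⊠ Y) (z * x ⊗ₜ y) =
      (pull (LinearMap.mulRight ℂ x) X ⊠ pull (LinearMap.mulRight ℂ y) Y) z := by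
  induction z with
  | zero => simp
  | tmul x' y' => rw [Algebra.TensorProduct.tmul_mul_tmul, tens_tmul, tens_tmul]; rfl
  | add z w hz hw => rw [add_mul, map_add, map_add, hz, hw]

theorem tens_tmul_mul (X Y : Dual (QGalilei q)) (z : QGalilei q ⊗[ℂ] QGalilei q)
    (x y : QGalilei q) : (X ⊠ Y) (x ⊗ₜ y * z) =
      (pull (LinearMap.mulLeft ℂ x) X ⊠ pull (LinearMap.mulLeft ℂ y) Y) z := by
  induction z with
  | zero => simp
  | tmul x' y' => rw [Algebra.TensorProduct.tmul_mul_tmul, tens_tmul, tens_tmul]; rfl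
  | add z w hz hw => rw [mul_add, map_add, map_add, hz, hw]

theorem pull_mulRight_one (X : Dual (QGalilei q)) : pull (LinearMap.mulRight ℂ 1) X = X :=
  dual_ext fun φ => by rw [pull_apply, LinearMap.mulRight_apply, mul_one]

theorem pull_mulLeft_one (X : Dual (QGalilei q)) : pull (LinearMap.mulLeft ℂ 1) X = X :=
  dual_ext fun φ => by rw [pull_apply, LinearMap.mulLeft_apply, one_mul]

theorem one_mulRight {x : QGalilei q} (hx : (1 : Dual (QGalilei q)) x = 0) :
    pull (LinearMap.mulRight ℂ x) 1 = 0 := dual_ext fun φ => by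
  rw [pull_apply, LinearMap.mulRight_apply, dual_one_apply, Bialgebra.counit_mul,
    ← dual_one_apply x, hx, mul_zero, dual_zero_apply]

theorem one_mulLeft {x : QGalilei q} (hx : (1 : Dual (QGalilei q)) x = 0) :
    pull (LinearMap.mulLeft ℂ x) 1 = 0 := dual_ext fun φ => by
  rw [pull_apply, LinearMap.mulLeft_apply, dual_one_apply, Bialgebra.counit_mul, ← dual_one_apply x,
    hx, zero_mul, dual_zero_apply]

variable (X Y : Dual (QGalilei q))

theorem mulRight_τ_mul : pull (LinearMap.mulRight ℂ (τ q)) (X * Y) =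
    pull (LinearMap.mulRight ℂ (τ q)) X * Y + X * pull (LinearMap.mulRight ℂ (τ q)) Y := by
  refine dual_ext fun φ => ?_
  rw [pull_apply, LinearMap.mulRight_apply, dual_mul_apply, Bialgebra.comul_mul, comul_τ, mul_add,
    map_add, tens_mul_tmul, tens_mul_tmul, pull_mulRight_one, pull_mulRight_one, dual_add_apply,
    dual_mul_apply, dual_mul_apply]

theorem mulRight_v_mul : pull (LinearMap.mulRight ℂ (v q)) (X * Y) =
    pull (LinearMap.mulRight ℂ (v q)) X * Y + X * pull (LinearMap.mulRight ℂ (v q)) Y := by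
  refine dual_ext fun φ => ?_
  rw [pull_apply, LinearMap.mulRight_apply, dual_mul_apply, Bialgebra.comul_mul, comul_v, mul_add,
    map_add, tens_mul_tmul, tens_mul_tmul, pull_mulRight_one, pull_mulRight_one, dual_add_apply,
    dual_mul_apply, dual_mul_apply]

variable {X}

theorem mulRight_v_pow (hX : pull (LinearMap.mulRight ℂ (v q)) X = 0) (n : ℕ) :
    pull (LinearMap.mulRight ℂ (v q)) (X ^ n) = 0 := by
  induction n with
  | zero => rw [pow_zero, one_mulRight one_apply_v]
  | succ n ih => rw [pow_succ, mulRight_v_mul, hX, ih, zero_mul, mul_zero, add_zero]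

theorem mulRight_v_series (hX : pull (LinearMap.mulRight ℂ (v q)) X = 0) (h1 : X 1 = 0)
    (f : ℕ → ℂ) : pull (LinearMap.mulRight ℂ (v q)) (series f X) = 0 := by
  refine dual_ext fun φ => ?_
  rw [pull_apply, LinearMap.mulRight_apply, series_apply f ((filtration q).locallyNilpotent h1),
    dual_zero_apply]
  refine finsum_eq_zero_of_forall_eq_zero fun n => ?_
  have := congrArg (fun Z : Dual (QGalilei q) => Z φ) (mulRight_v_pow hX n)
  simp only [pull_apply, LinearMap.mulRight_apply, dual_zero_apply] at this
  rw [this, mul_zero]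

/-- The right translation by `a` is a derivation on the functionals that are killed by the
translation by `v`. -/
theorem mulRight_a_mul (hX : pull (LinearMap.mulRight ℂ (v q)) X = 0) :
    pull (LinearMap.mulRight ℂ (a q)) (X * Y) =
    pull (LinearMap.mulRight ℂ (a q)) X * Y + X * pull (LinearMap.mulRight ℂ (a q)) Y := by
  refine dual_ext fun φ => ?_
  rw [pull_apply, LinearMap.mulRight_apply, dual_mul_apply, Bialgebra.comul_mul, comul_a, mul_add,
    mul_add, map_add, map_add, tens_mul_tmul, tens_mul_tmul, tens_mul_tmul, hX, pull_mulRight_one,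
    pull_mulRight_one, zero_tens, dual_add_apply, dual_mul_apply, dual_mul_apply, dual_zero_apply,
    add_zero]

/-- The left translation by `m` is a derivation on the functionals that are killed by the
translation by `v`. -/
theorem mulLeft_m_mul (hX : pull (LinearMap.mulLeft ℂ (v q)) X = 0) :
    pull (LinearMap.mulLeft ℂ (m q)) (X * Y) =
    pull (LinearMap.mulLeft ℂ (m q)) X * Y + X * pull (LinearMap.mulLeft ℂ (m q)) Y := by
  have hX2 : pull (LinearMap.mulLeft ℂ (v q ^ 2)) X = 0 := dual_ext fun φ => by
    have := congrArg (fun Z : Dual (QGalilei q) => Z (v q * φ)) hX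
    simpa only [pull_apply, LinearMap.mulLeft_apply, pow_two, mul_assoc, dual_zero_apply] using this
  refine dual_ext fun φ => ?_
  rw [pull_apply, LinearMap.mulLeft_apply, dual_mul_apply, Bialgebra.comul_mul, comul_m, sub_mul,
    sub_mul, add_mul, smul_mul_assoc, map_sub, map_sub, map_add, map_smul, tens_tmul_mul,
    tens_tmul_mul, tens_tmul_mul, tens_tmul_mul, hX, hX2, pull_mulLeft_one, pull_mulLeft_one,
    zero_tens, zero_tens, dual_add_apply, dual_mul_apply, dual_mul_apply, dual_zero_apply,
    smul_zero, sub_zero, sub_zero]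

end Translation

/-- The logarithmic derivative: a continuous linear operator that acts as a derivation on the powers
of `Y` and maps `Y` to `(1 - Y) * W`, with commuting `W`. -/
theorem derivation_logOneSub (δ : Dual (QGalilei q) →ₗ[ℂ] Dual (QGalilei q))
    (hδ : ∀ k, ∃ N, ∀ X ∈ (filtration q).J N, δ X ∈ (filtration q).J k)
    {Y W : Dual (QGalilei q)} (hY : Y 1 = 0) (h1 : δ 1 = 0) (hW : Commute Y W)
    (hpow : ∀ n : ℕ, δ (Y ^ (n + 1)) = δ (Y ^ n) * Y + Y ^ n * δ Y) (hYW : δ Y = (1 - Y) * W) :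
    δ (logOneSub Y) = -W := by
  have hc : Commute Y (δ Y) := hYW ▸ ((Commute.one_right Y).sub_right (Commute.refl Y)).mul_right hW
  have hn : ∀ n : ℕ, δ (Y ^ (n + 1)) = ((n : ℂ) + 1) • (Y ^ n * δ Y) := by
    intro n
    induction n with
    | zero => rw [hpow, pow_zero, h1, zero_mul, zero_add]; simp
    | succ n ih =>
      rw [hpow, ih, smul_mul_assoc, mul_assoc, ← hc.eq, ← mul_assoc, ← pow_succ]
      push_cast
      module
  have hs := (filtration q).map_series δ hδ hY h1 hn fun n => if n = 0 then 0 else -(1 / (n : ℂ))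
  have hf : (fun n : ℕ => ((n : ℂ) + 1) * if n + 1 = 0 then 0 else -(1 / ((n + 1 : ℕ) : ℂ))) =
      fun _ => -1 := by
    funext n
    have : (n : ℂ) + 1 ≠ 0 := Nat.cast_add_one_ne_zero n
    rw [if_neg n.succ_ne_zero]
    push_cast
    field_simp
  rw [hf] at hs
  have hneg : series (fun _ => (-1 : ℂ)) Y = -invOneSub Y := by
    have hl := (filtration q).locallyNilpotent hY
    refine dual_ext fun φ => ?_
    rw [series_apply _ hl, dual_neg_apply, invOneSub, series_apply _ hl, ← finsum_neg_distrib]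
    simp
  rw [logOneSub, hs, hneg, hYW, ← mul_assoc, dual_neg_mul, (filtration q).invOneSub_mul_one_sub hY,
    dual_neg_mul, one_mul]

/-! ### The case that contains the coordinates of `SL₂` -/

section Monomials
variable {q : Case}

theorem pull_mulRight_pow (x : QGalilei q) (n : ℕ) (X : Dual (QGalilei q)) :
    (pull (LinearMap.mulRight ℂ x) ^ n) X = pull (LinearMap.mulRight ℂ (x ^ n)) X := by
  induction n with
  | zero => rw [pow_zero, pow_zero, pull_mulRight_one, Module.End.one_apply]
  | succ n ih =>
    refine dual_ext fun φ => ?_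
    rw [pow_succ', Module.End.mul_apply, ih]
    simp only [pull_apply, LinearMap.mulRight_apply, pow_succ', mul_assoc]

theorem pull_mulLeft_pow (x : QGalilei q) (n : ℕ) (X : Dual (QGalilei q)) :
    (pull (LinearMap.mulLeft ℂ x) ^ n) X = pull (LinearMap.mulLeft ℂ (x ^ n)) X := by
  induction n with
  | zero => rw [pow_zero, pow_zero, pull_mulLeft_one, Module.End.one_apply]
  | succ n ih =>
    refine dual_ext fun φ => ?_
    rw [pow_succ', Module.End.mul_apply, ih]
    simp only [pull_apply, LinearMap.mulLeft_apply, pow_succ, mul_assoc]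

/-- The value at a monomial by iterated translations. -/
theorem apply_monomial (X : Dual (QGalilei q)) (α β γ σ : ℕ) : X (monomial q α β γ σ) =
    ((pull (LinearMap.mulLeft ℂ (m q)) ^ α) ((pull (LinearMap.mulRight ℂ (τ q)) ^ β)
      ((pull (LinearMap.mulRight ℂ (v q)) ^ σ) ((pull (LinearMap.mulRight ℂ (a q)) ^ γ) X)))) 1
        := by
  simp only [pull_mulRight_pow, pull_mulLeft_pow, pull_apply, LinearMap.mulRight_apply,
    LinearMap.mulLeft_apply, mul_one, monomial]

end Monomials

section SpecialLinear
variable {c : ℂ}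

open Matrix (single)

variable (c) in
/-- A representation in which `v` acts by zero. Given the shape of `m` and `τ`, the matrix of `a`
and the product of the entries of `m` and `τ` are forced by the relations; the entry `1` of `m` is a
normalization. -/
theorem holds_special_linear : (Case.case16 c).Holds (single 0 1 1 : Matrix (Fin 2) (Fin 2) ℂ)
    (single 1 0 (-(c ^ 2 / 2))) 0 (single 0 0 (-(I * c / 2)) + single 1 1 (I * c / 2)) := by
  constructor <;> ext i j <;> fin_cases i <;> fin_cases j <;>
    simp [Case.brackets, Matrix.mul_apply, Matrix.single_apply] <;>
    first
      | ring1
      | linear_combination (exp := 1) (c ^ 2 / 2) * Complex.I_sq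
      | linear_combination (exp := 1) (-c ^ 2 / 2) * Complex.I_sq

/-- The properties of the coefficients `A`, `B`, `C`, `D` of a two-dimensional representation of the
algebra in which `v` acts by zero: coproducts, values on the generators, translations by the
generators (`vA` and similar are right translations, `mB` and similar are left translations), and
the relations of the coordinates of `SL₂`. -/
structure SLCoordinates (A B C D : Dual (QGalilei (.case16 c))) : Prop where
  ΔA : coproduct A = A ⊠ A + B ⊠ C
  ΔB : coproduct B = A ⊠ B + B ⊠ D
  ΔC : coproduct C = C ⊠ A + D ⊠ C
  ΔD : coproduct D = C ⊠ B + D ⊠ D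
  values_A : HasValues A 1 0 0 0 (-(I * c / 2))
  values_B : HasValues B 0 1 0 0 0
  values_C : HasValues C 0 0 (-(c ^ 2 / 2)) 0 0
  values_D : HasValues D 1 0 0 0 (I * c / 2)
  vA : pull (LinearMap.mulRight ℂ (v _)) A = 0
  vB : pull (LinearMap.mulRight ℂ (v _)) B = 0
  vC : pull (LinearMap.mulRight ℂ (v _)) C = 0
  vD : pull (LinearMap.mulRight ℂ (v _)) D = 0
  aB : pull (LinearMap.mulRight ℂ (a _)) B = (I * c / 2) • B
  aC : pull (LinearMap.mulRight ℂ (a _)) C = -(I * c / 2) • C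
  aD : pull (LinearMap.mulRight ℂ (a _)) D = (I * c / 2) • D
  τB : pull (LinearMap.mulRight ℂ (τ _)) B = 0
  τC : pull (LinearMap.mulRight ℂ (τ _)) C = -(c ^ 2 / 2) • D
  τD : pull (LinearMap.mulRight ℂ (τ _)) D = 0
  mB : pull (LinearMap.mulLeft ℂ (m _)) B = D
  mC : pull (LinearMap.mulLeft ℂ (m _)) C = 0
  mD : pull (LinearMap.mulLeft ℂ (m _)) D = 0
  AB : A * B = B * A
  AC : A * C = C * A
  AD : A * D = D * A
  BC : B * C = C * B
  BD : B * D = D * B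
  CD : C * D = D * C
  det : A * D - B * C = 1

variable (c) in
/-- The products of the coefficients in both orders, and the determinant and `1`, are multiplicative
matrices of functionals that agree on the generators. Hence the coefficients commute and the
determinant is `1`, although the algebra is not cocommutative. -/
theorem exists_slCoordinates : ∃ A B C D : Dual (QGalilei (.case16 c)), SLCoordinates A B C D := by
  set ρ := lift (holds_special_linear c) with hρ
  set T := coefficient ρ with hT
  have hΔ : ∀ i j, coproduct (T i j) = ∑ k, T i k ⊠ T k j := coproduct_coefficient ρ
  have hval : ∀ i j, HasValues (T i j) ((1 : Matrix (Fin 2) (Fin 2) ℂ) i j)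
      ((single 0 1 1 : Matrix (Fin 2) (Fin 2) ℂ) i j)
      ((single 1 0 (-(c ^ 2 / 2)) : Matrix (Fin 2) (Fin 2) ℂ) i j) 0
      ((single 0 0 (-(I * c / 2)) + single 1 1 (I * c / 2) : Matrix (Fin 2) (Fin 2) ℂ) i j) := by
    intro i j
    constructor <;> simp only [hT, coefficient_apply, map_one, hρ, lift_m, lift_τ, lift_v, lift_a,
      Matrix.zero_apply]
  have hv2 : ∀ i j, T i j (v _ ^ 2) = 0 := by
    intro i j
    simp [hT, coefficient_apply, hρ]
  have hR : ∀ x i j, pull (LinearMap.mulRight ℂ x) (T i j) = ∑ k, ρ x k j • T i k := by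
    intro x i j
    refine dual_ext fun φ => ?_
    rw [Fin.sum_univ_two]
    simp only [pull_apply, LinearMap.mulRight_apply, hT, coefficient_apply, map_mul,
      Matrix.mul_apply, Fin.sum_univ_two, dual_add_apply, dual_smul_apply]
    ring
  have hL : ∀ x i j, pull (LinearMap.mulLeft ℂ x) (T i j) = ∑ k, ρ x i k • T k j := by
    intro x i j
    refine dual_ext fun φ => ?_
    rw [Fin.sum_univ_two]
    simp only [pull_apply, LinearMap.mulLeft_apply, hT, coefficient_apply, map_mul,
      Matrix.mul_apply, Fin.sum_univ_two, dual_add_apply, dual_smul_apply]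
  have hmul : ∀ i j k l, HasValues (T i j * T k l) _ _ _ _ _ := fun i j k l =>
    ⟨mul_apply_one _ _, mul_apply_m _ _, mul_apply_τ _ _, mul_apply_v _ _, mul_apply_a _ _⟩
  have hcom : ∀ i j k l, T i j * T k l = T k l * T i j := by
    intro i j k l
    refine eq_of_multiplicative (ι := Fin 2 × Fin 2) (W := fun p r => T p.1 r.1 * T p.2 r.2)
      (W' := fun p r => T p.2 r.2 * T p.1 r.1) ?_ ?_ ?_ (i, k) (j, l)
    · intro p r
      simp only [coproduct_mul, hΔ, Finset.sum_mul_sum, tens_mul_tens, Fintype.sum_prod_type]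
    · intro p r
      simp only [coproduct_mul, hΔ, Finset.sum_mul_sum, tens_mul_tens, Fintype.sum_prod_type]
      rw [Finset.sum_comm]
    · intro p r
      refine (hmul _ _ _ _).agree ((hmul _ _ _ _).of_eq ?_ ?_ ?_ ?_ ?_) <;>
        simp only [(hval _ _).1, (hval _ _).2, (hval _ _).3, (hval _ _).4, (hval _ _).5, hv2] <;>
        ring
  have hdet : T 0 0 * T 1 1 - T 0 1 * T 1 0 = 1 := by
    refine eq_of_multiplicative (ι := Unit) (W := fun _ _ => T 0 0 * T 1 1 - T 0 1 * T 1 0)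
      (W' := fun _ _ => 1) ?_ (by simp [coproduct_one]) ?_ () ()
    · intro _ _
      simp only [coproduct_sub, coproduct_mul, hΔ, Fin.sum_univ_two, Finset.univ_unique,
        Finset.sum_singleton, add_mul, mul_add, tens_mul_tens, sub_tens, tens_sub]
      rw [hcom 0 1 0 0, hcom 1 0 0 1, hcom 1 1 0 0, hcom 1 1 1 0]
      abel
    · intro _ _
      refine (((hmul _ _ _ _).sub (hmul _ _ _ _)).of_eq ?_ ?_ ?_ ?_ ?_).agree .one <;>
        simp [(hval _ _).1, (hval _ _).2, (hval _ _).3, (hval _ _).4, (hval _ _).5, hv2]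
  refine ⟨T 0 0, T 0 1, T 1 0, T 1 1, ?_⟩
  constructor
  case det => exact hdet
  all_goals first
    | exact hcom _ _ _ _
    | simpa [Fin.sum_univ_two] using hΔ _ _
    | (refine (hval _ _).of_eq ?_ ?_ ?_ ?_ ?_ <;> simp)
    | (rw [hR]; simp [hρ, Fin.sum_univ_two])
    | (rw [hL]; simp [hρ, Fin.sum_univ_two])

end SpecialLinear

section SpecialLinear
variable {c : ℂ} {A B C D E P : Dual (QGalilei (.case16 c))}

/-- The generator `v` is central. -/
theorem mulLeft_v_eq (X : Dual (QGalilei (.case16 c))) :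
    pull (LinearMap.mulLeft ℂ (v _)) X = pull (LinearMap.mulRight ℂ (v _)) X := by
  obtain ⟨hva, hvm, -, -, -, hvτ⟩ := holds (.case16 c)
  simp only [Case.brackets, sub_eq_zero] at hva hvm hvτ
  refine dual_ext fun φ => congrArg X.ofConv ?_
  change v _ * φ = φ * v _
  induction φ using QGalilei.induction with
  | hm => exact hvm
  | hτ => exact hvτ
  | hv => rfl
  | ha => exact hva
  | hc c => exact (Algebra.commutes c _).symm
  | hadd x y hx hy => rw [mul_add, add_mul, hx, hy]
  | hmul x y hx hy => rw [← mul_assoc, hx, mul_assoc, hy, mul_assoc]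

/-- The properties of the functional `P = -(2 / c) log D` and of the inverse `E` of `D`. The field
`derivation` is the formula for the logarithmic derivative: if `δ D = D W`, where `W` commutes with
`D`, then `δ P = -(2 / c) W`. -/
structure LogCoordinate (D P E : Dual (QGalilei (.case16 c))) : Prop where
  apply_one : P 1 = 0
  exp_neg_half : exp (-(c / 2) • P) = D
  exp_half : exp ((c / 2) • P) = E
  exp_pos : exp (c • P) = E * E
  exp_neg : exp (-c • P) = D * D
  DE : D * E = 1
  ED : E * D = 1
  commute_P : ∀ X, X * D = D * X → X * P = P * X
  commute_E : ∀ X, X * D = D * X → X * E = E * X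
  commute_coproduct : ∀ X, X * coproduct D = coproduct D * X → X * coproduct P = coproduct P * X
  commute_antipode : ∀ X, X * antipode D = antipode D * X → X * antipode P = antipode P * X
  vP : pull (LinearMap.mulRight ℂ (v _)) P = 0
  vE : pull (LinearMap.mulRight ℂ (v _)) E = 0
  derivation : ∀ δ : Dual (QGalilei (.case16 c)) →ₗ[ℂ] Dual (QGalilei (.case16 c)),
    (∀ k, ∃ N, ∀ X ∈ (filtration _).J N, δ X ∈ (filtration _).J k) → δ 1 = 0 →
    (∀ n : ℕ, δ ((1 - D) ^ (n + 1)) = δ ((1 - D) ^ n) * (1 - D) + (1 - D) ^ n * δ (1 - D)) →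
    ∀ W, W * D = D * W → δ D = D * W → δ P = -(2 / c) • W

/-- The logarithm of `D` is the power series of `log (1 - Y)` in `Y = 1 - D`, which vanishes at the
unit. -/
theorem SLCoordinates.exists_log (h : SLCoordinates A B C D) (hc : c ≠ 0) :
    ∃ P E, LogCoordinate D P E := by
  have hY : (1 - D) 1 = 0 := by rw [dual_sub_apply, one_apply_one, h.values_D.1, sub_self]
  have hL := (filtration _).logOneSub_apply_one hY
  have hexp := (filtration _).exp_logOneSub hY
  rw [sub_sub_cancel] at hexp
  have hcom : ∀ X, X * D = D * X → Commute X (logOneSub (1 - D)) := fun X hX =>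
    (filtration _).commute_series _ hY ((Commute.one_right X).sub_right hX)
  have e1 : (c / 2) • -(2 / c) • logOneSub (1 - D) = -logOneSub (1 - D) := by
    rw [smul_smul, show c / 2 * -(2 / c) = -1 by field_simp]; module
  have e2 : -(c / 2) • -(2 / c) • logOneSub (1 - D) = logOneSub (1 - D) := by
    rw [dual_neg_smul, e1, dual_neg_neg]
  have e3 : c • -(2 / c) • logOneSub (1 - D) = -logOneSub (1 - D) + -logOneSub (1 - D) := by
    rw [smul_smul, show c * -(2 / c) = -2 by field_simp]; module
  have hnL : (-logOneSub (1 - D)) 1 = 0 := by rw [dual_neg_apply, hL, neg_zero]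
  have hvY : pull (LinearMap.mulRight ℂ (v _)) (1 - D) = 0 := by
    rw [map_sub, one_mulRight one_apply_v, h.vD, sub_self]
  have hvL := mulRight_v_series hvY hY fun n => if n = 0 then 0 else -(1 / (n : ℂ))
  refine ⟨-(2 / c) • logOneSub (1 - D), exp (-logOneSub (1 - D)), ?_, ?_, ?_, ?_, ?_, ?_, ?_, ?_,
    ?_,
    ?_, ?_, ?_, ?_, ?_⟩
  · rw [dual_smul_apply, hL, mul_zero]
  · rw [e2, hexp]
  · rw [e1]
  · rw [e3, (filtration _).exp_add hnL hnL (Commute.refl _)]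
  · rw [dual_neg_smul, e3, neg_add, dual_neg_neg, (filtration _).exp_add hL hL (Commute.refl _),
      hexp]
  · nth_rw 1 [← hexp]; exact (filtration _).exp_mul_exp_neg hL
  · nth_rw 2 [← hexp]; exact (filtration _).exp_neg_mul_exp hL
  · exact fun X hX => (hcom X hX).smul_right _
  · exact fun X hX => (filtration _).commute_exp hnL (hcom X hX).neg_right
  · intro X hX
    rw [coproduct_smul, logOneSub, coproduct_series _ ((filtration _).locallyNilpotent hY)]
    refine (((filtration (.case16 c)).tensor (filtration (.case16 c))).commute_series _ ?_
      ?_).smul_right _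
    · rw [Algebra.TensorProduct.one_def, coproduct_tmul, mul_one, hY]
    · rw [coproduct_sub, coproduct_one, tens_one_one]
      exact (Commute.one_right X).sub_right hX
  · intro X hX
    rw [antipode_smul, logOneSub, antipode_series _ hY]
    refine ((filtration _).commute_series _ ?_ ?_).smul_right _
    · rw [antipode_sub, antipode_one, dual_sub_apply, one_apply_one]
      change 1 - D (HopfAlgebra.antipode ℂ 1) = 0
      rw [HopfAlgebra.antipode_one, h.values_D.1, sub_self]
    · rw [antipode_sub, antipode_one]
      exact (Commute.one_right X).sub_right hX
  · rw [map_smul, logOneSub, hvL, smul_zero]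
  · exact mulRight_v_series (by rw [map_neg, logOneSub, hvL, neg_zero]) hnL _
  · intro δ hδ h1 hpow W hW hDW
    rw [map_smul, derivation_logOneSub δ hδ hY (W := -W) h1 ?_ hpow ?_, dual_neg_neg]
    · exact (((Commute.one_left W).sub_left (Commute.symm hW)).neg_right)
    · rw [map_sub, h1, hDW, sub_sub_cancel, dual_mul_neg, zero_sub]

/-- The values on monomials of a functional whose translates are scalars, except for the translate
`Y` by `τ`, which in turn is killed by the translations by `m` and `τ`. -/
theorem apply_monomial_of_translation {q : Case} {X Y : Dual (QGalilei q)} {y₁ y₃ y₄ : ℂ}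
    (hm : pull (LinearMap.mulLeft ℂ (m q)) X = y₁ • 1)
    (hτ : pull (LinearMap.mulRight ℂ (τ q)) X = Y)
    (hv : pull (LinearMap.mulRight ℂ (v q)) X = y₃ • 1)
    (ha : pull (LinearMap.mulRight ℂ (a q)) X = y₄ • 1)
    (hmY : pull (LinearMap.mulLeft ℂ (m q)) Y = 0) (hτY : pull (LinearMap.mulRight ℂ (τ q)) Y = 0)
    (α β γ σ : ℕ) : X (monomial q α β γ σ) =
      (if α = 0 ∧ β = 0 ∧ γ = 0 ∧ σ = 0 then X 1 else 0) +
      (if α = 1 ∧ β = 0 ∧ γ = 0 ∧ σ = 0 then y₁ else 0) +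
      (if α = 0 ∧ β = 1 ∧ γ = 0 ∧ σ = 0 then Y 1 else 0) +
      (if α = 0 ∧ β = 0 ∧ γ = 0 ∧ σ = 1 then y₃ else 0) +
      (if α = 0 ∧ β = 0 ∧ γ = 1 ∧ σ = 0 then y₄ else 0) := by
  have r : ∀ {x : QGalilei q} (_ : (1 : Dual (QGalilei q)) x = 0) (y : ℂ),
      pull (LinearMap.mulRight ℂ x) (y • 1) = 0 := fun hx y => by
    rw [map_smul, one_mulRight hx, smul_zero]
  have l : ∀ y : ℂ, pull (LinearMap.mulLeft ℂ (m q)) (y • 1) = 0 := fun y => by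
    rw [map_smul, one_mulLeft one_apply_m, smul_zero]
  have e : ∀ (p : Prop) [Decidable p] (Z : Dual (QGalilei q)),
      (if p then Z else 0) 1 = if p then Z 1 else 0 := fun p _ Z => by split_ifs <;> rfl
  rw [apply_monomial, apply_monomial_left hm hτ hv ha (l _) hmY (l _) (l _) hτY (r one_apply_τ _)
    (r one_apply_τ _) (r one_apply_v _) (r one_apply_v _) (r one_apply_a _)]
  simp only [dual_add_apply, e, dual_smul_apply, one_apply_one, mul_one]

/-- The functionals `-i B D⁻¹`, `-(2i / c²) C D`, `-(2 / c) log D` and a primitive `K` with the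
right values on the generators are the dual generators. -/
theorem LogCoordinate.isDualGenerators (l : LogCoordinate D P E) (h : SLCoordinates A B C D)
    (hc : c ≠ 0) {K : Dual (QGalilei (.case16 c))} (hK : coproduct K = 1 ⊠ K + K ⊠ 1)
    (vK : HasValues K 0 0 0 (-I) 0) :
    IsDualGenerators (.case16 c) (-I • (B * E)) (-(2 * I / c ^ 2) • (C * D)) P K := by
  have lv : ∀ {X : Dual (QGalilei (.case16 c))}, pull (LinearMap.mulRight ℂ (v _)) X = 0 →
      pull (LinearMap.mulLeft ℂ (v _)) X = 0 := fun hX => (mulLeft_v_eq _).trans hX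
  have hvY : pull (LinearMap.mulRight ℂ (v _)) (1 - D) = 0 := by
    rw [map_sub, one_mulRight one_apply_v, h.vD, sub_self]
  have cancel : ∀ X : Dual (QGalilei (.case16 c)), D * X = 0 → X = 0 := fun X hX => by
    rw [← one_mul X, ← l.ED, mul_assoc, hX, mul_zero]
  have τE : pull (LinearMap.mulRight ℂ (τ _)) E = 0 := cancel _ (by
    have := mulRight_τ_mul D E
    rwa [l.DE, one_mulRight one_apply_τ, h.τD, zero_mul, zero_add, eq_comm] at this)
  have mE : pull (LinearMap.mulLeft ℂ (m _)) E = 0 := cancel _ (by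
    have := mulLeft_m_mul E (lv h.vD)
    rwa [l.DE, one_mulLeft one_apply_m, h.mD, zero_mul, zero_add, eq_comm] at this)
  have aE : pull (LinearMap.mulRight ℂ (a _)) E = -(I * c / 2) • E := by
    have := mulRight_a_mul E h.vD
    rw [l.DE, one_mulRight one_apply_a, h.aD, smul_mul_assoc, ← mul_smul_comm, ← mul_add] at this
    have := cancel _ this.symm
    rw [← sub_eq_zero, ← this]
    module
  have aP : pull (LinearMap.mulRight ℂ (a _)) P = -I • 1 := by
    rw [l.derivation _ (continuous_pull_mulRight _) (one_mulRight one_apply_a)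
      (fun n => by rw [pow_succ, mulRight_a_mul _ (mulRight_v_pow hvY n)])
      ((I * c / 2) • 1) (by simp) (by rw [h.aD, mul_smul_comm, mul_one]), smul_smul]
    congr 1
    field_simp
  have τP : pull (LinearMap.mulRight ℂ (τ _)) P = 0 := by
    rw [l.derivation _ (continuous_pull_mulRight _) (one_mulRight one_apply_τ)
      (fun n => by rw [pow_succ, mulRight_τ_mul])
      0 (by simp) (by rw [h.τD, mul_zero]), smul_zero]
  have mP : pull (LinearMap.mulLeft ℂ (m _)) P = 0 := by
    rw [l.derivation _ (continuous_pull_mulLeft _) (one_mulLeft one_apply_m)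
      (fun n => by rw [pow_succ, mulLeft_m_mul _ (lv (mulRight_v_pow hvY n))])
      0 (by simp) (by rw [h.mD, mul_zero]), smul_zero]
  have hK' : ∀ x y, K (x * y) = (1 : Dual _) x * K y + K x * (1 : Dual _) y := fun x y => by
    rw [← coproduct_tmul, hK, dual_add_apply, tens_tmul, tens_tmul]
  have rK : ∀ {x : QGalilei (.case16 c)} (_ : (1 : Dual _) x = 0),
      pull (LinearMap.mulRight ℂ x) K = K x • 1 := fun hx => dual_ext fun φ => by
    rw [pull_apply, LinearMap.mulRight_apply, hK', hx, dual_smul_apply]; ring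
  have lK : ∀ {x : QGalilei (.case16 c)} (_ : (1 : Dual _) x = 0),
      pull (LinearMap.mulLeft ℂ x) K = K x • 1 := fun hx => dual_ext fun φ => by
    rw [pull_apply, LinearMap.mulLeft_apply, hK', hx, dual_smul_apply]; ring
  have M1 : (-I • (B * E)) 1 = 0 := by
    rw [dual_smul_apply, mul_apply_one, h.values_B.1, zero_mul, mul_zero]
  have H1 : (-(2 * I / c ^ 2) • (C * D)) 1 = 0 := by
    rw [dual_smul_apply, mul_apply_one, h.values_C.1, zero_mul, mul_zero]
  have hM := apply_monomial_of_translation (X := -I • (B * E)) (Y := 0) (y₁ := -I) (y₃ := 0)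
    (y₄ := 0)
    (by rw [map_smul, mulLeft_m_mul _ (lv h.vB), h.mB, mE, mul_zero, add_zero, l.DE])
    (by rw [map_smul, mulRight_τ_mul, h.τB, τE, mul_zero, zero_mul, add_zero, smul_zero])
    (by rw [map_smul, mulRight_v_mul, h.vB, l.vE, mul_zero, zero_mul, add_zero, smul_zero,
      zero_smul])
    (by rw [map_smul, mulRight_a_mul _ h.vB, h.aB, aE, mul_smul_comm, smul_mul_assoc]; module)
    (map_zero _) (map_zero _)
  have hH := apply_monomial_of_translation (X := -(2 * I / c ^ 2) • (C * D)) (Y := I • (D * D))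
    (y₁ := 0) (y₃ := 0) (y₄ := 0)
    (by rw [map_smul, mulLeft_m_mul _ (lv h.vC), h.mC, h.mD, mul_zero, zero_mul, add_zero,
      smul_zero, zero_smul])
    (by
      rw [map_smul, mulRight_τ_mul, h.τC, h.τD, mul_zero, add_zero, smul_mul_assoc, smul_smul]
      congr 1
      field_simp)
    (by rw [map_smul, mulRight_v_mul, h.vC, h.vD, mul_zero, zero_mul, add_zero, smul_zero,
      zero_smul])
    (by rw [map_smul, mulRight_a_mul _ h.vC, h.aC, h.aD, mul_smul_comm, smul_mul_assoc]; module)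
    (by rw [map_smul, mulLeft_m_mul _ (lv h.vD), h.mD, mul_zero, zero_mul, add_zero, smul_zero])
    (by rw [map_smul, mulRight_τ_mul, h.τD, mul_zero, zero_mul, add_zero, smul_zero])
  have hP := apply_monomial_of_translation (X := P) (Y := 0) (y₁ := 0) (y₃ := 0) (y₄ := -I)
    (by rw [mP, zero_smul]) τP (by rw [l.vP, zero_smul]) aP (map_zero _) (map_zero _)
  have hKm := apply_monomial_of_translation (X := K) (Y := 0) (y₁ := 0) (y₃ := -I) (y₄ := 0)
    (by rw [lK one_apply_m, vK.2]) (by rw [rK one_apply_τ, vK.3, zero_smul])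
    (by rw [rK one_apply_v, vK.4]) (by rw [rK one_apply_a, vK.5]) (map_zero _) (map_zero _)
  have D1 : (I • (D * D)) 1 = I := by
    rw [dual_smul_apply, mul_apply_one, h.values_D.1, mul_one, mul_one]
  constructor <;> intro α β γ σ
  · rw [hM, M1]; simp
  · rw [hH, H1, D1]; simp
  · rw [hP, l.apply_one]; simp
  · rw [hKm, vK.1]; simp

end SpecialLinear

section SpecialLinear
variable {c : ℂ} {A B C D E P K : Dual (QGalilei (.case16 c))}

/-- The commutator with `K` acts on the coordinates of `SL₂` as an infinitesimal conjugation. -/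
theorem SLCoordinates.commutator (h : SLCoordinates A B C D) (hK : coproduct K = 1 ⊠ K + K ⊠ 1)
    (vK : HasValues K 0 0 0 (-I) 0) : K * B - B * K = 0 ∧
      K * C - C * K = -(c / 2) • (A - D) ∧ K * D - D * K = -(c / 2) • B := by
  have K2 : K (v _ ^ 2) = 0 := by
    rw [pow_two, ← coproduct_tmul, hK, dual_add_apply, tens_tmul, tens_tmul, one_apply_v]; ring
  have sq : ∀ {X : Dual (QGalilei (.case16 c))}, pull (LinearMap.mulRight ℂ (v _)) X = 0 →
      X (v _ ^ 2) = 0 := fun hX => by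
    have := congrArg (fun Z : Dual (QGalilei (.case16 c)) => Z (v _)) hX
    simpa only [pull_apply, LinearMap.mulRight_apply, pow_two, dual_zero_apply] using this
  have key := eq_of_coproduct_family (ι := Fin 4)
    (X := ![K * A - A * K, K * B - B * K, K * C - C * K, K * D - D * K])
    (Y := ![(c / 2) • B, 0, -(c / 2) • (A - D), -(c / 2) • B])
    (L := ![![A, 0, B, 0], ![0, A, 0, B], ![C, 0, D, 0], ![0, C, 0, D]])
    (R := ![![A, C, 0, 0], ![B, D, 0, 0], ![0, 0, A, C], ![0, 0, B, D]]) (T := 0) ?_ ?_ ?_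
  · exact ⟨congrFun key 1, congrFun key 2, congrFun key 3⟩
  · intro i
    fin_cases i <;>
      simp [Fin.sum_univ_four, coproduct_sub, coproduct_mul, h.ΔA, h.ΔB, h.ΔC, h.ΔD, hK, add_mul,
        mul_add, tens_mul_tens, tens_sub, sub_tens, zero_tens, tens_zero] <;>
      abel
  · intro i
    fin_cases i <;>
      simp [Fin.sum_univ_four, coproduct_sub, coproduct_smul, coproduct_neg, coproduct_zero, h.ΔA,
        h.ΔB, h.ΔD, tens_sub, sub_tens, zero_tens, tens_zero, tens_smul, smul_tens, tens_neg,
        neg_tens] <;>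
      module
  · intro i
    fin_cases i
    · exact ((vK.commutator h.values_A K2 (sq h.vA)).of_eq (by ring)
        (by linear_combination (exp := 1) (-c / 2) * Complex.I_sq) (by ring) (by ring)
        (by ring)).agree (h.values_B.smul (c / 2))
    · exact ((vK.commutator h.values_B K2 (sq h.vB)).of_eq (by ring) (by ring) (by ring) (by ring)
        (by ring)).agree .zero
    · exact (vK.commutator h.values_C K2 (sq h.vC)).agree
        (((h.values_A.sub h.values_D).smul (-(c / 2))).of_eq (by ring) (by ring) (by ring) (by ring)
          (by ring))
    · exact (vK.commutator h.values_D K2 (sq h.vD)).agree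
        ((h.values_B.smul (-(c / 2))).of_eq (by ring)
          (by linear_combination (exp := 1) (-c / 2) * Complex.I_sq) (by ring) (by ring) (by ring))

/-- The antipode inverts the matrix of the coordinates of `SL₂`. -/
theorem SLCoordinates.antipode_eq (h : SLCoordinates A B C D) :
    antipode B = -B ∧ antipode C = -C ∧ antipode D = A := by
  have eA := mulAntipode_coproduct A
  have eB := mulAntipode_coproduct B
  have eC := mulAntipode_coproduct C
  have eD := mulAntipode_coproduct D
  rw [h.ΔA, h.values_A.1, map_add, mulAntipode_tens, mulAntipode_tens, one_smul] at eA
  rw [h.ΔB, h.values_B.1, map_add, mulAntipode_tens, mulAntipode_tens, zero_smul] at eB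
  rw [h.ΔC, h.values_C.1, map_add, mulAntipode_tens, mulAntipode_tens, zero_smul] at eC
  rw [h.ΔD, h.values_D.1, map_add, mulAntipode_tens, mulAntipode_tens, one_smul] at eD
  have det1 : D * A - B * C = 1 := by rw [← h.AD, h.det]
  have det2 : A * D - C * B = 1 := by rw [← h.BC, h.det]
  refine ⟨?_, ?_, ?_⟩
  · calc antipode B = (D * A - B * C) * antipode B := by rw [det1, one_mul]
      _ = D * (A * antipode B + B * antipode D) - B * (C * antipode B + D * antipode D) := by
        rw [sub_mul, mul_add, mul_add, ← mul_assoc D B, ← h.BD]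
        simp only [mul_assoc]
        abel
      _ = -B := by rw [eB, eD, mul_zero, mul_one, zero_sub]
  · calc antipode C = (A * D - C * B) * antipode C := by rw [det2, one_mul]
      _ = A * (C * antipode A + D * antipode C) - C * (A * antipode A + B * antipode C) := by
        rw [sub_mul, mul_add, mul_add, ← mul_assoc A C, h.AC]
        simp only [mul_assoc]
        abel
      _ = -C := by rw [eC, eA, mul_zero, mul_one, zero_sub]
  · calc antipode D = (A * D - C * B) * antipode D := by rw [det2, one_mul]
      _ = A * (C * antipode B + D * antipode D) - C * (A * antipode B + B * antipode D) := by
        rw [sub_mul, mul_add, mul_add, ← mul_assoc A C, h.AC]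
        simp only [mul_assoc]
        abel
      _ = A := by rw [eB, eD, mul_zero, mul_one, sub_zero]

set_option maxHeartbeats 400000 in
theorem hasDual_case16 (c : ℂ) (hc : c ≠ 0) : HasDual (.case16 c) := by
  obtain ⟨A, B, C, D, h⟩ := exists_slCoordinates c
  obtain ⟨P, E, l⟩ := h.exists_log hc
  obtain ⟨K, hK, vK⟩ := exists_primitive (q := .case16 c) (xm := 0) (xτ := 0) (xv := -I) (xa := 0)
    (by constructor <;> simp [Case.brackets])
  have hD := l.isDualGenerators h hc hK vK
  obtain ⟨KB, KC, KD⟩ := h.commutator hK vK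
  obtain ⟨SB, SC, SD⟩ := h.antipode_eq
  have SK := antipode_of_primitive hK vK.1
  -- All products of coordinates are brought to the normal form `B * C * D` or `B * C * E`.
  have eA : A = E + B * C * E := by
    rw [← mul_one A, ← l.DE, ← mul_assoc, ← sub_eq_iff_eq_add, ← sub_mul, h.det, one_mul]
  have eCB := h.BC.symm
  have eDB := h.BD.symm
  have eDC := h.CD.symm
  have eEB := (l.commute_E B h.BD).symm
  have eEC := (l.commute_E C h.CD).symm
  have DE := l.DE
  have ED := l.ED
  have fCB : ∀ X, C * (B * X) = B * (C * X) := fun X => by rw [← mul_assoc, eCB, mul_assoc]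
  have fDB : ∀ X, D * (B * X) = B * (D * X) := fun X => by rw [← mul_assoc, eDB, mul_assoc]
  have fDC : ∀ X, D * (C * X) = C * (D * X) := fun X => by rw [← mul_assoc, eDC, mul_assoc]
  have fEB : ∀ X, E * (B * X) = B * (E * X) := fun X => by rw [← mul_assoc, eEB, mul_assoc]
  have fEC : ∀ X, E * (C * X) = C * (E * X) := fun X => by rw [← mul_assoc, eEC, mul_assoc]
  have fDE : ∀ X, D * (E * X) = X := fun X => by rw [← mul_assoc, DE, one_mul]
  have fED : ∀ X, E * (D * X) = X := fun X => by rw [← mul_assoc, ED, one_mul]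
  have KE : K * E - E * K = (c / 2) • (B * (E * E)) := by
    have e : E * (K * D - D * K) * E = -(K * E - E * K) := by
      simp only [mul_sub, sub_mul, mul_assoc, DE, fED, mul_one]; abel
    rw [← dual_neg_neg (K * E - E * K), ← e, KD]
    simp only [mul_smul_comm, smul_mul_assoc, mul_assoc, fEB]
    module
  have kCD : ∀ s t : ℂ, ((s • (C * D)) * (t • (B * E))) = (s * t) • (B * C) := fun s t => by
    rw [smul_mul_smul_comm]
    simp only [mul_assoc, fDB, DE, mul_one, eCB]
  have kBE : ∀ s t : ℂ, ((s • (B * E)) * (t • (C * D))) = (s * t) • (B * C) := fun s t => by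
    rw [smul_mul_smul_comm]
    simp only [mul_assoc, fEC, ED, mul_one]
  have PB := l.commute_P B h.BD
  have PC := l.commute_P C h.CD
  have PE := l.commute_P E (by rw [DE, ED])
  have PD := l.commute_P D rfl
  -- The argument of the geometric and logarithmic series in the coproducts.
  have hY : (c ^ 2 / 2) • (-(2 * I / c ^ 2) • (C * D) * exp (c • P)) ⊠ (-I • (B * E)) =
      -((C * E) ⊠ (B * E)) := by
    rw [l.exp_pos]
    simp only [smul_mul_assoc, mul_assoc, fDE, smul_tens, tens_smul, smul_smul]
    rw [show c ^ 2 / 2 * (-I * -(2 * I / c ^ 2)) = I * I by field_simp, Complex.I_mul_I]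
    module
  obtain ⟨Y, hYdef⟩ : ∃ Y, Y = -((C * E) ⊠ (B * E)) := ⟨_, rfl⟩
  rw [← hYdef] at hY
  have hY1 : Y 1 = 0 := by
    rw [hYdef, dual_neg_apply, Algebra.TensorProduct.one_def, tens_tmul, mul_apply_one,
      h.values_C.1]
    ring
  have ΔD : coproduct D = (D ⊠ D) * (1 - Y) := by
    rw [h.ΔD, hYdef, sub_neg_eq_add, mul_add, mul_one, tens_mul_tens, fDC, fDB, DE, mul_one,
      mul_one, add_comm]
  have ΔD' : coproduct D = (1 - Y) * (D ⊠ D) := by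
    rw [h.ΔD, hYdef, sub_neg_eq_add, add_mul, one_mul, tens_mul_tens, mul_assoc, mul_assoc, ED,
      mul_one, mul_one, add_comm]
  have ΔDE : coproduct D * coproduct E = 1 := by
    rw [← coproduct_mul, DE, coproduct_one, tens_one_one]
  have hy : ((c ^ 2 / 2) • (-I • (B * E) * -(2 * I / c ^ 2) • (C * D))) = -(B * C) := by
    rw [kBE, smul_smul,
      show c ^ 2 / 2 * (-I * -(2 * I / c ^ 2)) = I * I by field_simp, Complex.I_mul_I]
    module
  have hy' : ((c ^ 2 / 2) • (-(2 * I / c ^ 2) • (C * D) * -I • (B * E))) = -(B * C) := by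
    rw [kCD, mul_comm, ← hy, kBE]
  have hy1 : (-(B * C)) 1 = 0 := by
    rw [dual_neg_apply, mul_apply_one, h.values_B.1]; ring
  refine ⟨_, _, P, K, hD, ?_⟩
  constructor <;> simp only [Case.formulas, classical]
  case KM =>
    have e : K * (B * E) - B * E * K = (c / 2) • (B * (B * (E * E))) := by
      calc K * (B * E) - B * E * K = (K * B - B * K) * E + B * (K * E - E * K) := by
            simp only [sub_mul, mul_sub, mul_assoc]
            abel
        _ = _ := by rw [KB, KE, zero_mul, zero_add, mul_smul_comm]
    rw [mul_smul_comm, smul_mul_assoc, ← smul_sub, e, pow_two, smul_mul_smul_comm, smul_smul,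
      smul_smul]
    simp only [mul_assoc, fEB]
    congr 1
    linear_combination (exp := 1) (-I * c / 2) * Complex.I_sq
  case KP =>
    -- The commutator with `K` is a continuous derivation, and `[K, D] = D W` with `W` as below.
    let δ : Dual (QGalilei (.case16 c)) →ₗ[ℂ] Dual (QGalilei (.case16 c)) :=
      LinearMap.mulLeft ℂ K - LinearMap.mulRight ℂ K
    have hδ : ∀ X, δ X = K * X - X * K := fun X => rfl
    have leibniz : ∀ X Z : Dual (QGalilei (.case16 c)),
        K * (X * Z) - X * Z * K = (K * X - X * K) * Z + X * (K * Z - Z * K) := fun X Z => by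
      simp only [sub_mul, mul_sub, mul_assoc]
      abel
    have := l.derivation δ
      (fun k => ⟨k, fun X hX => sub_mem (Ideal.mul_mem_left _ _ hX) (Ideal.mul_mem_right _ _ hX)⟩)
      (by rw [hδ, mul_one, one_mul, sub_self])
      (fun n => by rw [hδ, hδ, hδ, pow_succ, leibniz]) (-(c / 2) • (B * E))
      (by simp only [mul_smul_comm, smul_mul_assoc, mul_assoc, fDB, DE, ED])
      (by rw [hδ, KD]; simp only [mul_smul_comm, fDB, DE, mul_one])
    rw [← hδ, this, smul_smul, smul_smul]
    congr 1
    field_simp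
    linear_combination (exp := 1) Complex.I_sq
  case KH =>
    have e : K * (C * D) - C * D * K = (c / 2) • (D * D - 1 - (2 : ℂ) • (B * C)) := by
      calc K * (C * D) - C * D * K = (K * C - C * K) * D + C * (K * D - D * K) := by
            simp only [sub_mul, mul_sub, mul_assoc]
            abel
        _ = _ := by
          rw [KC, KD, eA]
          simp only [mul_smul_comm, smul_mul_assoc, mul_assoc, sub_mul, add_mul, ED, mul_one, eCB]
          module
    rw [mul_smul_comm, smul_mul_assoc, ← smul_sub, e, l.exp_neg, kBE]
    match_scalars <;> field_simp
    simp
  case HP =>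
    rw [mul_smul_comm, smul_mul_assoc, ← smul_sub, mul_assoc, PD, ← mul_assoc, PC, mul_assoc,
      sub_self, smul_zero]
  case MP =>
    rw [mul_smul_comm, smul_mul_assoc, ← smul_sub, mul_assoc, PE, ← mul_assoc, PB, mul_assoc,
      sub_self, smul_zero]
  case MH =>
    rw [kBE, kCD, mul_comm, sub_self]
  case ΔM =>
    rw [hY, l.exp_pos]
    -- Multiplication by `ΔD = (1 - Y) (D ⊗ D)` removes the geometric series.
    have key : ((-I • (B * E)) ⊠ 1 + (E * E) ⊠ (-I • (B * E)) * invOneSub Y) * coproduct D =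
        -I • coproduct B := by
      rw [add_mul, mul_assoc _ (invOneSub Y), ΔD', ← mul_assoc (invOneSub Y),
        ((filtration _).tensor (filtration _)).invOneSub_mul_one_sub hY1, ← ΔD', one_mul, h.ΔD,
        h.ΔB, eA]
      simp only [mul_add, tens_mul_tens, smul_tens, tens_smul, smul_mul_assoc, mul_assoc, one_mul,
        ED, mul_one, eEC, add_tens]
      module
    rw [← mul_one (_ + _), ← ΔDE, ← mul_assoc, key, coproduct_smul, coproduct_mul, smul_mul_assoc]
  case ΔH =>
    rw [l.exp_pos, l.exp_neg, coproduct_smul, coproduct_mul, h.ΔC, h.ΔD, eA]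
    simp only [pow_two, add_mul, mul_add, tens_mul_tens, tens_add, smul_tens, tens_smul,
      mul_smul_comm, smul_mul_assoc, mul_assoc, mul_one, DE, ED, fDE, eCB, eDC, eEB, eEC, fCB, fDC,
      fEB, fEC]
    match_scalars <;> field_simp <;> simp [Complex.I_sq] <;> norm_num
  case ΔP =>
    rw [hY]
    have hp1 : (-(c / 2) • P) 1 = 0 := by rw [dual_smul_apply, l.apply_one, mul_zero]
    have hpn := (filtration _).locallyNilpotent hp1
    have hl1 := ((filtration _).tensor (filtration _)).logOneSub_apply_one hY1
    have cr : Commute (1 ⊠ (-(c / 2) • P)) Y := by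
      rw [Commute, SemiconjBy, hYdef, dual_mul_neg, dual_neg_mul]
      simp only [tens_mul_tens, one_mul, mul_one, smul_mul_assoc, mul_smul_comm,
        mul_assoc, PE]
      rw [← mul_assoc P, ← PB, mul_assoc]
    have cl : Commute ((-(c / 2) • P) ⊠ 1) Y := by
      rw [Commute, SemiconjBy, hYdef, dual_mul_neg, dual_neg_mul]
      simp only [tens_mul_tens, one_mul, mul_one, smul_mul_assoc, mul_smul_comm,
        mul_assoc, PE]
      rw [← mul_assoc P, ← PC, mul_assoc]
    have clr : Commute (1 ⊠ (-(c / 2) • P))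
        ((-(c / 2) • P) ⊠ (1 : Dual (QGalilei (.case16 c)))) := by
      simp only [Commute, SemiconjBy, tens_mul_tens, one_mul, mul_one]
    have cDD : Commute (D ⊠ D) Y := by
      have := ΔD.symm.trans ΔD'
      rw [mul_sub, sub_mul, mul_one, one_mul] at this
      exact sub_right_injective this
    have cD : Commute Y (coproduct D) := by
      rw [ΔD]
      exact cDD.symm.mul_right ((Commute.one_right Y).sub_right (Commute.refl Y))
    have crD : Commute (1 ⊠ (-(c / 2) • P)) (coproduct D) := by
      rw [ΔD]
      refine Commute.mul_right ?_ ((Commute.one_right _).sub_right cr)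
      simp only [Commute, SemiconjBy, tens_mul_tens, one_mul, mul_one, smul_mul_assoc,
        mul_smul_comm, PD]
    have clD : Commute ((-(c / 2) • P) ⊠ 1) (coproduct D) := by
      rw [ΔD]
      refine Commute.mul_right ?_ ((Commute.one_right _).sub_right cl)
      simp only [Commute, SemiconjBy, tens_mul_tens, one_mul, mul_one, smul_mul_assoc,
        mul_smul_comm, PD]
    have commute_log : ∀ X, Commute X Y → Commute X (logOneSub Y) := fun X hX =>
      ((filtration _).tensor (filtration _)).commute_series _ hY1 hX
    have r1 : ((1 : Dual (QGalilei (.case16 c))) ⊠ (-(c / 2) • P)) 1 = 0 := by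
      rw [Algebra.TensorProduct.one_def, tens_tmul, hp1, mul_zero]
    have l1 : ((-(c / 2) • P) ⊠ (1 : Dual (QGalilei (.case16 c)))) 1 = 0 := by
      rw [Algebra.TensorProduct.one_def, tens_tmul, hp1, zero_mul]
    -- Both sides commute and have the exponential `ΔD = (D ⊗ D) (1 - Y)`.
    have key : coproduct (-(c / 2) • P) =
        1 ⊠ (-(c / 2) • P) + (-(c / 2) • P) ⊠ 1 + logOneSub Y := by
      refine ((filtration _).tensor (filtration _)).exp_injective_of_commute ?_ ?_ ?_ ?_
      · rw [Algebra.TensorProduct.one_def, coproduct_tmul, mul_one, hp1]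
      · rw [dual_add_apply, dual_add_apply, r1, l1, hl1, add_zero, add_zero]
      · rw [coproduct_smul]
        refine Commute.smul_left (Commute.symm (l.commute_coproduct _ ?_)) _
        exact (crD.add_left clD).add_left (commute_log _ cD.symm).symm
      · rw [← coproduct_exp hpn, l.exp_neg_half,
          ((filtration _).tensor (filtration _)).exp_add
            (by rw [dual_add_apply, r1, l1, add_zero]) hl1 (commute_log _ (cr.add_left cl)),
          ((filtration _).tensor (filtration _)).exp_add r1 l1 clr, exp_one_tens hpn,
          exp_tens_one hpn, l.exp_neg_half,
            ((filtration _).tensor (filtration _)).exp_logOneSub hY1,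
          tens_mul_tens, one_mul, mul_one, ΔD]
    calc coproduct P = -(2 / c) • coproduct (-(c / 2) • P) := by
          rw [coproduct_smul, smul_smul, show -(2 / c) * -(c / 2) = 1 by field_simp, one_smul]
      _ = _ := by
          rw [key, tens_smul, smul_tens]
          match_scalars <;> field_simp
  case ΔK => exact hK
  case SM =>
    rw [hy, l.exp_neg]
    have SE : antipode E = D * invOneSub (-(B * C)) := by
      have e1 : antipode E * A = 1 := by rw [← SD, ← antipode_mul, DE, antipode_one]
      have e2 : A * D = 1 - -(B * C) := by rw [sub_neg_eq_add, ← h.det]; abel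
      rw [← one_mul D, ← e1, mul_assoc _ A, e2, mul_assoc,
        (filtration _).one_sub_mul_invOneSub hy1, mul_one]
    have cB : Commute B (invOneSub (-(B * C))) := (filtration _).commute_series _ hy1
      (((Commute.refl B).mul_right h.BC).neg_right)
    rw [antipode_smul, antipode_mul, SE, SB, dual_mul_neg, mul_assoc D, ← cB.eq]
    simp only [smul_mul_assoc, dual_neg_mul, mul_assoc, fDB, fED]
    module
  case SH =>
    rw [l.exp_pos, antipode_smul, antipode_mul, SC, SD, eA]
    simp only [pow_two, add_mul, smul_mul_assoc, mul_smul_comm, dual_mul_neg, mul_assoc, fDE, fED,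
      eEC, fEC, fDC]
    match_scalars <;> field_simp
    simp [Complex.I_sq]
  case SP =>
    rw [hy']
    have S1 : ∀ {X : Dual (QGalilei (.case16 c))}, X 1 = 0 → antipode X 1 = 0 := fun {X} hX => by
      change X (HopfAlgebra.antipode ℂ 1) = 0
      rw [HopfAlgebra.antipode_one, hX]
    have hp1 : (-(c / 2) • P) 1 = 0 := by rw [dual_smul_apply, l.apply_one, mul_zero]
    have hp1' : ((c / 2) • P) 1 = 0 := by rw [dual_smul_apply, l.apply_one, mul_zero]
    have hl1 := (filtration _).logOneSub_apply_one hy1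
    have cP : Commute ((c / 2) • P) (logOneSub (-(B * C))) := (filtration _).commute_series _ hy1
      ((Commute.mul_right PB.symm PC.symm).neg_right.smul_left _)
    have cA : Commute A (logOneSub (-(B * C))) := (filtration _).commute_series _ hy1
      ((Commute.mul_right h.AB h.AC).neg_right)
    -- Both sides commute and have the exponential `A = E (1 + B C)`.
    have key : antipode (-(c / 2) • P) = (c / 2) • P + logOneSub (-(B * C)) := by
      refine (filtration _).exp_injective_of_commute (S1 hp1)
        (by rw [dual_add_apply, hp1', hl1, add_zero]) ?_ ?_
      · rw [antipode_smul]
        refine Commute.smul_left (Commute.symm (l.commute_antipode _ ?_)) _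
        rw [SD]
        exact ((Commute.smul_left (Commute.symm (l.commute_P A h.AD)) _).add_left cA.symm)
      · rw [(filtration _).exp_add hp1' hl1 cP, l.exp_half, (filtration _).exp_logOneSub hy1, exp,
          ← antipode_series _ hp1, ← exp, l.exp_neg_half, SD, eA]
        simp only [sub_neg_eq_add, mul_add, mul_one, fEB, eEC, mul_assoc]
    calc antipode P = -(2 / c) • antipode (-(c / 2) • P) := by
          rw [antipode_smul, smul_smul, show -(2 / c) * -(c / 2) = 1 by field_simp, one_smul]
      _ = _ := by
          rw [key]
          match_scalars <;> field_simp
  case SK => exact SK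

end SpecialLinear

/-! ### All cases -/

theorem hasDual {q : Case} (hq : q.Nondegenerate) : HasDual q := by
  cases q with
  | case1 c => exact hasDual_case1 c
  | case2 c => exact hasDual_case2 c hq
  | case3 c => exact hasDual_case3 c
  | case4 c => exact hasDual_case4 c
  | case5 c => exact hasDual_case5 c
  | case6 c₁ c₂ => exact hasDual_case6 c₁ c₂ hq
  | case7 c₁ c₂ => exact hasDual_case7 c₁ c₂ hq
  | case8 c₁ c₂ => exact hasDual_case8 c₁ c₂
  | case9 c₁ c₂ c₃ => exact hasDual_case9 c₁ c₂ c₃ hq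
  | case10 c₁ c₂ => exact hasDual_case10 c₁ c₂
  | case11 c₁ c₂ => exact hasDual_case11 c₁ c₂ hq
  | case12 c₁ c₂ => exact hasDual_case12 c₁ c₂ hq
  | case13 c₁ c₂ => exact hasDual_case13 c₁ c₂ hq
  | case14 c₁ c₂ c₃ => exact hasDual_case14 c₁ c₂ c₃ hq
  | case15 c₁ c₂ c₃ => exact hasDual_case15 c₁ c₂ c₃ hq.1 hq.2
  | case16 c => exact hasDual_case16 c hq

end QGalilei

end QuantumGalilei

end

open QuantumGalilei

theorem mainTheorem2 (q : Case) (hq : q.Nondegenerate) :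
    (Submodule.span ℂ
        {φ : QGalilei q | ∃ α β γ σ : ℕ, φ = QGalilei.monomial q α β γ σ} = ⊤) ∧
    (∀ X : Dual (QGalilei q), X 1 = 0 → LocallyNilpotent X) ∧
    (∀ Z : Dual (QGalilei q ⊗[ℂ] QGalilei q), Z 1 = 0 → LocallyNilpotent Z) ∧
    ∃ M H P K : Dual (QGalilei q), QGalilei.IsDualGenerators q M H P K ∧
      K * M - M * K = (q.formulas M H P K).KM ∧
      K * P - P * K = (q.formulas M H P K).KP ∧
      K * H - H * K = (q.formulas M H P K).KH ∧
      H * P - P * H = (q.formulas M H P K).HP ∧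
      M * P - P * M = (q.formulas M H P K).MP ∧
      M * H - H * M = (q.formulas M H P K).MH ∧
      coproduct M = (q.formulas M H P K).ΔM ∧
      coproduct H = (q.formulas M H P K).ΔH ∧
      coproduct P = (q.formulas M H P K).ΔP ∧
      coproduct K = (q.formulas M H P K).ΔK ∧
      antipode M = (q.formulas M H P K).SM ∧
      antipode H = (q.formulas M H P K).SH ∧
      antipode P = (q.formulas M H P K).SP ∧
      antipode K = (q.formulas M H P K).SK ∧
      counit M = 0 ∧ counit H = 0 ∧ counit P = 0 ∧ counit K = 0 := by
  refine ⟨QGalilei.span_monomial q, fun X => (QGalilei.filtration q).locallyNilpotent,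
    fun Z hZ => ((QGalilei.filtration q).tensor (QGalilei.filtration q)).locallyNilpotent hZ, ?_⟩
  obtain ⟨M, H, P, K, hD, h⟩ := QGalilei.hasDual hq
  exact ⟨M, H, P, K, hD, h.KM, h.KP, h.KH, h.HP, h.MP, h.MH, h.ΔM, h.ΔH, h.ΔP, h.ΔK, h.SM, h.SH,
    h.SP, h.SK, hD.values_M.1, hD.values_H.1, hD.values_P.1, hD.values_K.1⟩
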